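/- For $0<\alpha\le 1$ and $0<\lambda<1$ let $\zeta_L(s,\alpha,\lambda)$ be the entire continuation of $\sum_{n=0}^{\infty}e^{2\pi i n\lambda}(n+\alpha)^{-s}$ ($\operatorname{Re}s>1$), and let $\zeta_H(s,\alpha)$ be the Hurwitz zeta-function, the meromorphic continuation of $\sum_{n=0}^{\infty}(n+\alpha)^{-s}$. Let $s=\sigma+it$ with $0\le\sigma\le1$, and let $x\ge1$, $y\ge1$ be real with $2\pi xy=|t|$. Then for all $0<\alpha\le1$, $0<\lambda<1$, $$\zeta_L(s,\alpha,\lambda)=\sum_{0\le n\le x}\frac{e^{2\pi i n\lambda}}{(n+\alpha)^s}+\frac{\Gamma(1-s)}{(2\pi)^{1-s}}\left\{e^{\{(1-s)/2-2\alpha\lambda\}\pi i}\sum_{0\le n\le y}\frac{e^{2\pi i n(1-\alpha)}}{(n+\lambda)^{1-s}}+e^{\{-(1-s)/2+2\alpha(1-\lambda)\}\pi i}\sum_{0\le n\le y}\frac{e^{2\pi i n\alpha}}{(n+1-\lambda)^{1-s}}\right\}+O(x^{-\sigma})+O(|t|^{1/2-\sigma}y^{\sigma-1}),$$ and for all $0<\alpha\le1$,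 $$\zeta_H(s,\alpha)=\sum_{0\le n\le x}\frac{1}{(n+\alpha)^s}+\frac{\Gamma(1-s)}{(2\pi)^{1-s}}\left\{e^{\frac{\pi i}{2}(1-s)}\sum_{1\le n\le y}\frac{e^{2\pi i n(1-\alpha)}}{n^{1-s}}+e^{-\frac{\pi i}{2}(1-s)}\sum_{1\le n\le y}\frac{e^{2\pi i n\alpha}}{n^{1-s}}\right\}+O(x^{-\sigma})+O(|t|^{1-\sigma}y^{\sigma-1}).$$ The constants implied by the $O$-symbols are absolute. -/

import Mathlib

/-! ## The Lerch zeta-function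

For real `α > 0` and non-integer real `lam`, the Dirichlet series
`∑ n ≥ 0, exp (2 π i n lam) / (n + α) ^ s`, absolutely convergent for `Re s > 1`, extends to an
entire function of `s`. -/

/-- `Z` is the entire function that continues the Lerch series
`∑ n ≥ 0, exp (2 π i n lam) / (n + α) ^ s` from the half-plane `Re s > 1`. -/
def IsLerchContinuation (α lam : ℝ) (Z : ℂ → ℂ) : Prop :=
  Differentiable ℂ Z ∧ ∀ s : ℂ, 1 < s.re →
    HasSum (fun n : ℕ =>
      Complex.exp (2 * Real.pi * Complex.I * n * lam) / ((n : ℂ) + α) ^ s) (Z s)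

open Classical in
/-- The Lerch zeta-function `ζ_L(s, α, lam)` for `α > 0` and non-integer `lam`: the entire
continuation of its Dirichlet series. It exists by `exists_isLerchContinuation` and is unique by
`IsLerchContinuation.unique`. -/
noncomputable def lerchZeta (α lam : ℝ) (s : ℂ) : ℂ :=
  if h : ∃ Z, IsLerchContinuation α lam Z then h.choose s else 0

/-! ### Existence and uniqueness of the continuation -/

namespace LerchContinuation

open Complex Set Filter Topology MeasureTheory Asymptotics

/-- Integrands of the Mellin transforms: `exp (-β t) / (1 - q exp (-t)) ^ m`. -/
noncomputable def kern (q : ℂ) (β : ℝ) (m : ℕ) (t : ℝ) : ℂ :=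
  cexp (-(β * t : ℝ)) * ((1 - q * cexp (-t)) ^ m)⁻¹

/-- The continuation to `Re s > -k` of the normalised Mellin transform of `kern`. -/
noncomputable def aux (q : ℂ) : ℕ → ℝ → ℕ → ℂ → ℂ
  | 0, β, m, s => mellin (kern q β m) s / Complex.Gamma s
  | k + 1, β, m, s => β * aux q k β m (s + 1) + m * q * aux q k (β + 1) (m + 1) (s + 1)

variable {q : ℂ}

theorem den_ne (hq : ‖q‖ = 1) (hq1 : q ≠ 1) (t : ℝ) : 1 - q * cexp (-t) ≠ 0 := by
  intro h
  have h1 : q * cexp (-t) = 1 := (sub_eq_zero.mp h).symm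
  have h2 := congrArg norm h1
  rw [norm_mul, hq, one_mul, norm_one, Complex.norm_exp] at h2
  have h3 : t = 0 := by simpa using h2
  apply hq1
  simpa [h3] using h1

theorem kern_continuous (hq : ‖q‖ = 1) (hq1 : q ≠ 1) (β : ℝ) (m : ℕ) :
    Continuous (kern q β m) := by
  unfold kern
  refine Continuous.mul (by fun_prop) (Continuous.inv₀ (by fun_prop) fun t => ?_)
  exact pow_ne_zero _ (den_ne hq hq1 t)

theorem kern_isBigO_top (β : ℝ) (m : ℕ) :
    kern q β m =O[atTop] fun t : ℝ => Real.exp (-β * t) := by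
  have h0 : Tendsto (fun t : ℝ => cexp (-(t : ℂ))) atTop (𝓝 0) := by
    rw [tendsto_zero_iff_norm_tendsto_zero]
    simpa [Complex.norm_exp] using Real.tendsto_exp_neg_atTop_nhds_zero
  have h1 : Tendsto (fun t : ℝ => ((1 - q * cexp (-t)) ^ m)⁻¹) atTop (𝓝 1) := by
    have := ((((h0.const_mul q).const_sub 1).pow m).inv₀ (by simp))
    simpa using this
  have h2 := h1.isBigO_one ℝ
  have h3 : (fun t : ℝ => cexp (-(β * t : ℝ))) =O[atTop] fun t : ℝ => Real.exp (-β * t) := by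
    refine IsBigO.of_bound 1 (Eventually.of_forall fun t => ?_)
    rw [Complex.norm_exp, Real.norm_of_nonneg (Real.exp_pos _).le]
    simp
  refine (h3.mul h2).congr_right fun t => ?_
  rw [mul_one]

theorem kern_isBigO_zero (hq : ‖q‖ = 1) (hq1 : q ≠ 1) (β : ℝ) (m : ℕ) :
    kern q β m =O[𝓝[>] 0] fun t : ℝ => t ^ (-(0 : ℝ)) := by
  have h := ((kern_continuous hq hq1 β m).tendsto 0).mono_left
    (nhdsWithin_le_nhds : 𝓝[>] (0 : ℝ) ≤ 𝓝 0)
  simpa using h.isBigO_one ℝ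

theorem kern_convergent (hq : ‖q‖ = 1) (hq1 : q ≠ 1) {β : ℝ} (hβ : 0 < β) (m : ℕ) {s : ℂ}
    (hs : 0 < s.re) : MellinConvergent (kern q β m) s :=
  mellinConvergent_of_isBigO_rpow_exp hβ
    ((kern_continuous hq hq1 β m).locallyIntegrable.locallyIntegrableOn _)
    (kern_isBigO_top β m) (kern_isBigO_zero hq hq1 β m) hs

theorem kern_differentiableAt (hq : ‖q‖ = 1) (hq1 : q ≠ 1) {β : ℝ} (hβ : 0 < β) (m : ℕ) {s : ℂ}
    (hs : 0 < s.re) : DifferentiableAt ℂ (mellin (kern q β m)) s :=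
  mellin_differentiableAt_of_isBigO_rpow_exp hβ
    ((kern_continuous hq hq1 β m).locallyIntegrable.locallyIntegrableOn _)
    (kern_isBigO_top β m) (kern_isBigO_zero hq hq1 β m) hs

theorem kern_hasDerivAt (hq : ‖q‖ = 1) (hq1 : q ≠ 1) (β : ℝ) (m : ℕ) (t : ℝ) :
    HasDerivAt (kern q β m)
      (-(β * kern q β m t + m * q * kern q (β + 1) (m + 1) t)) t := by
  have ht : HasDerivAt (fun t : ℝ => (t : ℂ)) 1 t := Complex.ofRealCLM.hasDerivAt
  have hE : HasDerivAt (fun t : ℝ => cexp (-(t : ℂ))) (-cexp (-(t : ℂ))) t := by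
    simpa using ht.neg.cexp
  have hB : HasDerivAt (fun t : ℝ => cexp (-(β * t : ℝ))) (-β * cexp (-(β * t : ℝ))) t := by
    have := (ht.const_mul (-(β : ℂ))).cexp
    convert! this using 1
    · ext x; simp
    · simp; ring
  have hD : HasDerivAt (fun t : ℝ => 1 - q * cexp (-(t : ℂ))) (q * cexp (-(t : ℂ))) t := by
    simpa using (hE.const_mul q).const_sub 1
  have hne := den_ne hq hq1 t
  have h := hB.mul ((hD.pow m).inv (pow_ne_zero m hne))
  refine h.congr_deriv ?_
  have hsplit : cexp (-((β + 1) * t : ℝ)) = cexp (-(β * t : ℝ)) * cexp (-(t : ℂ)) := by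
    rw [← Complex.exp_add]; congr 1; push_cast; ring
  simp only [kern, Pi.pow_apply, Pi.inv_apply, hsplit]
  rcases m with _ | m
  · simp
  · simp only [Nat.add_sub_cancel]
    field_simp
    ring

theorem mellin_kern (hq : ‖q‖ = 1) (hq1 : q ≠ 1) {β : ℝ} (hβ : 0 < β) (m : ℕ) {s : ℂ}
    (hs : 0 < s.re) : s * mellin (kern q β m) s =
      β * mellin (kern q β m) (s + 1) + m * q * mellin (kern q (β + 1) (m + 1)) (s + 1) := by
  have hs0 : s ≠ 0 := fun h => by simp [h] at hs
  have hs1 : 0 < (s + 1).re := by simp; linarith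
  have c0 := kern_convergent hq hq1 hβ m hs
  have c1 := kern_convergent hq hq1 hβ m hs1
  have c2 := kern_convergent hq hq1 (by linarith : 0 < β + 1) (m + 1) hs1
  simp only [MellinConvergent, add_sub_cancel_right, smul_eq_mul] at c0 c1 c2
  have hv : ∀ x ∈ Ioi (0 : ℝ), HasDerivAt (fun x : ℝ => (x : ℂ) ^ s) (s * (x : ℂ) ^ (s - 1)) x := by
    intro x hx
    exact hasDerivAt_ofReal_cpow_const (ne_of_gt hx) hs0
  have key := integral_Ioi_mul_deriv_eq_deriv_mul (a := (0 : ℝ)) (a' := 0) (b' := 0)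
    (u := kern q β m) (v := fun x : ℝ => (x : ℂ) ^ s)
    (u' := fun t => -(β * kern q β m t + m * q * kern q (β + 1) (m + 1) t))
    (v' := fun x : ℝ => s * (x : ℂ) ^ (s - 1))
    (fun x _ => kern_hasDerivAt hq hq1 β m x) hv ?_ ?_ ?_ ?_
  · simp only [mellin, add_sub_cancel_right, smul_eq_mul]
    rw [← integral_const_mul, ← integral_const_mul, ← integral_const_mul,
      ← integral_add (c1.const_mul _) (c2.const_mul _)]
    calc _ = ∫ x in Ioi (0 : ℝ), kern q β m x * (s * (x : ℂ) ^ (s - 1)) := by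
          congr 1; ext x; ring
      _ = _ := by
          rw [key, sub_self, zero_sub, ← integral_neg]
          congr 1; ext x; ring
  · refine IntegrableOn.congr_fun (c0.const_mul s) (fun x _ => ?_) measurableSet_Ioi
    simp only [Pi.mul_apply]; ring
  · refine IntegrableOn.congr_fun ((c1.const_mul (β : ℂ)).add (c2.const_mul (m * q))).neg
      (fun x _ => ?_) measurableSet_Ioi
    simp only [Pi.mul_apply, Pi.add_apply, Pi.neg_apply]; ring
  · have h1 := ((kern_continuous hq hq1 β m).tendsto 0).mono_left
      (nhdsWithin_le_nhds : 𝓝[>] (0 : ℝ) ≤ 𝓝 0)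
    have h2 : Tendsto (fun x : ℝ => (x : ℂ) ^ s) (𝓝[>] 0) (𝓝 0) := by
      have := (Complex.continuousAt_ofReal_cpow_const 0 s (Or.inl hs)).tendsto
      simp only [ofReal_zero, Complex.zero_cpow hs0] at this
      exact this.mono_left nhdsWithin_le_nhds
    have h3 := h1.mul h2
    rw [mul_zero] at h3
    exact h3
  · have h1 := kern_isBigO_top (q := q) β m
    have h2 : (fun x : ℝ => (x : ℂ) ^ s) =O[atTop] fun x : ℝ => x ^ s.re := by
      refine IsBigO.of_bound 1 ?_
      filter_upwards [eventually_gt_atTop 0] with x hx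
      rw [Complex.norm_cpow_eq_rpow_re_of_pos hx, one_mul]
      exact le_abs_self _
    refine (h1.mul h2).trans_tendsto ?_
    have := tendsto_rpow_mul_exp_neg_mul_atTop_nhds_zero s.re β hβ
    refine this.congr fun x => mul_comm _ _

theorem aux_one (hq : ‖q‖ = 1) (hq1 : q ≠ 1) {β : ℝ} (hβ : 0 < β) (m : ℕ) {s : ℂ}
    (hs : 0 < s.re) : aux q 1 β m s = aux q 0 β m s := by
  have hs0 : s ≠ 0 := fun h => by simp [h] at hs
  have hG : Complex.Gamma s ≠ 0 := Complex.Gamma_ne_zero_of_re_pos hs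
  have h := mellin_kern hq hq1 hβ m hs
  simp only [aux]
  rw [Complex.Gamma_add_one s hs0]
  field_simp
  rw [h]

theorem aux_succ (hq : ‖q‖ = 1) (hq1 : q ≠ 1) (k : ℕ) : ∀ {β : ℝ}, 0 < β → ∀ (m : ℕ) {s : ℂ},
    -(k : ℝ) < s.re → aux q (k + 1) β m s = aux q k β m s := by
  induction k with
  | zero => intro β hβ m s hs; exact aux_one hq hq1 hβ m (by simpa using hs)
  | succ k ih =>
    intro β hβ m s hs
    have hs' : -(k : ℝ) < (s + 1).re := by push_cast at hs; simp; linarith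
    rw [aux, ih hβ m hs', ih (by linarith) (m + 1) hs']
    rfl

theorem aux_add (hq : ‖q‖ = 1) (hq1 : q ≠ 1) (k j : ℕ) {β : ℝ} (hβ : 0 < β) (m : ℕ) {s : ℂ}
    (hs : -(k : ℝ) < s.re) : aux q (k + j) β m s = aux q k β m s := by
  induction j with
  | zero => rfl
  | succ j ih =>
    rw [← add_assoc, aux_succ hq hq1 (k + j) hβ m, ih]
    push_cast
    have : (0 : ℝ) ≤ j := by positivity
    linarith

theorem aux_differentiableAt (hq : ‖q‖ = 1) (hq1 : q ≠ 1) (k : ℕ) : ∀ {β : ℝ}, 0 < β →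
    ∀ (m : ℕ) {s : ℂ}, -(k : ℝ) < s.re → DifferentiableAt ℂ (aux q k β m) s := by
  induction k with
  | zero =>
    intro β hβ m s hs
    have hs : 0 < s.re := by simpa using hs
    have h := (kern_differentiableAt hq hq1 hβ m hs).mul
      (Complex.differentiable_one_div_Gamma.differentiableAt (x := s))
    refine h.congr_of_eventuallyEq (Eventually.of_forall fun z => ?_)
    simp [aux, div_eq_mul_inv]
  | succ k ih =>
    intro β hβ m s hs
    have hs' : -(k : ℝ) < (s + 1).re := by push_cast at hs; simp; linarith
    have h1 : DifferentiableAt ℂ (fun z => aux q k β m (z + 1)) s :=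
      (ih hβ m hs').comp s (by fun_prop)
    have h2 : DifferentiableAt ℂ (fun z => aux q k (β + 1) (m + 1) (z + 1)) s :=
      (ih (by linarith) (m + 1) hs').comp s (by fun_prop)
    exact (h1.const_mul _).add (h2.const_mul _)

theorem exists_entire (hq : ‖q‖ = 1) (hq1 : q ≠ 1) {β : ℝ} (hβ : 0 < β) (m : ℕ) :
    ∃ Z : ℂ → ℂ, Differentiable ℂ Z ∧ ∀ s : ℂ, 0 < s.re → Z s = aux q 0 β m s := by
  have hlt : ∀ s : ℂ, -((⌊-s.re⌋₊ + 1 : ℕ) : ℝ) < s.re := fun s => by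
    have := Nat.lt_floor_add_one (-s.re)
    push_cast
    linarith
  refine ⟨fun s => aux q (⌊-s.re⌋₊ + 1) β m s, fun s₀ => ?_, fun s hs => ?_⟩
  · set K := ⌊-s₀.re⌋₊ + 1 with hK
    refine (aux_differentiableAt hq hq1 K hβ m (hlt s₀)).congr_of_eventuallyEq ?_
    have hev : ∀ᶠ s : ℂ in 𝓝 s₀, -(K : ℝ) < s.re :=
      Complex.continuous_re.continuousAt.eventually (lt_mem_nhds (hlt s₀))
    filter_upwards [hev] with s hs
    have h1 : ⌊-s.re⌋₊ + 1 ≤ K := by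
      have : ⌊-s.re⌋₊ < K := (Nat.floor_lt' (by omega)).mpr (by linarith)
      omega
    obtain ⟨j, hj⟩ := Nat.exists_eq_add_of_le h1
    rw [hj, aux_add hq hq1 _ j hβ m (hlt s)]
  · have := aux_add hq hq1 0 (⌊-s.re⌋₊ + 1) hβ m (s := s) (by simpa using hs)
    rwa [zero_add] at this

theorem hasSum_aux (hq : ‖q‖ = 1) {β : ℝ} (hβ : 0 < β) {s : ℂ} (hs : 1 < s.re) :
    HasSum (fun n : ℕ => q ^ n / ((n : ℂ) + β) ^ s) (aux q 0 β 1 s) := by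
  have hs0 : 0 < s.re := by linarith
  have hG : Complex.Gamma s ≠ 0 := Complex.Gamma_ne_zero_of_re_pos hs0
  have hpos : ∀ n : ℕ, 0 < (n : ℝ) + β := fun n => by positivity
  have h := hasSum_mellin (a := fun n : ℕ => q ^ n) (p := fun n : ℕ => (n : ℝ) + β)
    (F := kern q β 1) (s := s) (fun n => Or.inr (hpos n)) hs0 ?_ ?_
  · have h2 := h.div_const (Complex.Gamma s)
    simp only [aux]
    refine h2.congr_fun ?_
    intro n
    push_cast
    field_simp
  · intro t ht
    have ht : 0 < t := ht
    have hlt : ‖q * cexp (-t)‖ < 1 := by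
      rw [norm_mul, hq, one_mul, Complex.norm_exp]
      simpa using ht
    have hg := (hasSum_geometric_of_norm_lt_one hlt).mul_left (cexp (-(β * t : ℝ)))
    simp only [kern, pow_one]
    refine hg.congr_fun ?_
    intro n
    rw [mul_pow, ← Complex.exp_nat_mul, mul_left_comm, ← Complex.exp_add, Complex.ofReal_exp]
    congr 2
    push_cast
    ring
  · simp only [norm_pow, hq, one_pow]
    have := (Real.summable_one_div_nat_add_rpow β s.re).mpr hs
    refine this.congr fun n => ?_
    rw [abs_of_pos (hpos n)]

end LerchContinuation

theorem exists_isLerchContinuation {α lam : ℝ} (hα : 0 < α) (h0 : 0 < lam) (h1 : lam < 1) :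
    ∃ Z, IsLerchContinuation α lam Z := by
  have hq : ‖Complex.exp (2 * Real.pi * Complex.I * lam)‖ = 1 := by
    simp [Complex.norm_exp]
  have hq1 : Complex.exp (2 * Real.pi * Complex.I * lam) ≠ 1 := by
    rw [Ne, Complex.exp_eq_one_iff]
    rintro ⟨n, hn⟩
    have h2 : (2 * Real.pi * Complex.I : ℂ) ≠ 0 := Complex.two_pi_I_ne_zero
    have h3 : (lam : ℂ) = n := mul_left_cancel₀ h2 (by rw [hn]; ring)
    have h4 : lam = n := by exact_mod_cast h3
    rw [h4] at h0 h1
    have h5 : (0 : ℤ) < n := by exact_mod_cast h0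
    have h6 : n < (1 : ℤ) := by exact_mod_cast h1
    omega
  obtain ⟨Z, hZ, hZs⟩ := LerchContinuation.exists_entire hq hq1 hα 1
  refine ⟨Z, hZ, fun s hs => ?_⟩
  rw [hZs s (by linarith)]
  refine (LerchContinuation.hasSum_aux hq hα hs).congr_fun fun n => ?_
  rw [← Complex.exp_nat_mul]
  congr 2
  ring

theorem lerchZeta_spec {α lam : ℝ} (hα : 0 < α) (h0 : 0 < lam) (h1 : lam < 1) :
    IsLerchContinuation α lam (lerchZeta α lam) := by
  have h := exists_isLerchContinuation hα h0 h1
  have h2 : lerchZeta α lam = h.choose := by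
    funext s
    simp only [lerchZeta, dif_pos h]
  rw [h2]
  exact h.choose_spec

theorem IsLerchContinuation.unique {α lam : ℝ} {Z W : ℂ → ℂ} (hZ : IsLerchContinuation α lam Z)
    (hW : IsLerchContinuation α lam W) : Z = W := by
  refine AnalyticOnNhd.eq_of_eventuallyEq (z₀ := 2)
    (fun z _ => hZ.1.analyticAt z) (fun z _ => hW.1.analyticAt z) ?_
  have h : ∀ᶠ s : ℂ in nhds 2, (1 : ℝ) < s.re :=
    Complex.continuous_re.continuousAt.eventually (lt_mem_nhds (by norm_num))
  filter_upwards [h] with s hs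
  exact (hZ.2 s hs).unique (hW.2 s hs)

/-!
Write `q(z) = exp (2πi (z - α))`. By the residue theorem the tail `n + α > X` of the Lerch series is
the integral of `z ^ (-s) * q(z) ^ lam / (1 - q(z))` along the oblique line `X + r (1 + i)`, and this
integral continues the tail to `Re s > 0` (`lerchZeta_sub_sum_eq_integral`); for `lam = 0`, the Hurwitz
zeta-function, the same holds after the term `X ^ (1 - s) / (1 - s)` has been split off
(`hurwitzZeta_sub_sum_eq_rest`). No functional equation is needed: the dual sums come out of this
integral. On the part of the line to the right of the negative imaginary axis `1 / (1 - q)` is expanded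
as `1 + q + ... + q ^ (K - 1) + q ^ K / (1 - q)`, and on the part to the left one term is expanded in
the other direction. By Cauchy's theorem the integral of `z ^ (-s) * q(z) ^ m` along such a half-line is
a Gamma integral along a ray from the origin, which is exactly the dual term of frequency `m`, plus an
integral over the segment from `0` to `-iX` (`rest_eq_sum_dual`).

Let `t = Im s > 0`. The phase of `z ^ (-s) * q(z) ^ m` is stationary at `z = t / (2πm)`. With `K` chosen
so that `X` lies between the saddle points of the frequencies `lam + K` and `lam + K + 1`, the modulus
of the remaining integrand is at most a Gaussian of width `X / √t` around `X`, because
`arg (X + r (1 + i)) ≤ r / X - r² / (3 X (X + |r|))` for `r ≥ -X` (`arg_line_le`). This gives the bound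
`X ^ (-σ) * X / (δ √t)`, `δ` being the distance of `X` from the poles
(`norm_integral_Ioi_osc_div_den_le`); the segments are small because `exp (-πt/2)` beats the growth of
the exponential on them (`norm_seg_le`).

The point `x` itself may be close to a pole. It is moved to a point `X` at distance at least a constant
times `min (1/2) √(x/y)` from the poles and within `min (1/2) √(x/y)` of `x`. This changes the first sum
by `O(1)` terms and the dual sum by `O(1 + √(y/x))` terms, each of which is bounded by the same
saddle-point estimate, applied to the dual term itself (`norm_dual_one_le`); all errors are then
`O(x ^ (-σ) + x ^ (1 - σ) / √t)` (`norm_sub_sum_sub_sum_dual_le`). The terms of the second dual sum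
beyond the first are exponentially small for `t > 0`. The edges `σ = 0, 1` follow by continuity in `σ`,
and `t < 0` by complex conjugation, which exchanges `lam` and `1 - lam` and the two dual sums.
-/

namespace LerchAFE
open Complex Set Filter Topology MeasureTheory

/-! ### Cauchy's theorem and formula for a parallelogram -/

/-- Cauchy's theorem for a parallelogram with sides in the directions `e` and `d`, from the divergence
theorem in the parameter rectangle. -/
theorem integral_boundary_parallelogram {F : ℂ → ℂ} (p e d : ℂ) (a b c c' : ℝ)
    (hF : ∀ u ∈ uIcc a b, ∀ r ∈ uIcc c c', DifferentiableAt ℂ F (p + u * e + r * d)) :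
    d * (∫ r in c..c', F (p + b * e + r * d)) - d * (∫ r in c..c', F (p + a * e + r * d)) =
      e * (∫ u in a..b, F (p + u * e + c' * d)) - e * ∫ u in a..b, F (p + u * e + c * d) := by
  let A : ℝ × ℝ → ℂ := fun x => p + x.1 * e + x.2 * d
  let A' : ℝ × ℝ →L[ℝ] ℂ := (ofRealCLM.comp (ContinuousLinearMap.fst ℝ ℝ ℝ)).smulRight e +
    (ofRealCLM.comp (ContinuousLinearMap.snd ℝ ℝ ℝ)).smulRight d
  have hA : ∀ x, HasFDerivAt A A' x := fun x => by
    have h : HasFDerivAt (fun x => A' x + p) A' x := A'.hasFDerivAt.add_const p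
    convert! h using 1
    ext y
    simp [A, A']; ring
  let F' : ℝ × ℝ → ℝ × ℝ →L[ℝ] ℂ := fun x =>
    ((fderiv ℂ F (A x)).restrictScalars ℝ).comp A'
  have hFA : ∀ x ∈ uIcc a b ×ˢ uIcc c c', HasFDerivAt (fun x => F (A x)) (F' x) x := by
    rintro ⟨u, r⟩ ⟨hu, hr⟩
    exact ((hF u hu r hr).hasFDerivAt.restrictScalars ℝ).comp (u, r) (hA _)
  have hdiv : ∀ x, (d • F' x) (1, 0) + ((-e) • F' x) (0, 1) = 0 := fun x => by
    have h1 : fderiv ℂ F (A x) e = e * fderiv ℂ F (A x) 1 := by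
      rw [← smul_eq_mul, ← map_smul]; simp
    have h2 : fderiv ℂ F (A x) d = d * fderiv ℂ F (A x) 1 := by
      rw [← smul_eq_mul, ← map_smul]; simp
    simp [F', A', h1, h2]; ring
  have hsub : Ioo (min a b) (max a b) ×ˢ Ioo (min c c') (max c c') ⊆ uIcc a b ×ˢ uIcc c c' :=
    prod_mono Ioo_subset_Icc_self Ioo_subset_Icc_self
  have key := integral2_divergence_prod_of_hasFDerivAt_off_countable
    (fun x => d • F (A x)) (fun x => (-e) • F (A x)) (fun x => d • F' x) (fun x => (-e) • F' x)
    a c b c' ∅ countable_empty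
    (fun x hx => ((hFA x hx).const_smul d).continuousAt.continuousWithinAt)
    (fun x hx => ((hFA x hx).const_smul (-e)).continuousAt.continuousWithinAt)
    (fun x hx => (hFA x (hsub hx.1)).const_smul d)
    (fun x hx => (hFA x (hsub hx.1)).const_smul (-e))
    (by simp only [hdiv]; exact integrableOn_zero)
  simp only [hdiv] at key
  simp only [intervalIntegral.integral_zero, smul_eq_mul, intervalIntegral.integral_const_mul,
    A] at key
  linear_combination -key

theorem integral_inv_segment {z v : ℂ} {a b : ℝ}
    (h : ∀ r ∈ uIcc a b, z + r * v ∈ slitPlane) :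
    v * (∫ r in a..b, (z + r * v)⁻¹) = log (z + b * v) - log (z + a * v) := by
  rw [← intervalIntegral.integral_const_mul]
  refine intervalIntegral.integral_eq_sub_of_hasDerivAt (f := fun r : ℝ => log (z + r * v))
    (fun r hr => ?_) ?_
  · have h1 : HasDerivAt (fun r : ℝ => z + r * v) v r := by
      simpa using ((hasDerivAt_id r).ofReal_comp.mul_const v).const_add z
    have := h1.clog_real (h r hr)
    rwa [div_eq_mul_inv] at this
  · refine ContinuousOn.intervalIntegrable ?_
    refine continuousOn_const.mul (ContinuousOn.inv₀ (by fun_prop) fun r hr => ?_)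
    exact slitPlane_ne_zero (h r hr)

/-- The winding number of the boundary of the parallelogram around an interior point is `1`, the four
sides being evaluated by branches of the logarithm. -/
theorem boundary_integral_inv {X p R : ℝ} (h1 : X < p) (h2 : p < X + 1) (hR : 0 < R) :
    (1 + I) * (∫ r in (-R)..R, (X + 1 + r * (1 + I) - p : ℂ)⁻¹) -
      (1 + I) * (∫ r in (-R)..R, (X + r * (1 + I) - p : ℂ)⁻¹) =
    2 * Real.pi * I +
     ((∫ u in (0 : ℝ)..1, (X + u + R * (1 + I) - p : ℂ)⁻¹) -
      ∫ u in (0 : ℝ)..1, (X + u + (-R : ℝ) * (1 + I) - p : ℂ)⁻¹) := by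
  have e1 := integral_inv_segment (z := X + 1 - p) (v := 1 + I) (a := -R) (b := R) fun r _ => by
    rw [mem_slitPlane_iff]
    simp only [add_re, sub_re, ofReal_re, one_re, mul_re, I_re, ofReal_im, add_im, sub_im,
      one_im, mul_im, I_im, ne_eq]
    by_cases hr : r = 0
    · left; rw [hr]; linarith
    · right; simpa using hr
  have e2 := integral_inv_segment (z := p - X) (v := -(1 + I)) (a := -R) (b := R) fun r _ => by
    rw [mem_slitPlane_iff]
    simp only [add_re, sub_re, ofReal_re, one_re, mul_re, I_re, ofReal_im, add_im, sub_im, neg_re,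
      neg_im, one_im, mul_im, I_im, ne_eq]
    by_cases hr : r = 0
    · left; rw [hr]; linarith
    · right; simpa using hr
  have e3 := integral_inv_segment (z := X + R * (1 + I) - p) (v := 1) (a := 0) (b := 1)
    fun r _ => by
      rw [mem_slitPlane_iff]
      right; simpa using hR.ne'
  have e4 := integral_inv_segment (z := X + (-R : ℝ) * (1 + I) - p) (v := 1) (a := 0) (b := 1)
    fun r _ => by
      rw [mem_slitPlane_iff]
      right; simpa using hR.ne'
  have c1 : ∀ r : ℝ, (X + 1 + r * (1 + I) - p : ℂ) = X + 1 - p + r * (1 + I) := fun r => by ring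
  have c2 : ∀ r : ℝ, (X + r * (1 + I) - p : ℂ)⁻¹ = -(p - X + r * (-(1 + I)))⁻¹ := fun r => by
    rw [← inv_neg]; congr 1; ring
  have c3 : ∀ u R : ℝ, (X + u + R * (1 + I) - p : ℂ) = X + R * (1 + I) - p + u * 1 :=
    fun u R => by ring
  simp only [c1, c2, c3, intervalIntegral.integral_neg]
  rw [one_mul] at e3 e4
  rw [e1, e3, e4]
  have l1 : log (p - X + R * (-(1 + I)) : ℂ) = log (X + R * (1 + I) - p) - Real.pi * I := by
    have h : (p - X + R * (-(1 + I)) : ℂ) = -(X + R * (1 + I) - p) := by ring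
    have hi : 0 < (X + R * (1 + I) - p : ℂ).im := by simpa using hR
    rw [h]
    simp only [log, norm_neg, arg_neg_eq_arg_sub_pi_of_im_pos hi]
    push_cast; ring
  have l2 : log (p - X + (-R : ℝ) * (-(1 + I)) : ℂ) =
      log (X + (-R : ℝ) * (1 + I) - p) + Real.pi * I := by
    have h : (p - X + (-R : ℝ) * (-(1 + I)) : ℂ) = -(X + (-R : ℝ) * (1 + I) - p) := by ring
    have hi : (X + (-R : ℝ) * (1 + I) - p : ℂ).im < 0 := by simpa using hR
    rw [h]
    simp only [log, norm_neg, arg_neg_eq_arg_add_pi_of_im_neg hi]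
    push_cast; ring
  rw [l1, l2] at e2
  have d1 : (X + 1 - p + R * (1 + I) : ℂ) = X + R * (1 + I) - p + (1 : ℝ) * 1 := by
    push_cast; ring
  have d2 : (X + 1 - p + (-R : ℝ) * (1 + I) : ℂ) = X + (-R : ℝ) * (1 + I) - p + (1 : ℝ) * 1 := by
    push_cast; ring
  rw [d1, d2]
  simp only [ofReal_zero, zero_mul, add_zero]
  linear_combination -e2

/-- Cauchy's formula for a parallelogram with one pair of sides parallel to the real axis. -/
theorem cauchy_parallelogram {A : ℂ → ℂ} {U : Set ℂ} (hU : IsOpen U) (hA : DifferentiableOn ℂ A U)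
    {X p R : ℝ} (h1 : X < p) (h2 : p < X + 1) (hR : 0 < R) (hp : (p : ℂ) ∈ U)
    (hmem : ∀ u ∈ Icc (0 : ℝ) 1, ∀ r ∈ Icc (-R) R, (X + u + r * (1 + I) : ℂ) ∈ U) :
    (1 + I) * (∫ r in (-R)..R, A (X + 1 + r * (1 + I)) / (X + 1 + r * (1 + I) - p)) -
      (1 + I) * (∫ r in (-R)..R, A (X + r * (1 + I)) / (X + r * (1 + I) - p)) =
    2 * Real.pi * I * A p +
     ((∫ u in (0 : ℝ)..1, A (X + u + R * (1 + I)) / (X + u + R * (1 + I) - p)) -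
      ∫ u in (0 : ℝ)..1, A (X + u + (-R : ℝ) * (1 + I)) / (X + u + (-R : ℝ) * (1 + I) - p)) := by
  have hB : DifferentiableOn ℂ (dslope A p) U :=
    (differentiableOn_dslope (hU.mem_nhds hp)).mpr hA
  have hRR : -R ≤ R := by linarith
  have key := integral_boundary_parallelogram (F := dslope A p) X 1 (1 + I) 0 1 (-R) R fun u hu r hr => by
    rw [uIcc_of_le zero_le_one] at hu
    rw [uIcc_of_le hRR] at hr
    rw [mul_one]
    exact hB.differentiableAt (hU.mem_nhds (hmem u hu r hr))
  have hinv := boundary_integral_inv h1 h2 hR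
  -- the regular part `dslope A p` integrates to zero, the pole contributes `A p`
  have hsplit : ∀ z : ℂ, z ≠ p → A z / (z - p) = dslope A p z + A p * (z - p)⁻¹ := fun z hz => by
    rw [dslope_of_ne _ hz, slope_def_field]
    have := sub_ne_zero.mpr hz
    field_simp; ring
  -- on each of the four sides the integrand splits into a regular part and a multiple of `1/(z-p)`
  have side : ∀ (z v : ℂ) (a b : ℝ), (∀ r ∈ uIcc a b, z + r * v ∈ U) →
      (∀ r ∈ uIcc a b, z + r * v ≠ p) →
      ∫ r in a..b, A (z + r * v) / (z + r * v - p) =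
        (∫ r in a..b, dslope A p (z + r * v)) + A p * ∫ r in a..b, (z + r * v - p)⁻¹ := by
    intro z v a b hz hne
    rw [← intervalIntegral.integral_const_mul, ← intervalIntegral.integral_add]
    · exact intervalIntegral.integral_congr fun r hr => hsplit _ (hne r hr)
    · exact (hB.continuousOn.comp (by fun_prop) hz).intervalIntegrable
    · refine ContinuousOn.intervalIntegrable (continuousOn_const.mul ?_)
      exact ContinuousOn.inv₀ (by fun_prop) fun r hr => sub_ne_zero.mpr (hne r hr)
  have s1 := side (X + 1) (1 + I) (-R) R
    (fun r hr => by
      rw [uIcc_of_le hRR] at hr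
      simpa using hmem 1 (by simp) r hr)
    (fun r _ h => by
      have him := congrArg im h
      have hre := congrArg re h
      simp at him hre
      rw [him] at hre
      linarith)
  have s2 := side X (1 + I) (-R) R
    (fun r hr => by
      rw [uIcc_of_le hRR] at hr
      simpa using hmem 0 (by simp) r hr)
    (fun r _ h => by
      have him := congrArg im h
      have hre := congrArg re h
      simp at him hre
      rw [him] at hre
      linarith)
  have hor : ∀ R' : ℝ, R' ∈ Icc (-R) R → R' ≠ 0 →
      ∫ u in (0 : ℝ)..1, A (X + u + R' * (1 + I)) / (X + u + R' * (1 + I) - p) =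
        (∫ u in (0 : ℝ)..1, dslope A p (X + u + R' * (1 + I))) +
          A p * ∫ u in (0 : ℝ)..1, (X + u + R' * (1 + I) - p : ℂ)⁻¹ := fun R' hR' h0 => by
    have := side (X + R' * (1 + I)) 1 0 1
      (fun u hu => by
        rw [uIcc_of_le zero_le_one] at hu
        have := hmem u hu R' hR'
        convert this using 1; ring)
      (fun u _ h => by
        have him := congrArg im h
        simp at him
        exact h0 him)
    have c : ∀ u : ℝ, (X + R' * (1 + I) + u * 1 : ℂ) = X + u + R' * (1 + I) := fun u => by ring
    simpa only [c] using this
  have s3 := hor R (by constructor <;> linarith) hR.ne'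
  have s4 := hor (-R) (by constructor <;> linarith) (by linarith)
  rw [s1, s2, s3, s4]
  simp only [mul_one, ofReal_one, ofReal_zero, add_zero, one_mul] at key
  linear_combination key + A p * hinv

/-! ### Gamma integrals along rays -/

theorem integrableOn_rpow_mul_exp {σ b : ℝ} (hσ : σ < 1) (hb : 0 < b) :
    IntegrableOn (fun r : ℝ => r ^ (-σ) * Real.exp (-(b * r))) (Ioi 0) := by
  have h := integrableOn_rpow_mul_exp_neg_mul_rpow (s := -σ) (p := 1) (b := b) (by linarith) zero_lt_one hb
  simpa using h

theorem norm_cpow_mul_exp {s c : ℂ} {r : ℝ} (hr : 0 < r) :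
    ‖(r : ℂ) ^ (-s) * cexp (-(c * r))‖ = r ^ (-s.re) * Real.exp (-(c.re * r)) := by
  rw [norm_mul, norm_cpow_eq_rpow_re_of_pos hr, norm_exp]
  simp

theorem continuousOn_cpow_mul_exp (s c : ℂ) :
    ContinuousOn (fun r : ℝ => (r : ℂ) ^ (-s) * cexp (-(c * r))) (Ioi 0) := by
  refine ContinuousOn.mul (fun r hr => ?_) (by fun_prop)
  exact (continuousAt_ofReal_cpow_const r (-s) (Or.inr (ne_of_gt hr))).continuousWithinAt

/-- Euler's integral for `Gamma (1 - s)` with a complex rate `c`, by analytic continuation from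
positive `c`. -/
theorem integral_cpow_mul_exp_complex {s c : ℂ} (hs : s.re < 1) (hc : 0 < c.re) :
    ∫ r in Ioi (0 : ℝ), (r : ℂ) ^ (-s) * cexp (-(c * r)) = c ^ (s - 1) * Gamma (1 - s) := by
  have hU : IsOpen {c : ℂ | 0 < c.re} := isOpen_lt continuous_const continuous_re
  have hd1 : DifferentiableOn ℂ
      (fun c : ℂ => ∫ r in Ioi (0 : ℝ), (r : ℂ) ^ (-s) * cexp (-(c * r))) {c : ℂ | 0 < c.re} := by
    intro c₀ hc₀
    have hc₀ : 0 < c₀.re := hc₀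
    have hn : {c : ℂ | c₀.re / 2 < c.re} ∈ 𝓝 c₀ :=
      (isOpen_lt continuous_const continuous_re).mem_nhds (by simp only [Set.mem_ofPred_eq]; linarith)
    have hm : ∀ c : ℂ, AEStronglyMeasurable
        (fun r : ℝ => (r : ℂ) ^ (-s) * cexp (-(c * r))) (volume.restrict (Ioi 0)) := fun c =>
      (continuousOn_cpow_mul_exp s c).aestronglyMeasurable measurableSet_Ioi
    have := hasDerivAt_integral_of_dominated_loc_of_deriv_le (μ := volume.restrict (Ioi (0 : ℝ)))
      (F := fun (c : ℂ) (r : ℝ) => (r : ℂ) ^ (-s) * cexp (-(c * r)))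
      (F' := fun (c : ℂ) (r : ℝ) => (r : ℂ) ^ (-s) * (cexp (-(c * r)) * -r)) (x₀ := c₀)
      (bound := fun r : ℝ => r ^ (-(s.re - 1)) * Real.exp (-(c₀.re / 2 * r))) hn
      (Eventually.of_forall hm) ?_ ?_ ?_ ?_ ?_
    · exact this.2.differentiableAt.differentiableWithinAt
    · refine (integrableOn_rpow_mul_exp hs hc₀).mono' (hm c₀) ?_
      filter_upwards [ae_restrict_mem measurableSet_Ioi] with r hr
      rw [norm_cpow_mul_exp hr]
    · have h := (hm c₀).mul (by fun_prop : Continuous fun r : ℝ => (-r : ℂ)).aestronglyMeasurable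
      refine h.congr (Eventually.of_forall fun r => ?_)
      simp only [Pi.mul_apply]; ring
    · filter_upwards [ae_restrict_mem measurableSet_Ioi] with r hr c hc
      have hr : 0 < r := hr
      rw [← mul_assoc, norm_mul, norm_cpow_mul_exp hr, norm_neg, norm_real,
        Real.norm_of_nonneg hr.le, show -(s.re - 1) = -s.re + 1 by ring, Real.rpow_add_one hr.ne']
      have : Real.exp (-(c.re * r)) ≤ Real.exp (-(c₀.re / 2 * r)) := by
        apply Real.exp_le_exp.mpr
        have : c₀.re / 2 < c.re := hc
        nlinarith
      have h2 : 0 ≤ r ^ (-s.re) := by positivity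
      calc _ = r ^ (-s.re) * r * Real.exp (-(c.re * r)) := by ring
        _ ≤ _ := by gcongr
    · exact integrableOn_rpow_mul_exp (by linarith) (by linarith)
    · refine Eventually.of_forall fun r c _ => ?_
      have h1 : HasDerivAt (fun c : ℂ => -(c * r)) (-r : ℂ) c := by
        simpa using ((hasDerivAt_id c).mul_const (r : ℂ)).fun_neg
      exact h1.cexp.const_mul _
  have hd2 : DifferentiableOn ℂ (fun c : ℂ => c ^ (s - 1) * Gamma (1 - s)) {c : ℂ | 0 < c.re} := by
    intro c hc
    have : c ∈ slitPlane := Or.inl hc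
    exact ((differentiableAt_id.cpow_const this).mul_const _).differentiableWithinAt
  have hpre : IsPreconnected {c : ℂ | 0 < c.re} := (convex_halfSpace_re_gt 0).isPreconnected
  refine (hd1.analyticOnNhd hU).eqOn_of_preconnected_of_frequently_eq (hd2.analyticOnNhd hU)
    hpre (z₀ := 1) (by simp) ?_ hc
  have hreal : ∀ x : ℝ, 0 < x →
      ∫ r in Ioi (0 : ℝ), (r : ℂ) ^ (-s) * cexp (-((x : ℂ) * r)) =
        (x : ℂ) ^ (s - 1) * Gamma (1 - s) := fun x hx => by
    have h := integral_cpow_mul_exp_neg_mul_Ioi (a := 1 - s) (r := x) (by simpa using hs) hx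
    rw [show (1 : ℂ) - s - 1 = -s by ring] at h
    rw [h, one_div, inv_cpow _ _ (by rw [arg_ofReal_of_nonneg hx.le]; exact Real.pi_pos.ne),
      ← cpow_neg, neg_sub]
  have hseq : Tendsto (fun n : ℕ => ((1 + 1 / ((n : ℝ) + 1) : ℝ) : ℂ)) atTop (𝓝[≠] 1) := by
    refine tendsto_nhdsWithin_iff.mpr ⟨?_, Eventually.of_forall fun n => ?_⟩
    · have := (tendsto_one_div_add_atTop_nhds_zero_nat (𝕜 := ℝ)).const_add 1
      rw [add_zero] at this
      have h2 := (continuous_ofReal.tendsto 1).comp this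
      simpa [Function.comp_def] using h2
    · have : (0 : ℝ) < 1 / ((n : ℝ) + 1) := by positivity
      simp only [mem_compl_iff, mem_singleton_iff]
      intro h
      have h3 : (1 + 1 / ((n : ℝ) + 1) : ℝ) = 1 := by exact_mod_cast h
      linarith
  exact hseq.frequently (Frequently.of_forall fun n => hreal _ (by positivity))

/-- The oscillating factor `z ^ (-s) * exp (2πi m (z - α))`; at `z = n + α` it is the `n`-th term of
the Lerch series with parameter `m`. -/
noncomputable def osc (s : ℂ) (α m : ℝ) (z : ℂ) : ℂ :=
  z ^ (-s) * cexp (2 * Real.pi * I * m * (z - α))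

/-- The term of frequency `m` of the dual series: the value of the integral of `osc s α m` along the
ray from the origin in the direction `ε * (1 + I)` in which the exponential decays (see
`integral_osc_ray`). The sign `ε = 1` or `-1` of `m` is an argument of its own, so that the formula
makes no case distinction; it is meant for `0 < ε * m`. -/
noncomputable def dual (s : ℂ) (α ε m : ℝ) : ℂ :=
  cexp (-(2 * Real.pi * I * m * α)) * cexp (ε * (Real.pi * I / 2) * (1 - s)) *
    ((2 * Real.pi * (ε * m) : ℝ) : ℂ) ^ (s - 1) * Gamma (1 - s)

theorem differentiableAt_osc (s : ℂ) (α m : ℝ) {z : ℂ} (hz : z ∈ slitPlane) :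
    DifferentiableAt ℂ (osc s α m) z := by
  unfold osc
  exact (differentiableAt_id.cpow_const hz).mul (by fun_prop)

theorem norm_osc (s : ℂ) (α m : ℝ) {z : ℂ} (hz : z ≠ 0) :
    ‖osc s α m z‖ = ‖z‖ ^ (-s.re) * Real.exp (s.im * arg z - 2 * Real.pi * m * z.im) := by
  rw [osc, norm_mul, norm_cpow_of_ne_zero hz, norm_exp, div_eq_mul_inv, ← Real.exp_neg, mul_assoc,
    ← Real.exp_add]
  congr 2
  simp
  ring

theorem norm_osc_le (s : ℂ) (α m : ℝ) {z : ℂ} (hz : z ≠ 0) :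
    ‖osc s α m z‖ ≤ ‖z‖ ^ (-s.re) * (Real.exp (Real.pi * |s.im|) *
      Real.exp (-(2 * Real.pi * m * z.im))) := by
  rw [norm_osc s α m hz, ← Real.exp_add]
  gcongr
  have h : |s.im * arg z| ≤ |s.im| * Real.pi := by
    rw [abs_mul]; gcongr; exact abs_arg_le_pi z
  linarith [le_abs_self (s.im * arg z)]

theorem osc_mul_exp (s : ℂ) (α m k : ℝ) (z : ℂ) :
    osc s α m z * cexp (2 * Real.pi * I * k * (z - α)) = osc s α (m + k) z := by
  rw [osc, osc, mul_assoc, ← Complex.exp_add]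
  congr 2; push_cast; ring

section ray
variable {ε v r : ℝ}

theorem ray_re (v r ε : ℝ) : (-(I * v) + r * (ε * (1 + I)) : ℂ).re = ε * r := by simp; ring

theorem ray_im (v r ε : ℝ) : (-(I * v) + r * (ε * (1 + I)) : ℂ).im = ε * r - v := by simp; ring

theorem le_norm_ray (hε : ε = 1 ∨ ε = -1) (hr : 0 ≤ r) (v : ℝ) :
    r ≤ ‖(-(I * v) + r * (ε * (1 + I)) : ℂ)‖ := by
  have h := abs_re_le_norm (-(I * v) + r * (ε * (1 + I)) : ℂ)
  rw [ray_re, abs_mul] at h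
  have : |ε| = 1 := by rcases hε with h | h <;> simp [h]
  rwa [this, one_mul, abs_of_nonneg hr] at h

theorem ray_mem_slitPlane (hε : ε = 1 ∨ ε = -1) (hr : 0 ≤ r) (h : 0 < r + v) :
    (-(I * v) + r * (ε * (1 + I)) : ℂ) ∈ slitPlane := by
  rw [mem_slitPlane_iff, ray_re, ray_im]
  rcases hε with rfl | rfl
  · rcases hr.eq_or_lt with h0 | h0
    · right; rw [← h0] at h ⊢; intro h; linarith
    · left; linarith
  · right; intro h; linarith

theorem norm_osc_ray_le {s : ℂ} {m : ℝ} (α : ℝ) (hs : 0 ≤ s.re) (hε : ε = 1 ∨ ε = -1)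
    (hr : 0 < r) :
    ‖osc s α m (-(I * v) + r * (ε * (1 + I)))‖ ≤
      Real.exp (Real.pi * |s.im| + 2 * Real.pi * |m| * |v|) *
       (r ^ (-s.re) * Real.exp (-(2 * Real.pi * (ε * m) * r))) := by
  have hle := le_norm_ray hε hr.le v
  have hne : (-(I * v) + r * (ε * (1 + I)) : ℂ) ≠ 0 := norm_pos_iff.mp (hr.trans_le hle)
  refine (norm_osc_le s α m hne).trans ?_
  rw [ray_im, ← Real.exp_add]
  have h1 : ‖(-(I * v) + r * (ε * (1 + I)) : ℂ)‖ ^ (-s.re) ≤ r ^ (-s.re) :=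
    Real.rpow_le_rpow_of_nonpos hr hle (by linarith)
  have h2 : Real.pi * |s.im| + -(2 * Real.pi * m * (ε * r - v)) ≤
      (Real.pi * |s.im| + 2 * Real.pi * |m| * |v|) + (-(2 * Real.pi * (ε * m) * r)) := by
    have : m * v ≤ |m| * |v| := by rw [← abs_mul]; exact le_abs_self _
    have := mul_le_mul_of_nonneg_left this Real.pi_pos.le
    linarith
  calc _ ≤ r ^ (-s.re) * Real.exp ((Real.pi * |s.im| + 2 * Real.pi * |m| * |v|) +
        (-(2 * Real.pi * (ε * m) * r))) :=
        mul_le_mul h1 (Real.exp_le_exp.mpr h2) (Real.exp_pos _).le (by positivity)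
    _ = _ := by rw [Real.exp_add]; ring

end ray

/-- The integral along a ray from the origin is a dual term. -/
theorem integral_osc_ray {s : ℂ} {m ε : ℝ} (α : ℝ) (hs1 : s.re < 1)
    (hε : ε = 1 ∨ ε = -1) (hm : 0 < ε * m) :
    ε * (1 + I) * ∫ r in Ioi (0 : ℝ), osc s α m (r * (ε * (1 + I))) = dual s α ε m := by
  have hpos : 0 < 2 * Real.pi * (ε * m) := by positivity
  have hεε : ε * ε = 1 := by rcases hε with h | h <;> simp [h]
  have hd0 : (ε * (1 + I) : ℂ) ≠ 0 := by
    intro h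
    have := congrArg re h
    simp at this
    simp [this] at hεε
  have hI0 : (ε * I : ℂ) ≠ 0 := by
    intro h
    have := congrArg im h
    simp at this
    simp [this] at hεε
  have h10 : (1 - I : ℂ) ≠ 0 := fun h => by simpa using congrArg re h
  have hargI : arg (ε * I : ℂ) = ε * (Real.pi / 2) := by
    rcases hε with rfl | rfl
    · simp
    · simp [arg_neg_I]
  have hlogI : log (ε * I : ℂ) = ε * (Real.pi * I / 2) := by
    rw [log, hargI]
    have : ‖(ε * I : ℂ)‖ = 1 := by rcases hε with rfl | rfl <;> simp
    rw [this]; push_cast; simp; ring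
  have hc : (2 * Real.pi * (ε * m) * (1 - I) : ℂ) = -(2 * Real.pi * I * m * (ε * (1 + I))) := by
    linear_combination (2 * Real.pi * ε * m : ℂ) * I_sq
  have hcre : 0 < (2 * Real.pi * (ε * m) * (1 - I) : ℂ).re := by
    have : (2 * Real.pi * (ε * m) * (1 - I) : ℂ) = ((2 * Real.pi * (ε * m) : ℝ) : ℂ) * (1 - I) := by
      push_cast; ring
    rw [this, re_ofReal_mul]; simpa using hpos
  have key := integral_cpow_mul_exp_complex hs1 hcre
  have hint : ∫ r in Ioi (0 : ℝ), osc s α m (r * (ε * (1 + I))) =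
      cexp (-(2 * Real.pi * I * m * α)) * (ε * (1 + I) : ℂ) ^ (-s) *
        ∫ r in Ioi (0 : ℝ), (r : ℂ) ^ (-s) * cexp (-((2 * Real.pi * (ε * m) * (1 - I)) * r)) := by
    rw [← integral_const_mul]
    refine setIntegral_congr_fun measurableSet_Ioi fun r hr => ?_
    have hr : 0 < r := hr
    have hp : (r * (ε * (1 + I)) : ℂ) ^ (-s) = (r : ℂ) ^ (-s) * (ε * (1 + I) : ℂ) ^ (-s) := by
      rw [cpow_def_of_ne_zero (mul_ne_zero (ofReal_ne_zero.mpr hr.ne') hd0), log_ofReal_mul hr hd0,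
        cpow_def_of_ne_zero (ofReal_ne_zero.mpr hr.ne'), cpow_def_of_ne_zero hd0,
        ← Complex.exp_add, ← ofReal_log hr.le]
      congr 1; ring
    simp only [osc]
    rw [hp, hc, show (2 * Real.pi * I * m * (r * (ε * (1 + I)) - α) : ℂ) =
      -(2 * Real.pi * I * m * α) + -(-(2 * Real.pi * I * m * (ε * (1 + I))) * r) by ring,
      Complex.exp_add]
    ring
  have h1 : (ε * (1 + I) : ℂ) * (ε * (1 + I) : ℂ) ^ (-s) = (ε * (1 + I) : ℂ) ^ (1 - s) := by
    rw [sub_eq_add_neg, cpow_add _ _ hd0, cpow_one]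
  -- `1 + I = I * (1 - I)`, and the arguments add without leaving the principal range
  have h2 : (ε * (1 + I) : ℂ) ^ (1 - s) =
      cexp (ε * (Real.pi * I / 2) * (1 - s)) * (1 - I) ^ (1 - s) := by
    have he : (ε * (1 + I) : ℂ) = ε * I * (1 - I) := by linear_combination (ε : ℂ) * I_sq
    have harg : |arg (1 - I)| < Real.pi / 2 := by
      rw [abs_arg_lt_pi_div_two_iff]; left; simp
    rw [abs_lt] at harg
    have hlog : log (ε * I * (1 - I)) = log (ε * I : ℂ) + log (1 - I) := by
      rw [log_mul_eq_add_log_iff hI0 h10, hargI]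
      rcases hε with rfl | rfl <;> constructor <;> linarith [Real.pi_pos]
    rw [he, cpow_def_of_ne_zero (mul_ne_zero hI0 h10), hlog, hlogI, add_mul, Complex.exp_add,
      ← cpow_def_of_ne_zero h10]
  have h3 : (2 * Real.pi * (ε * m) * (1 - I) : ℂ) ^ (s - 1) =
      ((2 * Real.pi * (ε * m) : ℝ) : ℂ) ^ (s - 1) * (1 - I) ^ (s - 1) := by
    have hne : ((2 * Real.pi * (ε * m) : ℝ) : ℂ) ≠ 0 := ofReal_ne_zero.mpr hpos.ne'
    have : (2 * Real.pi * (ε * m) * (1 - I) : ℂ) = ((2 * Real.pi * (ε * m) : ℝ) : ℂ) * (1 - I) := by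
      push_cast; ring
    rw [this, cpow_def_of_ne_zero (mul_ne_zero hne h10), log_ofReal_mul hpos h10,
      cpow_def_of_ne_zero hne, cpow_def_of_ne_zero h10, ← Complex.exp_add, ← ofReal_log hpos.le]
    congr 1; ring
  have h4 : (1 - I : ℂ) ^ (1 - s) * (1 - I) ^ (s - 1) = 1 := by
    rw [← cpow_add _ _ h10]; simp
  rw [hint, key, h3, dual]
  calc _ = cexp (-(2 * Real.pi * I * m * α)) *
        ((ε * (1 + I) : ℂ) * (ε * (1 + I) : ℂ) ^ (-s)) *
        (((2 * Real.pi * (ε * m) : ℝ) : ℂ) ^ (s - 1) * (1 - I) ^ (s - 1) * Gamma (1 - s)) := by ring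
    _ = cexp (-(2 * Real.pi * I * m * α)) * cexp (ε * (Real.pi * I / 2) * (1 - s)) *
        ((2 * Real.pi * (ε * m) : ℝ) : ℂ) ^ (s - 1) * Gamma (1 - s) *
        ((1 - I) ^ (1 - s) * (1 - I) ^ (s - 1)) := by rw [h1, h2]; ring
    _ = _ := by rw [h4, mul_one]

/-! ### Rays issuing from the negative imaginary axis -/

section shift
variable {s : ℂ} {α m ε : ℝ}

theorem continuousOn_osc_ray (s : ℂ) (α m : ℝ) (hε : ε = 1 ∨ ε = -1) {v : ℝ} (hv : 0 ≤ v) :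
    ContinuousOn (fun r : ℝ => osc s α m (-(I * v) + r * (ε * (1 + I)))) (Ioi 0) := fun r hr => by
  have hr : 0 < r := hr
  have h := (differentiableAt_osc s α m
    (ray_mem_slitPlane (v := v) hε hr.le (by linarith))).continuousAt
  exact (ContinuousAt.comp (f := fun r : ℝ => (-(I * v) + r * (ε * (1 + I)) : ℂ)) h
    (by fun_prop)).continuousWithinAt

theorem integrableOn_osc_ray (hs0 : 0 ≤ s.re) (hs1 : s.re < 1) (hε : ε = 1 ∨ ε = -1)
    (hm : 0 < ε * m) {v : ℝ} (hv : 0 ≤ v) :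
    IntegrableOn (fun r : ℝ => osc s α m (-(I * v) + r * (ε * (1 + I)))) (Ioi 0) := by
  have hb : 0 < 2 * Real.pi * (ε * m) := by positivity
  refine ((integrableOn_rpow_mul_exp hs1 hb).const_mul
    (Real.exp (Real.pi * |s.im| + 2 * Real.pi * |m| * |v|))).mono'
    ((continuousOn_osc_ray s α m hε hv).aestronglyMeasurable measurableSet_Ioi) ?_
  filter_upwards [ae_restrict_mem measurableSet_Ioi] with r hr
  exact norm_osc_ray_le α hs0 hε hr

theorem norm_osc_neg_I_mul (s : ℂ) (α m : ℝ) {v : ℝ} (hv : 0 < v) :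
    ‖osc s α m (-(I * v))‖ =
      v ^ (-s.re) * Real.exp (-(Real.pi / 2 * s.im) + 2 * Real.pi * m * v) := by
  have h : (-(I * v) : ℂ) = v * (-I) := by ring
  have hne : (-(I * v) : ℂ) ≠ 0 := by simpa using hv.ne'
  rw [norm_osc s α m hne]
  have h1 : ‖(-(I * v) : ℂ)‖ = v := by simp [abs_of_pos hv]
  have h2 : arg (-(I * v) : ℂ) = -(Real.pi / 2) := by rw [h, arg_real_mul _ hv, arg_neg_I]
  rw [h1, h2]
  congr 2
  simp; ring

theorem neg_I_mul_mem_slitPlane {v : ℝ} (hv : 0 < v) : (-(I * v) : ℂ) ∈ slitPlane := by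
  rw [mem_slitPlane_iff]; right; simpa using hv.ne'

theorem intervalIntegrable_osc_neg_I_mul (s : ℂ) (α m : ℝ) (hs1 : s.re < 1) {X : ℝ} (hX : 0 ≤ X) :
    IntervalIntegrable (fun v : ℝ => osc s α m (-(I * v))) volume 0 X := by
  rw [intervalIntegrable_iff_integrableOn_Ioc_of_le hX]
  have h1 : IntegrableOn (fun v : ℝ => v ^ (-s.re)) (Ioc 0 X) :=
    (intervalIntegrable_iff_integrableOn_Ioc_of_le hX).mp
      (intervalIntegral.intervalIntegrable_rpow' (by linarith))
  have hcont : ContinuousOn (fun v : ℝ => osc s α m (-(I * v))) (Ioc 0 X) := fun v hv => by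
    have h := (differentiableAt_osc s α m (neg_I_mul_mem_slitPlane hv.1)).continuousAt
    exact (ContinuousAt.comp (f := fun v : ℝ => (-(I * v) : ℂ)) h
      (by fun_prop)).continuousWithinAt
  refine (h1.mul_const (Real.exp (Real.pi / 2 * |s.im| + 2 * Real.pi * |m| * X))).mono'
    (hcont.aestronglyMeasurable measurableSet_Ioc) ?_
  filter_upwards [ae_restrict_mem measurableSet_Ioc] with v hv
  rw [norm_osc_neg_I_mul s α m hv.1]
  have h2 : m * v ≤ |m| * X :=
    (mul_le_mul_of_nonneg_right (le_abs_self m) hv.1.le).trans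
      (mul_le_mul_of_nonneg_left hv.2 (abs_nonneg m))
  have h3 := mul_le_mul_of_nonneg_left h2 Real.pi_pos.le
  have h4 := mul_le_mul_of_nonneg_left (neg_abs_le s.im) Real.pi_pos.le
  exact mul_le_mul_of_nonneg_left (Real.exp_le_exp.mpr (by linarith))
    (Real.rpow_nonneg hv.1.le _)

/-- Cauchy's theorem for the region swept by a ray whose starting point moves along the negative
imaginary axis. -/
theorem integral_osc_ray_shift_pos (hs0 : 0 ≤ s.re) (hs1 : s.re < 1) (hε : ε = 1 ∨ ε = -1)
    (hm : 0 < ε * m) {a X : ℝ} (ha : 0 < a) (haX : a ≤ X) :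
    ε * (1 + I) * (∫ r in Ioi (0 : ℝ), osc s α m (-(I * X) + r * (ε * (1 + I)))) =
      ε * (1 + I) * (∫ r in Ioi (0 : ℝ), osc s α m (-(I * a) + r * (ε * (1 + I)))) +
        I * ∫ v in a..X, osc s α m (-(I * v)) := by
  have hX : 0 < X := ha.trans_le haX
  have hfin : ∀ R : ℝ, 0 < R →
      ε * (1 + I) * (∫ r in (0 : ℝ)..R, osc s α m (-(I * X) + r * (ε * (1 + I)))) =
      ε * (1 + I) * (∫ r in (0 : ℝ)..R, osc s α m (-(I * a) + r * (ε * (1 + I)))) +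
        (I * (∫ v in a..X, osc s α m (-(I * v))) -
          I * ∫ v in a..X, osc s α m (-(I * v) + R * (ε * (1 + I)))) := fun R hR => by
    have hc : ∀ u r : ℝ, (0 + u * (-I) + r * (ε * (1 + I)) : ℂ) =
      -(I * u) + r * (ε * (1 + I)) := fun u r => by ring
    have key := integral_boundary_parallelogram (F := osc s α m) 0 (-I) (ε * (1 + I)) a X 0 R fun u hu r hr => by
      rw [uIcc_of_le haX] at hu
      rw [uIcc_of_le hR.le] at hr
      rw [hc]
      exact differentiableAt_osc s α m
        (ray_mem_slitPlane hε hr.1 (by linarith [hu.1, hr.1]))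
    have hc0 : ∀ u : ℝ, (0 + u * (-I) : ℂ) = -(I * u) := fun u => by ring
    simp only [ofReal_zero, zero_mul, add_zero, hc0] at key
    linear_combination key
  have htop : Tendsto (fun R : ℝ => ∫ v in a..X, osc s α m (-(I * v) + R * (ε * (1 + I))))
      atTop (𝓝 0) := by
    have hb : 0 < 2 * Real.pi * (ε * m) := by positivity
    have hlim : Tendsto (fun R : ℝ => Real.exp (Real.pi * |s.im| + 2 * Real.pi * |m| * X) *
        Real.exp (-(2 * Real.pi * (ε * m) * R)) * |X - a|) atTop (𝓝 0) := by
      have : Tendsto (fun R : ℝ => Real.exp (-(2 * Real.pi * (ε * m) * R))) atTop (𝓝 0) :=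
        Real.tendsto_exp_neg_atTop_nhds_zero.comp (tendsto_id.const_mul_atTop hb)
      simpa using (this.const_mul (Real.exp (Real.pi * |s.im| + 2 * Real.pi * |m| * X))).mul_const
        |X - a|
    refine squeeze_zero_norm' ?_ hlim
    filter_upwards [eventually_ge_atTop 1] with R hR
    refine intervalIntegral.norm_integral_le_of_norm_le_const fun v hv => ?_
    rw [uIoc_of_le haX] at hv
    refine (norm_osc_ray_le α hs0 hε (by linarith)).trans ?_
    have h1 : R ^ (-s.re) ≤ 1 := Real.rpow_le_one_of_one_le_of_nonpos hR (by linarith)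
    have hv0 : 0 < v := ha.trans hv.1
    rw [abs_of_pos hv0]
    have h2 : Real.exp (Real.pi * |s.im| + 2 * Real.pi * |m| * v) ≤
        Real.exp (Real.pi * |s.im| + 2 * Real.pi * |m| * X) := by
      gcongr; exact hv.2
    refine mul_le_mul h2 ?_ (by positivity) (Real.exp_pos _).le
    exact mul_le_of_le_one_left (Real.exp_pos _).le h1
  have l1 := (intervalIntegral_tendsto_integral_Ioi 0
    (integrableOn_osc_ray (α := α) hs0 hs1 hε hm hX.le) tendsto_id).const_mul (ε * (1 + I) : ℂ)
  have l2 := (intervalIntegral_tendsto_integral_Ioi 0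
    (integrableOn_osc_ray (α := α) hs0 hs1 hε hm ha.le) tendsto_id).const_mul (ε * (1 + I) : ℂ)
  have l3 := l2.add ((htop.const_mul I).const_sub (I * ∫ v in a..X, osc s α m (-(I * v))))
  rw [mul_zero, sub_zero] at l3
  refine tendsto_nhds_unique (l1.congr' ?_) l3
  filter_upwards [eventually_gt_atTop 0] with R hR
  exact hfin R hR

/-- The integral along a ray from `-iX` is a dual term plus the integral over the segment from `0` to
`-iX`; the limit `a → 0` in `integral_osc_ray_shift_pos`. -/
theorem integral_osc_ray_shift (hs0 : 0 ≤ s.re) (hs1 : s.re < 1) (hε : ε = 1 ∨ ε = -1)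
    (hm : 0 < ε * m) {X : ℝ} (hX : 0 < X) :
    ε * (1 + I) * (∫ r in Ioi (0 : ℝ), osc s α m (-(I * X) + r * (ε * (1 + I)))) =
      dual s α ε m + I * ∫ v in (0 : ℝ)..X, osc s α m (-(I * v)) := by
  have hb : 0 < 2 * Real.pi * (ε * m) := by positivity
  have hev : ∀ᶠ a : ℝ in 𝓝[>] 0, a ∈ Ioc 0 X := Ioc_mem_nhdsGT hX
  have l1 : Tendsto (fun a : ℝ => ∫ r in Ioi (0 : ℝ), osc s α m (-(I * a) + r * (ε * (1 + I))))
      (𝓝[>] 0) (𝓝 (∫ r in Ioi (0 : ℝ), osc s α m (r * (ε * (1 + I))))) := by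
    refine tendsto_integral_filter_of_dominated_convergence
      (fun r => Real.exp (Real.pi * |s.im| + 2 * Real.pi * |m| * X) *
        (r ^ (-s.re) * Real.exp (-(2 * Real.pi * (ε * m) * r)))) ?_ ?_
      ((integrableOn_rpow_mul_exp hs1 hb).const_mul _) ?_
    · filter_upwards [hev] with a ha
      exact (continuousOn_osc_ray s α m hε ha.1.le).aestronglyMeasurable measurableSet_Ioi
    · filter_upwards [hev] with a ha
      filter_upwards [ae_restrict_mem measurableSet_Ioi] with r hr
      have hr : 0 < r := hr
      refine (norm_osc_ray_le α hs0 hε hr).trans ?_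
      rw [abs_of_pos ha.1]
      gcongr
      exact ha.2
    · filter_upwards [ae_restrict_mem measurableSet_Ioi] with r hr
      have hr : 0 < r := hr
      have hmem := ray_mem_slitPlane (v := 0) hε hr.le (by linarith)
      have h := (differentiableAt_osc s α m hmem).continuousAt
      have h2 : ContinuousAt (fun a : ℝ => osc s α m (-(I * a) + r * (ε * (1 + I)))) 0 :=
        ContinuousAt.comp (f := fun a : ℝ => (-(I * a) + r * (ε * (1 + I)) : ℂ)) h (by fun_prop)
      have h3 := h2.tendsto.mono_left (nhdsWithin_le_nhds (s := Ioi 0))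
      simpa using h3
  have l2 : Tendsto (fun a : ℝ => ∫ v in a..X, osc s α m (-(I * v))) (𝓝[>] 0)
      (𝓝 (∫ v in (0 : ℝ)..X, osc s α m (-(I * v)))) := by
    have hint := intervalIntegrable_osc_neg_I_mul s α m hs1 hX.le
    have hint' : IntegrableOn (fun v : ℝ => osc s α m (-(I * v))) (uIcc 0 X) := by
      rw [uIcc_of_le hX.le, integrableOn_Icc_iff_integrableOn_Ioc]
      exact (intervalIntegrable_iff_integrableOn_Ioc_of_le hX.le).mp hint
    have hc := intervalIntegral.continuousOn_primitive_interval_left hint' 0 left_mem_uIcc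
    refine hc.tendsto.mono_left (nhdsWithin_le_of_mem ?_)
    rw [uIcc_of_le hX.le]
    exact mem_of_superset hev Ioc_subset_Icc_self
  have l3 := (l1.const_mul (ε * (1 + I) : ℂ)).add (l2.const_mul I)
  rw [integral_osc_ray α hs1 hε hm] at l3
  refine tendsto_nhds_unique (tendsto_const_nhds.congr' ?_) l3
  filter_upwards [hev] with a ha
  exact integral_osc_ray_shift_pos hs0 hs1 hε hm ha.1 ha.2

end shift

/-! ### The oblique line and the denominator -/

/-- The denominator `1 - exp (2πi (z - α))`, which vanishes exactly at the points `n + α`, `n ∈ ℤ`. -/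
noncomputable def den (α : ℝ) (z : ℂ) : ℂ := 1 - cexp (2 * Real.pi * I * (z - α))

theorem line_re (X r : ℝ) : (X + r * (1 + I) : ℂ).re = X + r := by simp

theorem line_im (X r : ℝ) : (X + r * (1 + I) : ℂ).im = r := by simp

theorem line_mem_slitPlane {X : ℝ} (hX : 0 < X) (r : ℝ) : (X + r * (1 + I) : ℂ) ∈ slitPlane := by
  rw [mem_slitPlane_iff, line_re, line_im]
  by_cases h : r = 0
  · left; linarith
  · right; exact h

theorem half_le_norm_line (X r : ℝ) : X / 2 ≤ ‖(X + r * (1 + I) : ℂ)‖ := by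
  have h1 := abs_re_le_norm (X + r * (1 + I) : ℂ)
  have h2 := abs_im_le_norm (X + r * (1 + I) : ℂ)
  rw [line_re] at h1
  rw [line_im] at h2
  have h3 := le_abs_self (X + r)
  have h4 := neg_abs_le r
  linarith

theorem norm_exp_two_pi_I (α : ℝ) (z : ℂ) :
    ‖cexp (2 * Real.pi * I * (z - α))‖ = Real.exp (-(2 * Real.pi * z.im)) := by
  rw [norm_exp]; congr 1; simp

/-- A point at distance at least `δ` from the integers gives a lower bound for the denominator along
the oblique line through it. -/
theorem half_le_norm_one_sub_exp {x δ : ℝ} (hδ : 0 < δ) (hδ2 : δ ≤ 1 / 2)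
    (h : ∀ n : ℤ, δ ≤ |x - n|) (r : ℝ) :
    δ / 2 ≤ ‖1 - cexp (2 * Real.pi * I * (x + r) - 2 * Real.pi * |r|)‖ := by
  set ρ := Real.exp (-(2 * Real.pi * |r|)) with hρ
  have hρ0 : 0 < ρ := Real.exp_pos _
  have hnorm : ‖cexp (2 * Real.pi * I * (x + r) - 2 * Real.pi * |r|)‖ = ρ := by
    rw [norm_exp, hρ]; congr 1; simp
  rcases le_or_gt (δ / 2) |r| with hr | hr
  · have h1 : 1 - ρ ≤ ‖1 - cexp (2 * Real.pi * I * (x + r) - 2 * Real.pi * |r|)‖ := by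
      have := norm_sub_norm_le (1 : ℂ) (cexp (2 * Real.pi * I * (x + r) - 2 * Real.pi * |r|))
      rwa [hnorm, norm_one] at this
    have h2 : ρ * (1 + 2 * Real.pi * |r|) ≤ 1 := by
      have := Real.add_one_le_exp (2 * Real.pi * |r|)
      calc _ ≤ ρ * Real.exp (2 * Real.pi * |r|) := by gcongr; linarith
        _ = 1 := by rw [hρ, ← Real.exp_add]; simp
    have h3 : 3 * δ ≤ 2 * Real.pi * |r| := by nlinarith [Real.pi_gt_three]
    have h4 : ρ * (1 + 3 * δ) ≤ 1 := (mul_le_mul_of_nonneg_left (by linarith) hρ0.le).trans h2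
    nlinarith
  · have hsq : ‖1 - cexp (2 * Real.pi * I * (x + r) - 2 * Real.pi * |r|)‖ ^ 2 =
        (1 - ρ) ^ 2 + 4 * ρ * Real.sin (Real.pi * (x + r)) ^ 2 := by
      have he : cexp (2 * Real.pi * I * (x + r) - 2 * Real.pi * |r|) =
          (ρ * Real.cos (2 * (Real.pi * (x + r))) : ℝ) +
            (ρ * Real.sin (2 * (Real.pi * (x + r))) : ℝ) * I := by
        rw [show (2 * Real.pi * I * (x + r) - 2 * Real.pi * |r| : ℂ) =
          ((-(2 * Real.pi * |r|) : ℝ) : ℂ) + ((2 * (Real.pi * (x + r)) : ℝ) : ℂ) * I by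
            push_cast; ring, Complex.exp_add, exp_mul_I, hρ]
        push_cast; ring
      rw [he, ← normSq_eq_norm_sq, normSq_apply]
      simp only [sub_re, one_re, add_re, ofReal_re, mul_re, I_re, ofReal_im, I_im, sub_im, one_im,
        add_im, mul_im]
      have h1 := Real.sin_sq_add_cos_sq (2 * (Real.pi * (x + r)))
      have h2 := Real.sin_sq_eq_half_sub (Real.pi * (x + r))
      linear_combination ρ ^ 2 * h1 - 4 * ρ * h2
    obtain ⟨n, θ, hθ, hn⟩ : ∃ (n : ℤ) (θ : ℝ), |θ| ≤ 1 / 2 ∧ x + r = θ + n :=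
      ⟨round (x + r), x + r - round (x + r), abs_sub_round _, by ring⟩
    have hsin : Real.sin (Real.pi * (x + r)) ^ 2 = Real.sin (Real.pi * |θ|) ^ 2 := by
      have h1 : 2 * (Real.pi * (x + r)) = 2 * (Real.pi * θ) + n * (2 * Real.pi) := by rw [hn]; ring
      have h2 : Real.cos (2 * (Real.pi * |θ|)) = Real.cos (2 * (Real.pi * θ)) := by
        rcases abs_cases θ with ⟨h, _⟩ | ⟨h, _⟩ <;> rw [h]
        rw [mul_neg, mul_neg, Real.cos_neg]
      rw [Real.sin_sq_eq_half_sub, Real.sin_sq_eq_half_sub, h1, Real.cos_add_int_mul_two_pi, h2]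
    have hθδ : δ / 2 ≤ |θ| := by
      have h1 := h n
      have h2 : x - n = θ - r := by linarith
      rw [h2] at h1
      have := abs_sub θ r
      linarith
    have hs : δ ≤ Real.sin (Real.pi * |θ|) := by
      have := Real.mul_le_sin (x := Real.pi * |θ|) (by positivity) (by nlinarith [Real.pi_pos])
      have h2 : 2 / Real.pi * (Real.pi * |θ|) = 2 * |θ| := by
        have := Real.pi_pos.ne'
        field_simp
      linarith
    have hρ1 : 1 / 16 ≤ ρ := by
      have h1 : -2 ≤ -(2 * Real.pi * |r|) := by nlinarith [Real.pi_lt_d2, Real.pi_pos, abs_nonneg r]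
      have h2 : Real.exp (-2) ≤ ρ := Real.exp_le_exp.mpr h1
      have h3 : (1 : ℝ) / 16 ≤ Real.exp (-2) := by
        rw [Real.exp_neg, ← one_div]
        apply one_div_le_one_div_of_le (Real.exp_pos _)
        have := Real.exp_one_lt_d9
        have h4 : Real.exp 2 = Real.exp 1 ^ 2 := by rw [← Real.exp_nat_mul]; norm_num
        rw [h4]; nlinarith [Real.exp_pos 1]
      linarith
    refine le_of_sq_le_sq ?_ (norm_nonneg _)
    rw [hsq, hsin]
    have h5 : δ ^ 2 ≤ Real.sin (Real.pi * |θ|) ^ 2 := by gcongr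
    nlinarith [sq_nonneg (1 - ρ), mul_le_mul hρ1 h5 (sq_nonneg δ) hρ0.le]

section line
variable {X α δ : ℝ}

theorem le_norm_den_of_nonneg (hδ : 0 < δ) (hδ2 : δ ≤ 1 / 2) (h : ∀ n : ℤ, δ ≤ |X - α - n|)
    {r : ℝ} (hr : 0 ≤ r) : δ / 2 ≤ ‖den α (X + r * (1 + I))‖ := by
  have h1 := half_le_norm_one_sub_exp hδ hδ2 h r
  rw [abs_of_nonneg hr] at h1
  rw [den]
  convert h1 using 4
  push_cast
  linear_combination (2 * Real.pi * r : ℂ) * I_sq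

theorem le_norm_den_of_nonpos (hδ : 0 < δ) (hδ2 : δ ≤ 1 / 2) (h : ∀ n : ℤ, δ ≤ |X - α - n|)
    {r : ℝ} (hr : r ≤ 0) :
    δ / 2 * Real.exp (-(2 * Real.pi * r)) ≤ ‖den α (X + r * (1 + I))‖ := by
  have h1 := half_le_norm_one_sub_exp hδ hδ2 h r
  rw [abs_of_nonpos hr] at h1
  have hq := norm_exp_two_pi_I α (X + r * (1 + I))
  rw [line_im] at hq
  set q := cexp (2 * Real.pi * I * ((X + r * (1 + I) : ℂ) - α)) with hqdef
  have hq0 : q ≠ 0 := Complex.exp_ne_zero _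
  have hw : cexp (2 * Real.pi * I * (((X - α : ℝ) : ℂ) + r) - 2 * Real.pi * ((-r : ℝ) : ℂ)) =
      (starRingEnd ℂ) q⁻¹ := by
    rw [hqdef, ← Complex.exp_neg, ← exp_conj]
    congr 1
    simp only [map_neg, map_mul, map_sub, map_add, conj_ofReal, conj_I, map_one, map_ofNat]
    push_cast
    linear_combination (2 * Real.pi * r : ℂ) * I_sq
  rw [hw, ← map_one (starRingEnd ℂ), ← map_sub, norm_conj] at h1
  have h2 : den α (X + r * (1 + I)) = -(q * (1 - q⁻¹)) := by
    rw [den, ← hqdef]; field_simp; ring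
  rw [h2, norm_neg, norm_mul, hq, mul_comm]
  gcongr

theorem den_ne_zero_of_im_ne {z : ℂ} (hz : z.im ≠ 0) : den α z ≠ 0 := by
  intro h
  have h1 : cexp (2 * Real.pi * I * (z - α)) = 1 := (sub_eq_zero.mp h).symm
  have h2 := norm_exp_two_pi_I α z
  rw [h1, norm_one, eq_comm, Real.exp_eq_one_iff, neg_eq_zero] at h2
  have := Real.pi_pos.ne'
  simp_all

theorem exists_int_of_den_eq_zero {z : ℂ} (h : den α z = 0) : ∃ n : ℤ, z = n + α := by
  have h1 : cexp (2 * Real.pi * I * (z - α)) = 1 := (sub_eq_zero.mp h).symm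
  obtain ⟨n, hn⟩ := Complex.exp_eq_one_iff.mp h1
  refine ⟨n, ?_⟩
  have h2 : z - α = n := mul_left_cancel₀ two_pi_I_ne_zero (by rw [hn]; ring)
  linear_combination h2

theorem continuous_den (α : ℝ) : Continuous (den α) := by unfold den; fun_prop

theorem continuous_osc_div_den_line (hX : 0 < X) (hδ : 0 < δ) (hδ2 : δ ≤ 1 / 2)
    (h : ∀ n : ℤ, δ ≤ |X - α - n|) (s : ℂ) (m : ℝ) :
    Continuous fun r : ℝ => osc s α m (X + r * (1 + I)) / den α (X + r * (1 + I)) := by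
  refine continuous_iff_continuousAt.mpr fun r => ?_
  have h1 := (differentiableAt_osc s α m (line_mem_slitPlane hX r)).continuousAt
  have h2 : ContinuousAt (fun r : ℝ => (X + r * (1 + I) : ℂ)) r := by fun_prop
  refine (ContinuousAt.comp (f := fun r : ℝ => (X + r * (1 + I) : ℂ)) h1 h2).div
    (ContinuousAt.comp (f := fun r : ℝ => (X + r * (1 + I) : ℂ))
      (continuous_den α).continuousAt h2) ?_
  rw [← norm_pos_iff]
  rcases le_total 0 r with hr | hr
  · exact lt_of_lt_of_le (by positivity) (le_norm_den_of_nonneg hδ hδ2 h hr)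
  · exact lt_of_lt_of_le (by positivity) (le_norm_den_of_nonpos hδ hδ2 h hr)

theorem norm_osc_line_le {s : ℂ} (hs : 0 ≤ s.re) (hX : 0 < X) (m r : ℝ) :
    ‖osc s α m (X + r * (1 + I))‖ ≤ (X / 2) ^ (-s.re) * (Real.exp (Real.pi * |s.im|) *
      Real.exp (-(2 * Real.pi * m * r))) := by
  have h1 := norm_osc_le s α m (slitPlane_ne_zero (line_mem_slitPlane hX r))
  rw [line_im] at h1
  refine h1.trans ?_
  gcongr ?_ * _
  exact Real.rpow_le_rpow_of_nonpos (by linarith) (half_le_norm_line X r) (by linarith)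

/-- On the upper half of the line the integrand decays like `exp (-2π m r)`. -/
theorem norm_osc_div_den_le_of_nonneg {s : ℂ} (hs : 0 ≤ s.re) (hX : 0 < X) (hδ : 0 < δ)
    (hδ2 : δ ≤ 1 / 2) (h : ∀ n : ℤ, δ ≤ |X - α - n|) (m : ℝ) {r : ℝ} (hr : 0 ≤ r) :
    ‖osc s α m (X + r * (1 + I)) / den α (X + r * (1 + I))‖ ≤
      2 / δ * Real.exp (Real.pi * |s.im|) * (X / 2) ^ (-s.re) *
        Real.exp (-(2 * Real.pi * m * r)) := by
  rw [norm_div, div_le_iff₀ (lt_of_lt_of_le (by positivity) (le_norm_den_of_nonneg hδ hδ2 h hr))]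
  refine (norm_osc_line_le hs hX m r).trans ?_
  calc _ = 2 / δ * Real.exp (Real.pi * |s.im|) * (X / 2) ^ (-s.re) *
        Real.exp (-(2 * Real.pi * m * r)) * (δ / 2) := by field_simp
    _ ≤ _ := by gcongr; exact le_norm_den_of_nonneg hδ hδ2 h hr

/-- On the lower half of the line the integrand decays like `exp (-2π (1 - m) |r|)`. -/
theorem norm_osc_div_den_le_of_nonpos {s : ℂ} (hs : 0 ≤ s.re) (hX : 0 < X) (hδ : 0 < δ)
    (hδ2 : δ ≤ 1 / 2) (h : ∀ n : ℤ, δ ≤ |X - α - n|) (m : ℝ) {r : ℝ} (hr : r ≤ 0) :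
    ‖osc s α m (X + r * (1 + I)) / den α (X + r * (1 + I))‖ ≤
      2 / δ * Real.exp (Real.pi * |s.im|) * (X / 2) ^ (-s.re) *
        Real.exp (2 * Real.pi * (1 - m) * r) := by
  rw [norm_div, div_le_iff₀ (lt_of_lt_of_le (by positivity) (le_norm_den_of_nonpos hδ hδ2 h hr))]
  refine (norm_osc_line_le hs hX m r).trans ?_
  have he : Real.exp (2 * Real.pi * (1 - m) * r) * Real.exp (-(2 * Real.pi * r)) =
      Real.exp (-(2 * Real.pi * m * r)) := by rw [← Real.exp_add]; congr 1; ring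
  calc _ = 2 / δ * Real.exp (Real.pi * |s.im|) * (X / 2) ^ (-s.re) *
        Real.exp (2 * Real.pi * (1 - m) * r) * (δ / 2 * Real.exp (-(2 * Real.pi * r))) := by
        rw [← he]; field_simp
    _ ≤ _ := by gcongr; exact le_norm_den_of_nonpos hδ hδ2 h hr

end line

/-! ### Crossing a pole -/

section residue
variable {s : ℂ} {α m X : ℝ}

/-- Away from the real axis the integrand is `O(|Im z| ^ (-Re s))`. -/
theorem norm_osc_div_den_edge_le (hs : 0 ≤ s.re) (hm0 : 0 ≤ m) (hm1 : m ≤ 1) {z : ℂ}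
    (hz : 1 ≤ |z.im|) :
    ‖osc s α m z / den α z‖ ≤ 2 * Real.exp (Real.pi * |s.im|) * |z.im| ^ (-s.re) := by
  have hz0 : z ≠ 0 := by rintro rfl; simp at hz; linarith
  have hpos : 0 < |z.im| := by linarith
  have h1 : ‖z‖ ^ (-s.re) ≤ |z.im| ^ (-s.re) :=
    Real.rpow_le_rpow_of_nonpos hpos (abs_im_le_norm z) (by linarith)
  have hq := norm_exp_two_pi_I α z
  -- `exp (-2π m Im z) ≤ 2 |den|` in both half-planes
  have h2 : Real.exp (-(2 * Real.pi * m * z.im)) ≤ 2 * ‖den α z‖ := by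
    have he : Real.exp (-(2 * Real.pi)) ≤ 1 / 2 := by
      have := Real.add_one_le_exp (2 * Real.pi)
      rw [Real.exp_neg, inv_eq_one_div]
      apply one_div_le_one_div_of_le (by norm_num)
      linarith [Real.pi_gt_three]
    rcases le_total 0 z.im with h0 | h0
    · rw [abs_of_nonneg h0] at hz
      have h3 := norm_sub_norm_le (1 : ℂ) (cexp (2 * Real.pi * I * (z - α)))
      rw [hq, norm_one] at h3
      have h4 : Real.exp (-(2 * Real.pi * z.im)) ≤ Real.exp (-(2 * Real.pi)) := by
        apply Real.exp_le_exp.mpr; nlinarith [Real.pi_pos]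
      have h5 : Real.exp (-(2 * Real.pi * m * z.im)) ≤ 1 := by
        apply Real.exp_le_one_iff.mpr
        have : 0 ≤ 2 * Real.pi * m * z.im := by positivity
        linarith
      rw [den]; linarith
    · rw [abs_of_nonpos h0] at hz
      have h3 := norm_sub_norm_le (cexp (2 * Real.pi * I * (z - α))) (1 : ℂ)
      rw [hq, norm_one, norm_sub_rev] at h3
      have h4 : Real.exp (2 * Real.pi) ≤ Real.exp (-(2 * Real.pi * z.im)) := by
        apply Real.exp_le_exp.mpr; nlinarith [Real.pi_pos]
      have h5 : Real.exp (-(2 * Real.pi * m * z.im)) ≤ Real.exp (-(2 * Real.pi * z.im)) := by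
        apply Real.exp_le_exp.mpr
        have h6 : 0 ≤ (1 - m) * (Real.pi * (-z.im)) :=
          mul_nonneg (by linarith) (mul_nonneg Real.pi_pos.le (by linarith))
        nlinarith
      have h6 := Real.add_one_le_exp (2 * Real.pi)
      have := Real.pi_gt_three
      rw [den]; linarith
  have hd : den α z ≠ 0 := den_ne_zero_of_im_ne (by intro h; rw [h] at hz; norm_num at hz)
  rw [norm_div, div_le_iff₀ (norm_pos_iff.mpr hd)]
  refine (norm_osc_le s α m hz0).trans ?_
  calc _ ≤ |z.im| ^ (-s.re) * (Real.exp (Real.pi * |s.im|) * (2 * ‖den α z‖)) := by gcongr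
    _ = _ := by ring

theorem osc_natCast_add {n : ℕ} :
    osc s α m (n + α) = cexp (2 * Real.pi * I * n * m) / ((n : ℂ) + α) ^ s := by
  rw [osc, cpow_neg, div_eq_mul_inv, mul_comm]
  congr 2; ring

/-- Shifting the line across the pole at `n + α` picks up the `n`-th term of the series. -/
theorem tendsto_integral_line_sub (hs : 0 < s.re) (hm0 : 0 ≤ m) (hm1 : m ≤ 1) (hX : 0 < X) {n : ℕ}
    (h1 : X < n + α) (h2 : n + α < X + 1) :
    Tendsto (fun R : ℝ =>
      (1 + I) * (∫ r in (-R)..R, osc s α m (X + r * (1 + I)) / den α (X + r * (1 + I))) -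
      (1 + I) * ∫ r in (-R)..R,
        osc s α m ((X + 1 : ℝ) + r * (1 + I)) / den α ((X + 1 : ℝ) + r * (1 + I)))
      atTop (𝓝 (osc s α m (n + α))) := by
  set p : ℝ := n + α with hp
  have hpc : ((n : ℂ) + α) = p := by rw [hp]; push_cast; ring
  have hdp : den α p = 0 := by
    rw [den, ← hpc, show (2 * Real.pi * I * ((n : ℂ) + α - α)) = n * (2 * Real.pi * I) by ring,
      exp_nat_mul_two_pi_mul_I, sub_self]
  have hderiv : HasDerivAt (den α) (-(2 * Real.pi * I)) p := by
    have h3 : HasDerivAt (fun z : ℂ => 2 * Real.pi * I * (z - α)) (2 * Real.pi * I) p := by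
      simpa using ((hasDerivAt_id (p : ℂ)).sub_const (α : ℂ)).const_mul (2 * Real.pi * I : ℂ)
    have h4 := h3.cexp.const_sub 1
    have h5 : cexp (2 * Real.pi * I * (p - α)) = 1 := by
      have := hdp; rw [den, sub_eq_zero] at this; exact this.symm
    rw [h5, one_mul] at h4
    exact h4
  have hdiff : Differentiable ℂ (den α) := by unfold den; fun_prop
  have hds : DifferentiableOn ℂ (dslope (den α) p) univ :=
    (differentiableOn_dslope univ_mem).mpr hdiff.differentiableOn
  have hdsp : dslope (den α) p p = -(2 * Real.pi * I) := by rw [dslope_same, hderiv.deriv]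
  have hdsne : ∀ z : ℂ, z ≠ p → dslope (den α) p z = den α z / (z - p) := fun z hz => by
    rw [dslope_of_ne _ hz, slope_def_field, hdp, sub_zero]
  set U : Set ℂ := slitPlane ∩ {z | dslope (den α) p z ≠ 0} with hU
  have hUo : IsOpen U := isOpen_slitPlane.inter
    (isOpen_ne_fun (continuousOn_univ.mp hds.continuousOn) continuous_const)
  have hA : DifferentiableOn ℂ (fun z => osc s α m z / dslope (den α) p z) U := fun z hz =>
    ((differentiableAt_osc s α m hz.1).div (hds.differentiableAt univ_mem)
      hz.2).differentiableWithinAt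
  have hpU : (p : ℂ) ∈ U := by
    refine ⟨ofReal_mem_slitPlane.mpr (hX.trans h1), ?_⟩
    rw [Set.mem_ofPred_eq, hdsp, neg_ne_zero]; exact two_pi_I_ne_zero
  have hdne : ∀ u ∈ Icc (0 : ℝ) 1, ∀ r : ℝ, (X + u + r * (1 + I) : ℂ) ≠ p →
      den α (X + u + r * (1 + I)) ≠ 0 := fun u hu r hne h0 => by
    obtain ⟨k, hk⟩ := exists_int_of_den_eq_zero h0
    have him := congrArg im hk
    have hre := congrArg re hk
    simp at him hre
    rw [him, add_zero] at hre
    have hk1 : (k : ℝ) < n + 1 := by linarith [hu.2]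
    have hk2 : (n : ℝ) < k + 1 := by linarith [hu.1]
    have hk3 : k = n := by
      have a1 : k < n + 1 := by exact_mod_cast hk1
      have a2 : (n : ℤ) < k + 1 := by exact_mod_cast hk2
      omega
    apply hne
    rw [hk, hk3, ← hpc]; push_cast; ring
  have hmem : ∀ u ∈ Icc (0 : ℝ) 1, ∀ r : ℝ, (X + u + r * (1 + I) : ℂ) ∈ U := fun u hu r => by
    refine ⟨?_, ?_⟩
    · have := line_mem_slitPlane (X := X + u) (by linarith [hu.1]) r
      push_cast at this; exact this
    · rw [Set.mem_ofPred_eq]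
      by_cases hz : (X + u + r * (1 + I) : ℂ) = p
      · rw [hz]; exact hpU.2
      · rw [hdsne _ hz]
        exact div_ne_zero (hdne u hu r hz) (sub_ne_zero.mpr hz)
  have hquot : ∀ z : ℂ, z ≠ p →
      osc s α m z / dslope (den α) p z / (z - p) = osc s α m z / den α z := fun z hz => by
    rw [hdsne z hz]
    have := sub_ne_zero.mpr hz
    field_simp
  have hfin : ∀ R : ℝ, 0 < R →
      (1 + I) * (∫ r in (-R)..R, osc s α m (X + r * (1 + I)) / den α (X + r * (1 + I))) -
      (1 + I) * (∫ r in (-R)..R,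
        osc s α m ((X + 1 : ℝ) + r * (1 + I)) / den α ((X + 1 : ℝ) + r * (1 + I))) =
      osc s α m p -
        ((∫ u in (0 : ℝ)..1, osc s α m (X + u + R * (1 + I)) / den α (X + u + R * (1 + I))) -
        ∫ u in (0 : ℝ)..1, osc s α m (X + u + (-R : ℝ) * (1 + I)) /
          den α (X + u + (-R : ℝ) * (1 + I))) := fun R hR => by
    have key := cauchy_parallelogram hUo hA h1 h2 hR hpU fun u hu r _ => hmem u hu r
    have c1 : ∀ r : ℝ, (X + 1 + r * (1 + I) : ℂ) ≠ p := fun r h => by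
      have him := congrArg im h
      have hre := congrArg re h
      simp at him hre
      rw [him] at hre
      linarith
    have c2 : ∀ r : ℝ, (X + r * (1 + I) : ℂ) ≠ p := fun r h => by
      have him := congrArg im h
      have hre := congrArg re h
      simp at him hre
      rw [him] at hre
      linarith
    have c3 : ∀ u R' : ℝ, R' ≠ 0 → (X + u + R' * (1 + I) : ℂ) ≠ p := fun u R' h0 h => by
      have him := congrArg im h
      simp at him
      exact h0 him
    have hA : 2 * Real.pi * I * (osc s α m p / dslope (den α) p p) = -osc s α m p := by
      rw [hdsp]
      have := two_pi_I_ne_zero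
      field_simp
    simp only [hquot _ (c1 _), hquot _ (c2 _), hquot _ (c3 _ R hR.ne'),
      hquot _ (c3 _ (-R) (neg_ne_zero.mpr hR.ne')), hA] at key
    have hcast : ((X + 1 : ℝ) : ℂ) = X + 1 := by push_cast; ring
    rw [hcast]
    linear_combination -key
  have hedge : ∀ ε : ℝ, |ε| = 1 → Tendsto (fun R : ℝ => ∫ u in (0 : ℝ)..1,
      osc s α m (X + u + (ε * R : ℝ) * (1 + I)) / den α (X + u + (ε * R : ℝ) * (1 + I)))
      atTop (𝓝 0) := fun ε hε => by
    have hlim : Tendsto (fun R : ℝ => 2 * Real.exp (Real.pi * |s.im|) * R ^ (-s.re)) atTop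
        (𝓝 0) := by
      simpa using (tendsto_rpow_neg_atTop hs).const_mul (2 * Real.exp (Real.pi * |s.im|))
    refine squeeze_zero_norm' ?_ hlim
    filter_upwards [eventually_ge_atTop 1] with R hR
    have him : ∀ u : ℝ, |(X + u + (ε * R : ℝ) * (1 + I) : ℂ).im| = R := fun u => by
      simp [abs_mul, hε]; linarith
    have := intervalIntegral.norm_integral_le_of_norm_le_const (a := 0) (b := 1)
      (f := fun u : ℝ => osc s α m (X + u + (ε * R : ℝ) * (1 + I)) /
        den α (X + u + (ε * R : ℝ) * (1 + I)))
      (C := 2 * Real.exp (Real.pi * |s.im|) * R ^ (-s.re)) fun u _ => by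
        have := norm_osc_div_den_edge_le (α := α) hs.le hm0 hm1
          (z := X + u + (ε * R : ℝ) * (1 + I)) (by rw [him]; exact hR)
        rwa [him] at this
    simpa using this
  have l1 := hedge 1 (by simp)
  have l2 := hedge (-1) (by simp)
  simp only [one_mul, neg_one_mul] at l1 l2
  have l3 := (l1.sub l2).const_sub (osc s α m p)
  rw [sub_zero, sub_zero] at l3
  rw [hpc]
  refine l3.congr' ?_
  filter_upwards [eventually_gt_atTop 0] with R hR
  exact (hfin R hR).symm

end residue

/-! ### The continued tail of the Lerch series -/

theorem isOpen_quadrant : IsOpen {s : ℂ | 0 < s.re ∧ 0 < s.im} :=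
  (isOpen_lt continuous_const continuous_re).inter (isOpen_lt continuous_const continuous_im)

theorem isPreconnected_quadrant : IsPreconnected {s : ℂ | 0 < s.re ∧ 0 < s.im} :=
  ((convex_halfSpace_re_gt 0).inter (convex_halfSpace_im_gt 0)).isPreconnected

/-- A function that is approximated by holomorphic functions, with an error that tends to zero
locally uniformly in the open first quadrant, is the continuation of the limit found for
`1 < Re s`. -/
theorem eqOn_quadrant_of_norm_sub_le {g : ℕ → ℂ → ℂ} {V Z : ℂ → ℂ} {C X : ℝ} (hX : 0 < X)
    (hg : ∀ M, DifferentiableOn ℂ (g M) {s : ℂ | 0 < s.re ∧ 0 < s.im})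
    (hZ : DifferentiableOn ℂ Z {s : ℂ | 0 < s.re ∧ 0 < s.im})
    (hb : ∀ M : ℕ, ∀ s : ℂ, 0 < s.re → 0 < s.im →
      ‖V s - g M s‖ ≤ C * Real.exp (Real.pi * |s.im|) * ((X + M) / 2) ^ (-s.re))
    (hlim : ∀ s : ℂ, 1 < s.re → 0 < s.im → Tendsto (fun M => g M s) atTop (𝓝 (Z s))) {s : ℂ}
    (hs : 0 < s.re) (ht : 0 < s.im) : V s = Z s := by
  have hXM : Tendsto (fun M : ℕ => (X + M) / 2) atTop atTop :=
    (tendsto_atTop_add_const_left _ X tendsto_natCast_atTop_atTop).atTop_div_const two_pos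
  have hC : 0 ≤ C := by
    have h := (norm_nonneg _).trans (hb 0 s hs ht)
    by_contra hC
    have h1 : 0 < Real.exp (Real.pi * |s.im|) * ((X + (0 : ℕ)) / 2) ^ (-s.re) := by
      have : 0 < (X + (0 : ℕ)) / 2 := by simpa using hX
      positivity
    nlinarith
  have hunif : TendstoLocallyUniformlyOn g V atTop {s : ℂ | 0 < s.re ∧ 0 < s.im} := by
    rw [Metric.tendstoLocallyUniformlyOn_iff]
    intro ε hε s₀ hs₀
    set K := C * Real.exp (Real.pi * (|s₀.im| + 1))
    have hlim0 : Tendsto (fun M : ℕ => K * ((X + M) / 2) ^ (-(s₀.re / 2))) atTop (𝓝 0) := by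
      have := (tendsto_rpow_neg_atTop (half_pos hs₀.1)).comp hXM
      simpa using this.const_mul K
    refine ⟨_, inter_mem self_mem_nhdsWithin (mem_nhdsWithin_of_mem_nhds
      (s := {s : ℂ | s₀.re / 2 < s.re ∧ |s.im| < |s₀.im| + 1}) ?_), ?_⟩
    · refine IsOpen.mem_nhds ((isOpen_lt continuous_const continuous_re).inter
        (isOpen_lt (continuous_im.abs) continuous_const)) ⟨?_, ?_⟩
      · have : 0 < s₀.re := hs₀.1
        exact half_lt_self this
      · exact lt_add_one |s₀.im|
    · filter_upwards [hlim0.eventually (gt_mem_nhds hε), hXM.eventually_ge_atTop 1] with M hM hM1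
      rintro s ⟨⟨hs3, hs4⟩, hs1, hs2⟩
      rw [dist_eq_norm]
      refine lt_of_le_of_lt ?_ hM
      refine (hb M s hs3 hs4).trans ?_
      have h1 : ((X + M) / 2) ^ (-s.re) ≤ ((X + M) / 2) ^ (-(s₀.re / 2)) :=
        Real.rpow_le_rpow_of_exponent_le hM1 (neg_le_neg hs1.le)
      have h2 : C * Real.exp (Real.pi * |s.im|) ≤ K :=
        mul_le_mul_of_nonneg_left (Real.exp_le_exp.mpr
          (mul_le_mul_of_nonneg_left hs2.le Real.pi_pos.le)) hC
      exact mul_le_mul h2 h1 (by positivity) (by positivity)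
  have hV : DifferentiableOn ℂ V {s : ℂ | 0 < s.re ∧ 0 < s.im} :=
    hunif.differentiableOn (Eventually.of_forall hg) isOpen_quadrant
  refine (hV.analyticOnNhd isOpen_quadrant).eqOn_of_preconnected_of_eventuallyEq
    (hZ.analyticOnNhd isOpen_quadrant) isPreconnected_quadrant (z₀ := 2 + I) (by simp) ?_ ⟨hs, ht⟩
  have hev : ∀ᶠ z : ℂ in 𝓝 (2 + I), 1 < z.re ∧ 0 < z.im :=
    ((isOpen_lt continuous_const continuous_re).inter
      (isOpen_lt continuous_const continuous_im)).mem_nhds (by constructor <;> simp)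
  filter_upwards [hev] with z hz
  exact tendsto_nhds_unique (hunif.tendsto_at ⟨by linarith [hz.1], hz.2⟩) (hlim z hz.1 hz.2)

section tails
variable {s : ℂ} {α δ m X : ℝ}

theorem integrableOn_Ioi_osc_div_den (hs : 0 ≤ s.re) (hX : 0 < X) (hδ : 0 < δ)
    (hδ2 : δ ≤ 1 / 2) (h : ∀ n : ℤ, δ ≤ |X - α - n|) (hm : 0 < m) :
    IntegrableOn (fun r : ℝ => osc s α m (X + r * (1 + I)) / den α (X + r * (1 + I))) (Ioi 0) ∧
    ‖∫ r in Ioi (0 : ℝ), osc s α m (X + r * (1 + I)) / den α (X + r * (1 + I))‖ ≤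
      2 / δ * (2 * Real.pi * m)⁻¹ * Real.exp (Real.pi * |s.im|) * (X / 2) ^ (-s.re) := by
  have hb : 0 < 2 * Real.pi * m := by positivity
  have hint : IntegrableOn (fun r : ℝ => 2 / δ * Real.exp (Real.pi * |s.im|) * (X / 2) ^ (-s.re) *
      Real.exp (-(2 * Real.pi * m) * r)) (Ioi 0) :=
    (integrableOn_exp_mul_Ioi (by linarith) 0).const_mul _
  have hle : ∀ᵐ r : ℝ ∂(volume.restrict (Ioi (0 : ℝ))),
      ‖osc s α m (X + r * (1 + I)) / den α (X + r * (1 + I))‖ ≤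
      2 / δ * Real.exp (Real.pi * |s.im|) * (X / 2) ^ (-s.re) *
        Real.exp (-(2 * Real.pi * m) * r) := by
    filter_upwards [ae_restrict_mem measurableSet_Ioi] with r hr
    rw [neg_mul]
    exact norm_osc_div_den_le_of_nonneg hs hX hδ hδ2 h m (le_of_lt hr)
  refine ⟨hint.mono' (continuous_osc_div_den_line hX hδ hδ2 h s m).aestronglyMeasurable hle, ?_⟩
  refine (norm_integral_le_of_norm_le hint hle).trans (le_of_eq ?_)
  rw [integral_const_mul, integral_exp_mul_Ioi (by linarith)]
  simp only [mul_zero, Real.exp_zero, neg_div_neg_eq, one_div]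
  ring

theorem integrableOn_Iic_osc_div_den (hs : 0 ≤ s.re) (hX : 0 < X) (hδ : 0 < δ)
    (hδ2 : δ ≤ 1 / 2) (h : ∀ n : ℤ, δ ≤ |X - α - n|) (hm : m < 1) :
    IntegrableOn (fun r : ℝ => osc s α m (X + r * (1 + I)) / den α (X + r * (1 + I))) (Iic 0) ∧
    ‖∫ r in Iic (0 : ℝ), osc s α m (X + r * (1 + I)) / den α (X + r * (1 + I))‖ ≤
      2 / δ * (2 * Real.pi * (1 - m))⁻¹ * Real.exp (Real.pi * |s.im|) * (X / 2) ^ (-s.re) := by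
  have hb : 0 < 2 * Real.pi * (1 - m) := mul_pos (by positivity) (by linarith)
  have hint : IntegrableOn (fun r : ℝ => 2 / δ * Real.exp (Real.pi * |s.im|) * (X / 2) ^ (-s.re) *
      Real.exp (2 * Real.pi * (1 - m) * r)) (Iic 0) :=
    (integrableOn_exp_mul_Iic hb 0).const_mul _
  have hle : ∀ᵐ r : ℝ ∂(volume.restrict (Iic (0 : ℝ))),
      ‖osc s α m (X + r * (1 + I)) / den α (X + r * (1 + I))‖ ≤
      2 / δ * Real.exp (Real.pi * |s.im|) * (X / 2) ^ (-s.re) *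
        Real.exp (2 * Real.pi * (1 - m) * r) := by
    filter_upwards [ae_restrict_mem measurableSet_Iic] with r hr
    exact norm_osc_div_den_le_of_nonpos hs hX hδ hδ2 h m hr
  refine ⟨hint.mono' (continuous_osc_div_den_line hX hδ hδ2 h s m).aestronglyMeasurable hle, ?_⟩
  refine (norm_integral_le_of_norm_le hint hle).trans (le_of_eq ?_)
  rw [integral_const_mul, integral_exp_mul_Iic hb]
  simp only [mul_zero, Real.exp_zero, one_div]
  ring

theorem norm_one_add_I_le : ‖(1 + I : ℂ)‖ ≤ 2 := by
  refine (norm_add_le _ _).trans ?_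
  simp; norm_num

theorem integrable_osc_div_den (hs : 0 ≤ s.re) (hX : 0 < X) (hδ : 0 < δ)
    (hδ2 : δ ≤ 1 / 2) (h : ∀ n : ℤ, δ ≤ |X - α - n|) (hm0 : 0 < m) (hm1 : m < 1) :
    Integrable fun r : ℝ => osc s α m (X + r * (1 + I)) / den α (X + r * (1 + I)) := by
  rw [← integrableOn_univ, ← Iic_union_Ioi (a := (0 : ℝ))]
  exact (integrableOn_Iic_osc_div_den hs hX hδ hδ2 h hm1).1.union
    (integrableOn_Ioi_osc_div_den hs hX hδ hδ2 h hm0).1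

theorem differentiable_osc_param (α m : ℝ) {z : ℂ} (hz : z ≠ 0) :
    Differentiable ℂ fun s => osc s α m z := by
  unfold osc
  exact ((differentiable_id.neg.const_cpow (Or.inl hz))).mul_const _

/-- The tail of the Lerch series, continued, as an integral along an oblique line. -/
theorem lerchZeta_sub_sum_eq_integral (hα : 0 < α) (hδ : 0 < δ) (hδ2 : δ ≤ 1 / 2)
    (hm0 : 0 < m) (hm1 : m < 1) (hX : 0 < X) (h : ∀ n : ℤ, δ ≤ |X - α - n|) {N : ℕ}
    (h1 : X < N + α) (h2 : N + α < X + 1) (hs : 0 < s.re) (ht : 0 < s.im) :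
    lerchZeta α m s - ∑ n ∈ Finset.range N, osc s α m (n + α) =
      (1 + I) * ∫ r : ℝ, osc s α m (X + r * (1 + I)) / den α (X + r * (1 + I)) := by
  have hspec := lerchZeta_spec hα hm0 hm1
  have hne : ∀ n : ℕ, (n + α : ℂ) ≠ 0 := fun n => by
    have h3 : ((n + α : ℝ) : ℂ) ≠ 0 := ofReal_ne_zero.mpr (by positivity)
    simpa using h3
  have hdist : ∀ M : ℕ, ∀ n : ℤ, δ ≤ |X + M - α - n| := fun M n => by
    have := h (n - M)
    push_cast at this
    rwa [show X - α - (n - M) = X + M - α - n by ring] at this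
  have hXM : ∀ M : ℕ, 0 < X + M := fun M => by positivity
  have hstep : ∀ s : ℂ, 0 < s.re → ∀ M : ℕ,
      (1 + I) * (∫ r : ℝ, osc s α m ((X + M : ℝ) + r * (1 + I)) /
        den α ((X + M : ℝ) + r * (1 + I))) -
      (1 + I) * (∫ r : ℝ, osc s α m ((X + (M + 1 : ℕ) : ℝ) + r * (1 + I)) /
        den α ((X + (M + 1 : ℕ) : ℝ) + r * (1 + I))) = osc s α m ((N + M : ℕ) + α) := by
    intro s hs M
    have key := tendsto_integral_line_sub (s := s) (α := α) (n := N + M) hs hm0.le hm1.le (hXM M)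
      (by push_cast; linarith) (by push_cast; linarith)
    have i1 := integrable_osc_div_den hs.le (hXM M) hδ hδ2 (hdist M) hm0 hm1
    have i2 := integrable_osc_div_den hs.le (hXM (M + 1)) hδ hδ2 (hdist (M + 1)) hm0 hm1
    rw [show X + M + 1 = X + (M + 1 : ℕ) by push_cast; ring] at key
    exact tendsto_nhds_unique
      (((intervalIntegral_tendsto_integral i1 tendsto_neg_atTop_atBot tendsto_id).const_mul _).sub
      ((intervalIntegral_tendsto_integral i2 tendsto_neg_atTop_atBot tendsto_id).const_mul _)) key
  have hsum : ∀ s : ℂ, 0 < s.re → ∀ M : ℕ,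
      (1 + I) * (∫ r : ℝ, osc s α m (X + r * (1 + I)) / den α (X + r * (1 + I))) -
        ∑ j ∈ Finset.range M, osc s α m ((N + j : ℕ) + α) =
      (1 + I) * ∫ r : ℝ, osc s α m ((X + M : ℝ) + r * (1 + I)) /
        den α ((X + M : ℝ) + r * (1 + I)) := by
    intro s hs M
    induction M with
    | zero => simp
    | succ M ih =>
      rw [Finset.sum_range_succ, ← hstep s hs M, ← sub_sub, ih]; ring
  symm
  refine eqOn_quadrant_of_norm_sub_le
    (g := fun M s => ∑ j ∈ Finset.range M, osc s α m ((N + j : ℕ) + α))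
    (V := fun s => (1 + I) * ∫ r : ℝ, osc s α m (X + r * (1 + I)) / den α (X + r * (1 + I)))
    (Z := fun s => lerchZeta α m s - ∑ n ∈ Finset.range N, osc s α m (n + α))
    (C := 2 * (2 / δ * (2 * Real.pi * (1 - m))⁻¹ + 2 / δ * (2 * Real.pi * m)⁻¹)) hX
    (fun M => ?_) ?_ (fun M s hs _ => ?_) (fun s hs _ => ?_) hs ht
  · exact (Differentiable.fun_sum fun j _ =>
      differentiable_osc_param α m (hne _)).differentiableOn
  · exact (hspec.1.sub (Differentiable.fun_sum fun j _ =>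
      differentiable_osc_param α m (hne _))).differentiableOn
  · rw [hsum s hs M, norm_mul]
    have i1 := integrableOn_Iic_osc_div_den hs.le (hXM M) hδ hδ2 (hdist M) hm1
    have i2 := integrableOn_Ioi_osc_div_den hs.le (hXM M) hδ hδ2 (hdist M) hm0
    rw [← intervalIntegral.integral_Iic_add_Ioi i1.1 i2.1]
    calc _ ≤ 2 * (2 / δ * (2 * Real.pi * (1 - m))⁻¹ * Real.exp (Real.pi * |s.im|) *
            ((X + M) / 2) ^ (-s.re) + 2 / δ * (2 * Real.pi * m)⁻¹ *
            Real.exp (Real.pi * |s.im|) * ((X + M) / 2) ^ (-s.re)) :=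
          mul_le_mul norm_one_add_I_le ((norm_add_le _ _).trans (add_le_add i1.2 i2.2))
            (norm_nonneg _) two_pos.le
      _ = _ := by ring
  · have hT := (hspec.2 s hs).tendsto_sum_nat.comp (tendsto_add_atTop_nat N)
    refine (hT.sub_const (∑ n ∈ Finset.range N, osc s α m (n + α))).congr fun M => ?_
    simp only [Function.comp, ← osc_natCast_add]
    rw [add_comm M N, Finset.sum_range_add, add_sub_cancel_left]

end tails

/-! ### The first dual term -/

theorem setIntegral_Ioi_neg_eq (f : ℝ → ℂ) (X : ℝ) :
    ∫ r in Ioi (-X), f r = ∫ r in Ioi (0 : ℝ), f (r - X) := by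
  have h := (measurePreserving_sub_right volume X).setIntegral_preimage_emb
    (measurableEmbedding_subRight X) f (Ioi (-X))
  rw [← h]; congr 2; ext r; simp

theorem integrableOn_Ioi_neg_iff (f : ℝ → ℂ) (X : ℝ) :
    IntegrableOn f (Ioi (-X)) ↔ IntegrableOn (fun r => f (r - X)) (Ioi 0) := by
  have h := (measurePreserving_sub_right volume X).integrableOn_comp_preimage
    (measurableEmbedding_subRight X) (f := f) (s := Ioi (-X))
  rw [← h]; simp [Function.comp_def]

theorem setIntegral_Iic_neg_eq (f : ℝ → ℂ) (X : ℝ) :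
    ∫ r in Iic (-X), f r = ∫ r in Ioi (0 : ℝ), f (-r - X) := by
  rw [integral_comp_neg_Ioi (0 : ℝ) (fun r => f (r - X)), neg_zero]
  have h := (measurePreserving_sub_right volume X).setIntegral_preimage_emb
    (measurableEmbedding_subRight X) f (Iic (-X))
  rw [← h]; congr 2; ext r; simp

theorem integrableOn_Iic_neg_iff (f : ℝ → ℂ) (X : ℝ) :
    IntegrableOn f (Iic (-X)) ↔ IntegrableOn (fun r => f (-r - X)) (Ioi 0) := by
  have h1 := (measurePreserving_sub_right volume X).integrableOn_comp_preimage
    (measurableEmbedding_subRight X) (f := f) (s := Iio (-X))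
  have h2 := (Measure.measurePreserving_neg (volume : Measure ℝ)).integrableOn_comp_preimage
    (MeasurableEquiv.neg ℝ).measurableEmbedding (f := fun r => f (r - X)) (s := Iio 0)
  have e1 : (fun r => r - X) ⁻¹' Iio (-X) = Iio (0 : ℝ) := by ext r; simp
  have e2 : (Neg.neg : ℝ → ℝ) ⁻¹' Iio 0 = Ioi (0 : ℝ) := by ext r; simp
  rw [e1] at h1
  rw [e2] at h2
  rw [integrableOn_Iic_iff_integrableOn_Iio, ← h1]
  exact h2.symm

section split
variable {s : ℂ} {α δ m X : ℝ}

/-- One step of the geometric expansion `1 / (1 - q) = 1 + q / (1 - q)`. -/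
theorem osc_div_den (s : ℂ) (m : ℝ) {z : ℂ} (hz : den α z ≠ 0) :
    osc s α m z / den α z = osc s α m z + osc s α (m + 1) z / den α z := by
  have h := osc_mul_exp s α m 1 z
  rw [← h]
  rw [ofReal_one, mul_one]
  field_simp
  rw [den]; ring

theorem den_line_ne_zero (hδ : 0 < δ) (hδ2 : δ ≤ 1 / 2) (h : ∀ n : ℤ, δ ≤ |X - α - n|) (r : ℝ) :
    den α (X + r * (1 + I)) ≠ 0 := by
  rw [← norm_pos_iff]
  rcases le_total 0 r with hr | hr
  · exact lt_of_lt_of_le (by positivity) (le_norm_den_of_nonneg hδ hδ2 h hr)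
  · exact lt_of_lt_of_le (by positivity) (le_norm_den_of_nonpos hδ hδ2 h hr)

/-- What remains of the tail integral when the dual term of frequency `m` is taken out: the geometric
expansion is carried one step further on the part `r > -X` of the line, which lies to the right of the
imaginary axis, and the last summand is the segment that completes this part to a ray from the origin.
All three integrals still converge at `m = 0`, where the tail integral itself does not. -/
noncomputable def rest (s : ℂ) (α m X : ℝ) : ℂ :=
  (1 + I) * (∫ r in Ioi (-X), osc s α (m + 1) (X + r * (1 + I)) / den α (X + r * (1 + I))) +
  (1 + I) * (∫ r in Iic (-X), osc s α m (X + r * (1 + I)) / den α (X + r * (1 + I))) +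
  I * ∫ v in (0 : ℝ)..X, osc s α m (-(I * v))

/-- The integrability of `integrableOn_Ioi_osc_div_den` for an arbitrary end point. -/
theorem integrableOn_Ioi_osc_div_den' (hs : 0 ≤ s.re) (hX : 0 < X) (hδ : 0 < δ)
    (hδ2 : δ ≤ 1 / 2) (h : ∀ n : ℤ, δ ≤ |X - α - n|) (hm : 0 < m) (a : ℝ) :
    IntegrableOn (fun r : ℝ => osc s α m (X + r * (1 + I)) / den α (X + r * (1 + I))) (Ioi a) := by
  have h0 := (integrableOn_Ioi_osc_div_den hs hX hδ hδ2 h hm).1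
  have hc := continuous_osc_div_den_line hX hδ hδ2 h s m
  refine (h0.union (hc.continuousOn.integrableOn_Icc (a := a) (b := 0))).mono_set fun r hr => ?_
  rcases le_or_gt r 0 with h1 | h1
  · exact Or.inr ⟨le_of_lt hr, h1⟩
  · exact Or.inl h1

/-- The integrability of `integrableOn_Iic_osc_div_den` for an arbitrary end point. -/
theorem integrableOn_Iic_osc_div_den' (hs : 0 ≤ s.re) (hX : 0 < X) (hδ : 0 < δ)
    (hδ2 : δ ≤ 1 / 2) (h : ∀ n : ℤ, δ ≤ |X - α - n|) (hm : m < 1) (a : ℝ) :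
    IntegrableOn (fun r : ℝ => osc s α m (X + r * (1 + I)) / den α (X + r * (1 + I))) (Iic a) := by
  have h0 := (integrableOn_Iic_osc_div_den hs hX hδ hδ2 h hm).1
  have hc := continuous_osc_div_den_line hX hδ hδ2 h s m
  refine (h0.union (hc.continuousOn.integrableOn_Icc (a := 0) (b := a))).mono_set fun r hr => ?_
  rcases le_or_gt r 0 with h1 | h1
  · exact Or.inl h1
  · exact Or.inr ⟨h1.le, hr⟩

theorem line_sub_eq_ray (X r : ℝ) :
    (X + (r - X : ℝ) * (1 + I) : ℂ) = -(I * X) + r * ((1 : ℝ) * (1 + I)) := by push_cast; ring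

theorem line_neg_sub_eq_ray (X r : ℝ) :
    (X + (-r - X : ℝ) * (1 + I) : ℂ) = -(I * X) + r * ((-1 : ℝ) * (1 + I)) := by push_cast; ring

theorem integrableOn_osc_line (hs0 : 0 ≤ s.re) (hs1 : s.re < 1) (hX : 0 < X) (hm : 0 < m) :
    IntegrableOn (fun r : ℝ => osc s α m (X + r * (1 + I))) (Ioi (-X)) := by
  rw [integrableOn_Ioi_neg_iff]
  simp only [line_sub_eq_ray]
  exact integrableOn_osc_ray hs0 hs1 (Or.inl rfl) (by linarith) hX.le

/-- The integral of `osc s α m`, `m > 0`, along the line to the right of the imaginary axis. -/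
theorem integral_Ioi_osc_line (hs0 : 0 ≤ s.re) (hs1 : s.re < 1) (hX : 0 < X) (hm : 0 < m) :
    (1 + I) * ∫ r in Ioi (-X), osc s α m (X + r * (1 + I)) =
      dual s α 1 m + I * ∫ v in (0 : ℝ)..X, osc s α m (-(I * v)) := by
  have h := integral_osc_ray_shift (s := s) (α := α) hs0 hs1 (Or.inl rfl : (1 : ℝ) = 1 ∨ (1 : ℝ) = -1)
    (by linarith : 0 < 1 * m) hX
  rw [setIntegral_Ioi_neg_eq]
  simp only [line_sub_eq_ray]
  rw [← h]; push_cast; ring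

/-- The integral of `osc s α m`, `m < 0`, along the line to the left of the imaginary axis. -/
theorem integral_Iic_osc_line (hs0 : 0 ≤ s.re) (hs1 : s.re < 1) (hX : 0 < X) (hm : m < 0) :
    IntegrableOn (fun r : ℝ => osc s α m (X + r * (1 + I))) (Iic (-X)) ∧
    -((1 + I) * ∫ r in Iic (-X), osc s α m (X + r * (1 + I))) =
      dual s α (-1) m + I * ∫ v in (0 : ℝ)..X, osc s α m (-(I * v)) := by
  have hε : (-1 : ℝ) = 1 ∨ (-1 : ℝ) = -1 := Or.inr rfl
  have h := integral_osc_ray_shift (s := s) (α := α) hs0 hs1 hε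
    (by linarith : 0 < -1 * m) hX
  rw [setIntegral_Iic_neg_eq, integrableOn_Iic_neg_iff]
  simp only [line_neg_sub_eq_ray]
  refine ⟨integrableOn_osc_ray hs0 hs1 hε (by linarith) hX.le, ?_⟩
  rw [← h]; push_cast; ring

/-- The tail of the Lerch series is its first dual term plus `rest`. -/
theorem lerchZeta_sub_sum_eq_rest (hα : 0 < α) (hδ : 0 < δ) (hδ2 : δ ≤ 1 / 2)
    (hm0 : 0 < m) (hm1 : m < 1) (hX : 0 < X) (h : ∀ n : ℤ, δ ≤ |X - α - n|) {N : ℕ}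
    (h1 : X < N + α) (h2 : N + α < X + 1) (hs : 0 < s.re) (hs1 : s.re < 1) (ht : 0 < s.im) :
    lerchZeta α m s - ∑ n ∈ Finset.range N, osc s α m (n + α) =
      dual s α 1 m + rest s α m X := by
  rw [lerchZeta_sub_sum_eq_integral hα hδ hδ2 hm0 hm1 hX h h1 h2 hs ht, rest,
    ← intervalIntegral.integral_Iic_add_Ioi (b := -X)
      (integrableOn_Iic_osc_div_den' hs.le hX hδ hδ2 h hm1 _)
      (integrableOn_Ioi_osc_div_den' hs.le hX hδ hδ2 h hm0 _)]
  have hsplit : ∫ r in Ioi (-X), osc s α m (X + r * (1 + I)) / den α (X + r * (1 + I)) =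
      (∫ r in Ioi (-X), osc s α m (X + r * (1 + I))) +
        ∫ r in Ioi (-X), osc s α (m + 1) (X + r * (1 + I)) / den α (X + r * (1 + I)) := by
    rw [← integral_add (integrableOn_osc_line hs.le hs1 hX hm0)
      (integrableOn_Ioi_osc_div_den' hs.le hX hδ hδ2 h (by linarith) _)]
    exact integral_congr_ae (Eventually.of_forall fun r =>
      osc_div_den s m (den_line_ne_zero hδ hδ2 h r))
  rw [hsplit]
  have h3 := integral_Ioi_osc_line (α := α) hs.le hs1 hX hm0
  linear_combination h3

theorem integral_osc_zero {z v : ℂ} {a b : ℝ} (α : ℝ) (hs : s ≠ 1)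
    (h : ∀ r ∈ uIcc a b, z + r * v ∈ slitPlane) :
    v * (∫ r in a..b, osc s α 0 (z + r * v)) =
      ((z + b * v) ^ (1 - s) - (z + a * v) ^ (1 - s)) / (1 - s) := by
  have hs' : 1 - s ≠ 0 := sub_ne_zero.mpr hs.symm
  rw [← intervalIntegral.integral_const_mul, sub_div]
  refine intervalIntegral.integral_eq_sub_of_hasDerivAt
    (f := fun r : ℝ => (z + r * v) ^ (1 - s) / (1 - s)) (fun r hr => ?_) ?_
  · have h1 : HasDerivAt (fun r : ℝ => z + r * v) v r := by
      simpa using ((hasDerivAt_id r).ofReal_comp.mul_const v).const_add z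
    have h2 : HasDerivAt (fun w : ℂ => w ^ (1 - s) / (1 - s)) (osc s α 0 (z + r * v))
        (z + r * v) := by
      have := ((hasDerivAt_id (z + r * v)).cpow_const (c := 1 - s) (h r hr)).div_const (1 - s)
      convert! this using 1
      rw [osc, show (1 - s - 1 : ℂ) = -s by ring]
      field_simp
      simp
    have := h2.scomp r h1
    simpa [Function.comp_def] using this
  · refine ContinuousOn.intervalIntegrable (continuousOn_const.mul fun r hr => ?_)
    exact (ContinuousAt.comp (f := fun r : ℝ => z + r * v)
      (differentiableAt_osc s α 0 (h r hr)).continuousAt (by fun_prop)).continuousWithinAt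

end split

/-! ### The continued tail of the Hurwitz series -/

section hurwitz
variable {s : ℂ} {α δ X : ℝ}

/-- The absolutely convergent part of the tail of the Hurwitz series. On the upper half of the line the
summand `z ^ (-s)` of the integrand, which is not integrable there, has been removed; its integral from
`X` is `-X ^ (1 - s) / (1 - s)` in the sense of analytic continuation. -/
noncomputable def hurwitzRem (s : ℂ) (α X : ℝ) : ℂ :=
  (1 + I) * (∫ r in Iic (0 : ℝ), osc s α 0 (X + r * (1 + I)) / den α (X + r * (1 + I))) +
  (1 + I) * ∫ r in Ioi (0 : ℝ), osc s α 1 (X + r * (1 + I)) / den α (X + r * (1 + I))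

theorem tendsto_integral_line_zero (hs : 0 < s.re) (hs1 : s ≠ 1) (hX : 0 < X) (hδ : 0 < δ)
    (hδ2 : δ ≤ 1 / 2) (h : ∀ n : ℤ, δ ≤ |X - α - n|) :
    Tendsto (fun R : ℝ =>
      (1 + I) * (∫ r in (-R)..R, osc s α 0 (X + r * (1 + I)) / den α (X + r * (1 + I))) -
        (X + R * (1 + I) : ℂ) ^ (1 - s) / (1 - s)) atTop
      (𝓝 (hurwitzRem s α X - (X : ℂ) ^ (1 - s) / (1 - s))) := by
  have i1 := (integrableOn_Iic_osc_div_den (m := 0) hs.le hX hδ hδ2 h one_pos).1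
  have i2 := (integrableOn_Ioi_osc_div_den (m := 1) hs.le hX hδ hδ2 h one_pos).1
  have l1 := (intervalIntegral_tendsto_integral_Iic 0 i1 tendsto_neg_atTop_atBot).const_mul
    (1 + I : ℂ)
  have l2 := (intervalIntegral_tendsto_integral_Ioi 0 i2 tendsto_id).const_mul (1 + I : ℂ)
  refine ((l1.add l2).sub_const ((X : ℂ) ^ (1 - s) / (1 - s))).congr fun R => ?_
  have c0 := continuous_osc_div_den_line hX hδ hδ2 h s 0
  have c1 := continuous_osc_div_den_line hX hδ hδ2 h s 1
  have hc : Continuous fun r : ℝ => osc s α 0 (X + r * (1 + I)) :=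
    continuous_iff_continuousAt.mpr fun r => ContinuousAt.comp (f := fun r : ℝ => (X + r * (1 + I) : ℂ))
      (differentiableAt_osc s α 0 (line_mem_slitPlane hX r)).continuousAt (by fun_prop)
  have hsplit : ∫ r in (0 : ℝ)..R, osc s α 0 (X + r * (1 + I)) / den α (X + r * (1 + I)) =
      (∫ r in (0 : ℝ)..R, osc s α 0 (X + r * (1 + I))) +
        ∫ r in (0 : ℝ)..R, osc s α 1 (X + r * (1 + I)) / den α (X + r * (1 + I)) := by
    rw [← intervalIntegral.integral_add (hc.intervalIntegrable _ _) (c1.intervalIntegrable _ _)]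
    refine intervalIntegral.integral_congr fun r _ => ?_
    have := osc_div_den s 0 (den_line_ne_zero hδ hδ2 h r)
    rwa [zero_add] at this
  have hprim := integral_osc_zero (z := X) (v := 1 + I) (a := 0) (b := R) α hs1
    fun r _ => line_mem_slitPlane hX r
  rw [← intervalIntegral.integral_add_adjacent_intervals (c0.intervalIntegrable (-R) 0)
    (c0.intervalIntegrable 0 R), hsplit]
  simp only [ofReal_zero, zero_mul, add_zero, sub_div] at hprim
  simp only [id]
  linear_combination -hprim

/-- The divergent boundary terms at the far ends of two adjacent lines cancel in the limit. -/
theorem tendsto_cpow_sub_cpow (X : ℝ) (hs : 0 < s.re) (hs1 : s ≠ 1) :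
    Tendsto (fun R : ℝ => ((X + 1 : ℝ) + R * (1 + I) : ℂ) ^ (1 - s) / (1 - s) -
      (X + R * (1 + I) : ℂ) ^ (1 - s) / (1 - s)) atTop (𝓝 0) := by
  have hlim : Tendsto (fun R : ℝ => Real.exp (Real.pi * |s.im|) * R ^ (-s.re)) atTop (𝓝 0) := by
    simpa using (tendsto_rpow_neg_atTop hs).const_mul (Real.exp (Real.pi * |s.im|))
  refine squeeze_zero_norm' ?_ hlim
  filter_upwards [eventually_ge_atTop 1] with R hR
  have hprim := integral_osc_zero (z := X + R * (1 + I)) (v := 1) (a := 0) (b := 1) 0 hs1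
    fun u hu => by
      rw [mem_slitPlane_iff]; right; simp; linarith
  have hcast : ((X + 1 : ℝ) + R * (1 + I) : ℂ) = X + R * (1 + I) + (1 : ℝ) * 1 := by
    push_cast; ring
  rw [hcast, ← sub_div]
  simp only [ofReal_zero, zero_mul, add_zero] at hprim
  rw [← hprim, one_mul]
  have := intervalIntegral.norm_integral_le_of_norm_le_const (a := 0) (b := 1)
    (f := fun u : ℝ => osc s 0 0 (X + R * (1 + I) + u * 1))
    (C := Real.exp (Real.pi * |s.im|) * R ^ (-s.re)) fun u _ => by
      have him : (X + R * (1 + I) + u * 1 : ℂ).im = R := by simp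
      have hle := abs_im_le_norm (X + R * (1 + I) + u * 1 : ℂ)
      rw [him, abs_of_pos (by linarith)] at hle
      refine (norm_osc_le s 0 0 (norm_pos_iff.mp (by linarith))).trans ?_
      have := Real.rpow_le_rpow_of_nonpos (by linarith) hle (by linarith : -s.re ≤ 0)
      rw [mul_comm]
      simpa using mul_le_mul_of_nonneg_left this (Real.exp_pos _).le
  simpa using this

theorem hurwitzRem_eq_rest (hs : 0 < s.re) (hs1 : s.re < 1) (hX : 0 < X) (hδ : 0 < δ)
    (hδ2 : δ ≤ 1 / 2) (h : ∀ n : ℤ, δ ≤ |X - α - n|) :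
    hurwitzRem s α X - (X : ℂ) ^ (1 - s) / (1 - s) = rest s α 0 X := by
  have hne1 : s ≠ 1 := fun h => by rw [h] at hs1; simp at hs1
  have hs' : 1 - s ≠ 0 := sub_ne_zero.mpr hne1.symm
  have c0 := continuous_osc_div_den_line hX hδ hδ2 h s 0
  have c1 := continuous_osc_div_den_line hX hδ hδ2 h s 1
  have hc : Continuous fun r : ℝ => osc s α 0 (X + r * (1 + I)) :=
    continuous_iff_continuousAt.mpr fun r => ContinuousAt.comp (f := fun r : ℝ => (X + r * (1 + I) : ℂ))
      (differentiableAt_osc s α 0 (line_mem_slitPlane hX r)).continuousAt (by fun_prop)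
  have hsplit : ∫ r in (-X)..0, osc s α 0 (X + r * (1 + I)) / den α (X + r * (1 + I)) =
      (∫ r in (-X)..0, osc s α 0 (X + r * (1 + I))) +
        ∫ r in (-X)..0, osc s α 1 (X + r * (1 + I)) / den α (X + r * (1 + I)) := by
    rw [← intervalIntegral.integral_add (hc.intervalIntegrable _ _) (c1.intervalIntegrable _ _)]
    refine intervalIntegral.integral_congr fun r _ => ?_
    have := osc_div_den s 0 (den_line_ne_zero hδ hδ2 h r)
    rwa [zero_add] at this
  have e1 := intervalIntegral.integral_Iic_sub_Iic
    (integrableOn_Iic_osc_div_den' (m := 0) hs.le hX hδ hδ2 h one_pos (-X))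
    (integrableOn_Iic_osc_div_den' (m := 0) hs.le hX hδ hδ2 h one_pos 0)
  have e2 := intervalIntegral.integral_interval_add_Ioi
    (integrableOn_Ioi_osc_div_den' (m := 1) hs.le hX hδ hδ2 h one_pos (-X))
    (integrableOn_Ioi_osc_div_den' (m := 1) hs.le hX hδ hδ2 h one_pos 0)
  have hprim := integral_osc_zero (z := X) (v := 1 + I) (a := -X) (b := 0) α hne1
    fun r _ => line_mem_slitPlane hX r
  have hseg : I * ∫ v in (0 : ℝ)..X, osc s α 0 (-(I * v)) = -((-(I * X) : ℂ) ^ (1 - s) / (1 - s)) := by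
    have hcv : ∀ v ∈ uIcc 0 X, osc s α 0 (-(I * v)) = (-I) ^ (-s) * (v : ℂ) ^ (-s) := fun v hv => by
      rw [uIcc_of_le hX.le] at hv
      rw [osc, show (-(I * v) : ℂ) = v * (-I) by ring]
      rcases hv.1.eq_or_lt with h0 | h0
      · have : -s ≠ 0 := fun h => by
          have := congrArg re h; simp at this; linarith
        rw [← h0]; simp [zero_cpow this]
      · rw [cpow_def_of_ne_zero (by simpa using h0.ne'), log_ofReal_mul h0 (by simp),
          cpow_def_of_ne_zero (by simp : (-I : ℂ) ≠ 0),
          cpow_def_of_ne_zero (ofReal_ne_zero.mpr h0.ne'), ← ofReal_log h0.le]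
        simp only [ofReal_zero, mul_zero, zero_mul, Complex.exp_zero, mul_one]
        rw [← Complex.exp_add]; ring_nf
    rw [intervalIntegral.integral_congr hcv, intervalIntegral.integral_const_mul,
      integral_cpow (Or.inl (by simp; linarith))]
    have hI : (-I : ℂ) ≠ 0 := by simp
    have hX' : (X : ℂ) ≠ 0 := ofReal_ne_zero.mpr hX.ne'
    have e3 : (-(I * X) : ℂ) ^ (1 - s) = (-I) ^ (1 - s) * (X : ℂ) ^ (1 - s) := by
      rw [show (-(I * X) : ℂ) = X * (-I) by ring, cpow_def_of_ne_zero (mul_ne_zero hX' hI),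
        log_ofReal_mul hX hI, cpow_def_of_ne_zero hI, cpow_def_of_ne_zero hX', ← ofReal_log hX.le,
        ← Complex.exp_add]
      ring_nf
    have e4 : (-I : ℂ) ^ (1 - s) = -I * (-I) ^ (-s) := by
      rw [sub_eq_add_neg, cpow_add _ _ hI, cpow_one]
    rw [e3, e4, show (-s + 1 : ℂ) = 1 - s by ring, ofReal_zero, zero_cpow hs']
    ring
  have hneg : (X + (-X : ℝ) * (1 + I) : ℂ) = -(I * X) := by push_cast; ring
  rw [hneg] at hprim
  simp only [ofReal_zero, zero_mul, add_zero, sub_div] at hprim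
  rw [rest, hseg, hurwitzRem, zero_add]
  rw [hsplit] at e1
  linear_combination (1 + I) * e1 + (1 + I) * e2 + hprim

/-- The tail of the Hurwitz series is `rest` with frequency `0`: there is no dual term of frequency
`0`. -/
theorem hurwitzZeta_sub_sum_eq_rest (hα : 0 < α) (hα1 : α ≤ 1) (hδ : 0 < δ) (hδ2 : δ ≤ 1 / 2)
    (hX : 0 < X) (h : ∀ n : ℤ, δ ≤ |X - α - n|) {N : ℕ}
    (h1 : X < N + α) (h2 : N + α < X + 1) (hs : 0 < s.re) (hs1 : s.re < 1) (ht : 0 < s.im) :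
    HurwitzZeta.hurwitzZeta (α : UnitAddCircle) s - ∑ n ∈ Finset.range N, osc s α 0 (n + α) =
      rest s α 0 X := by
  have hne : ∀ n : ℕ, (n + α : ℂ) ≠ 0 := fun n => by
    have h3 : ((n + α : ℝ) : ℂ) ≠ 0 := ofReal_ne_zero.mpr (by positivity)
    simpa using h3
  have hdist : ∀ M : ℕ, ∀ n : ℤ, δ ≤ |X + M - α - n| := fun M n => by
    have := h (n - M)
    push_cast at this
    rwa [show X - α - (n - M) = X + M - α - n by ring] at this
  have hXM : ∀ M : ℕ, 0 < X + M := fun M => by positivity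
  have hnone : ∀ s : ℂ, 0 < s.im → s ≠ 1 := fun s hs h => by rw [h] at hs; simp at hs
  have hstep : ∀ s : ℂ, 0 < s.re → 0 < s.im → ∀ M : ℕ,
      (hurwitzRem s α (X + M) - ((X + M : ℝ) : ℂ) ^ (1 - s) / (1 - s)) -
      (hurwitzRem s α (X + (M + 1 : ℕ)) - ((X + (M + 1 : ℕ) : ℝ) : ℂ) ^ (1 - s) / (1 - s)) =
        osc s α 0 ((N + M : ℕ) + α) := by
    intro s hs ht M
    have key := tendsto_integral_line_sub (s := s) (α := α) (n := N + M) (m := 0) hs le_rfl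
      zero_le_one (hXM M) (by push_cast; linarith) (by push_cast; linarith)
    have l1 := tendsto_integral_line_zero hs (hnone s ht) (hXM M) hδ hδ2 (hdist M)
    have l2 := tendsto_integral_line_zero hs (hnone s ht) (hXM (M + 1)) hδ hδ2 (hdist (M + 1))
    have l3 := tendsto_cpow_sub_cpow (X + M) hs (hnone s ht)
    rw [show X + M + 1 = X + (M + 1 : ℕ) by push_cast; ring] at key l3
    have l4 := (l1.sub l2).sub l3
    rw [sub_zero] at l4
    refine tendsto_nhds_unique (l4.congr fun R => ?_) key
    ring
  have hsum : ∀ s : ℂ, 0 < s.re → 0 < s.im → ∀ M : ℕ,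
      (hurwitzRem s α X - (X : ℂ) ^ (1 - s) / (1 - s)) -
        ∑ j ∈ Finset.range M, osc s α 0 ((N + j : ℕ) + α) =
      hurwitzRem s α (X + M) - ((X + M : ℝ) : ℂ) ^ (1 - s) / (1 - s) := by
    intro s hs ht M
    induction M with
    | zero => simp
    | succ M ih =>
      rw [Finset.sum_range_succ, ← hstep s hs ht M, ← sub_sub, ih]; ring
  rw [← hurwitzRem_eq_rest hs hs1 hX hδ hδ2 h]
  symm
  refine eqOn_quadrant_of_norm_sub_le
    (g := fun M s => (∑ j ∈ Finset.range M, osc s α 0 ((N + j : ℕ) + α)) -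
      ((X + M : ℝ) : ℂ) ^ (1 - s) / (1 - s))
    (V := fun s => hurwitzRem s α X - (X : ℂ) ^ (1 - s) / (1 - s))
    (Z := fun s => HurwitzZeta.hurwitzZeta (α : UnitAddCircle) s -
      ∑ n ∈ Finset.range N, osc s α 0 (n + α))
    (C := 2 * (2 / δ * (2 * Real.pi * (1 - 0))⁻¹) + 2 * (2 / δ * (2 * Real.pi * 1)⁻¹)) hX
    (fun M => ?_) ?_ (fun M s hs ht => ?_) (fun s hs ht => ?_) hs ht
  · refine (Differentiable.fun_sum fun j _ =>
      differentiable_osc_param α 0 (hne _)).differentiableOn.sub fun s hs => ?_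
    have h4 : ((X + M : ℝ) : ℂ) ≠ 0 := ofReal_ne_zero.mpr (hXM M).ne'
    have h5 : DifferentiableAt ℂ (fun s : ℂ => ((X + M : ℝ) : ℂ) ^ (1 - s)) s :=
      (differentiableAt_id.const_sub 1).const_cpow (Or.inl h4)
    exact (h5.div (by fun_prop) (sub_ne_zero.mpr (hnone s hs.2).symm)).differentiableWithinAt
  · refine DifferentiableOn.sub (fun s hs => ?_) (Differentiable.fun_sum fun j _ =>
      differentiable_osc_param α 0 (hne _)).differentiableOn
    exact (HurwitzZeta.differentiableAt_hurwitzZeta _ (hnone s hs.2)).differentiableWithinAt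
  · have e : hurwitzRem s α X - (X : ℂ) ^ (1 - s) / (1 - s) -
        ((∑ j ∈ Finset.range M, osc s α 0 ((N + j : ℕ) + α)) -
          ((X + M : ℝ) : ℂ) ^ (1 - s) / (1 - s)) = hurwitzRem s α (X + M) := by
      linear_combination hsum s hs ht M
    rw [e, hurwitzRem]
    have i1 := integrableOn_Iic_osc_div_den (m := 0) hs.le (hXM M) hδ hδ2 (hdist M) one_pos
    have i2 := integrableOn_Ioi_osc_div_den (m := 1) hs.le (hXM M) hδ hδ2 (hdist M) one_pos
    refine (norm_add_le _ _).trans ?_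
    rw [norm_mul, norm_mul]
    have b1 := mul_le_mul norm_one_add_I_le i1.2 (norm_nonneg _) two_pos.le
    have b2 := mul_le_mul norm_one_add_I_le i2.2 (norm_nonneg _) two_pos.le
    refine (add_le_add b1 b2).trans (le_of_eq (by ring))
  · have hT := (HurwitzZeta.hasSum_hurwitzZeta_of_one_lt_re ⟨hα.le, hα1⟩ hs).tendsto_sum_nat.comp
      (tendsto_add_atTop_nat N)
    have hpow : Tendsto (fun M : ℕ => ((X + M : ℝ) : ℂ) ^ (1 - s) / (1 - s)) atTop (𝓝 0) := by
      rw [← zero_div (1 - s)]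
      refine Tendsto.div_const ?_ _
      rw [tendsto_zero_iff_norm_tendsto_zero]
      have h6 : Tendsto (fun M : ℕ => X + (M : ℝ)) atTop atTop :=
        tendsto_atTop_add_const_left _ X tendsto_natCast_atTop_atTop
      have h7 := (tendsto_rpow_neg_atTop (by linarith : 0 < s.re - 1)).comp h6
      refine h7.congr fun M => ?_
      rw [norm_cpow_eq_rpow_re_of_pos (hXM M)]
      simp
    have h8 := (hT.sub_const (∑ n ∈ Finset.range N, osc s α 0 (n + α))).sub hpow
    rw [sub_zero] at h8
    refine h8.congr fun M => ?_
    have h9 : ∀ n : ℕ, 1 / ((n : ℂ) + α) ^ s = osc s α 0 (n + α) := fun n => by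
      rw [osc_natCast_add]; simp
    simp only [Function.comp, h9]
    rw [add_comm M N, Finset.sum_range_add, add_sub_cancel_left]

end hurwitz

/-! ### Extraction of the dual terms -/

/-- The integral of `osc s α m` over the segment from `0` to `-iX`, up to sign. -/
noncomputable def seg (s : ℂ) (α m X : ℝ) : ℂ := I * ∫ v in (0 : ℝ)..X, osc s α m (-(I * v))

section decomposition
variable {s : ℂ} {α δ lam X : ℝ}

/-- The geometric expansion on the right part of the line, each term giving a dual term and a
segment. -/
theorem integral_Ioi_osc_div_den_eq_sum (hs0 : 0 ≤ s.re) (hs1 : s.re < 1) (hX : 0 < X)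
    (hδ : 0 < δ) (hδ2 : δ ≤ 1 / 2) (h : ∀ n : ℤ, δ ≤ |X - α - n|) (hl : 0 ≤ lam) (K : ℕ) :
    (1 + I) * (∫ r in Ioi (-X), osc s α (lam + 1) (X + r * (1 + I)) / den α (X + r * (1 + I))) =
      ∑ k ∈ Finset.range K, (dual s α 1 (lam + (k + 1)) + seg s α (lam + (k + 1)) X) +
      (1 + I) * ∫ r in Ioi (-X),
        osc s α (lam + K + 1) (X + r * (1 + I)) / den α (X + r * (1 + I)) := by
  induction K with
  | zero => simp
  | succ K ih =>
    have hm : 0 < lam + K + 1 := by positivity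
    have hsplit : ∫ r in Ioi (-X), osc s α (lam + K + 1) (X + r * (1 + I)) /
        den α (X + r * (1 + I)) =
        (∫ r in Ioi (-X), osc s α (lam + K + 1) (X + r * (1 + I))) +
        ∫ r in Ioi (-X), osc s α (lam + K + 1 + 1) (X + r * (1 + I)) /
          den α (X + r * (1 + I)) := by
      rw [← integral_add (integrableOn_osc_line hs0 hs1 hX hm)
        (integrableOn_Ioi_osc_div_den' hs0 hX hδ hδ2 h (by linarith) _)]
      exact integral_congr_ae (Eventually.of_forall fun r =>
        osc_div_den s _ (den_line_ne_zero hδ hδ2 h r))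
    have h3 := integral_Ioi_osc_line (α := α) hs0 hs1 hX hm
    rw [ih, hsplit, Finset.sum_range_succ, mul_add, h3, seg]
    push_cast
    rw [← add_assoc lam]
    ring

/-- The tail integral, with `K` dual terms above and one below taken out. -/
theorem rest_eq_sum_dual (hs0 : 0 ≤ s.re) (hs1 : s.re < 1) (hX : 0 < X)
    (hδ : 0 < δ) (hδ2 : δ ≤ 1 / 2) (h : ∀ n : ℤ, δ ≤ |X - α - n|) (hl : 0 ≤ lam) (hl1 : lam < 1)
    (K : ℕ) :
    rest s α lam X = ∑ k ∈ Finset.range K, dual s α 1 (lam + (k + 1)) + dual s α (-1) (lam - 1) +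
      ((1 + I) * (∫ r in Ioi (-X),
        osc s α (lam + K + 1) (X + r * (1 + I)) / den α (X + r * (1 + I))) +
      (1 + I) * (∫ r in Iic (-X),
        osc s α (lam - 1) (X + r * (1 + I)) / den α (X + r * (1 + I))) +
      (∑ k ∈ Finset.range K, seg s α (lam + (k + 1)) X + seg s α lam X +
        seg s α (lam - 1) X)) := by
  have h1 := integral_Ioi_osc_div_den_eq_sum hs0 hs1 hX hδ hδ2 h hl K
  obtain ⟨h2, h3⟩ := integral_Iic_osc_line (α := α) hs0 hs1 hX (by linarith : lam - 1 < 0)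
  have hsplit : ∫ r in Iic (-X), osc s α (lam - 1) (X + r * (1 + I)) / den α (X + r * (1 + I)) =
      (∫ r in Iic (-X), osc s α (lam - 1) (X + r * (1 + I))) +
      ∫ r in Iic (-X), osc s α lam (X + r * (1 + I)) / den α (X + r * (1 + I)) := by
    rw [← integral_add h2 (integrableOn_Iic_osc_div_den' hs0 hX hδ hδ2 h hl1 _)]
    refine integral_congr_ae (Eventually.of_forall fun r => ?_)
    have := osc_div_den s (lam - 1) (den_line_ne_zero hδ hδ2 h r)
    rwa [sub_add_cancel] at this
  rw [Finset.sum_add_distrib] at h1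
  rw [rest, h1, hsplit]
  simp only [seg] at h3 ⊢
  linear_combination h3

end decomposition

/-! ### Saddle-point bounds along the oblique line -/

/-- The left side is at most `ρ + ρ² - 2ρ³/3`, whose derivative `1 + 2ρ - 2ρ²` is at most that of the
right side, `1 / ((1 - ρ)² + ρ²)`. -/
theorem add_sq_div_three_le_arctan {ρ : ℝ} (h0 : 0 ≤ ρ) (h1 : ρ < 1) :
    ρ + ρ ^ 2 / 3 ≤ Real.arctan (ρ / (1 - ρ)) := by
  let f : ℝ → ℝ := fun ρ => Real.arctan (ρ / (1 - ρ)) - (ρ + ρ ^ 2 - 2 / 3 * ρ ^ 3)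
  have hd : ∀ x : ℝ, x < 1 → HasDerivAt f (1 / (1 + (x / (1 - x)) ^ 2) *
      ((1 * (1 - x) - x * (-1)) / (1 - x) ^ 2) - (1 + 2 * x - 2 * x ^ 2)) x := by
    intro x hx
    have hx' : 1 - x ≠ 0 := by linarith
    have a1 := ((hasDerivAt_id x).div ((hasDerivAt_id x).const_sub 1) hx').arctan
    have a2 : HasDerivAt (fun ρ : ℝ => ρ + ρ ^ 2 - 2 / 3 * ρ ^ 3) (1 + 2 * x - 2 * x ^ 2) x := by
      have := ((hasDerivAt_id x).add (hasDerivAt_pow 2 x)).sub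
        ((hasDerivAt_pow 3 x).const_mul (2 / 3))
      convert! this using 1
      norm_num; ring
    exact a1.sub a2
  have hmono : MonotoneOn f (Ico 0 1) := by
    refine monotoneOn_of_deriv_nonneg (convex_Ico 0 1)
      (fun x hx => (hd x hx.2).continuousAt.continuousWithinAt)
      (fun x hx => ?_) (fun x hx => ?_)
    · rw [interior_Ico] at hx
      exact (hd x hx.2).differentiableAt.differentiableWithinAt
    · rw [interior_Ico] at hx
      have hx' : 0 < 1 - x := by linarith [hx.2]
      have hD : 0 < (1 - x) ^ 2 + x ^ 2 := by positivity
      rw [(hd x hx.2).deriv]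
      have e : 1 / (1 + (x / (1 - x)) ^ 2) * ((1 * (1 - x) - x * (-1)) / (1 - x) ^ 2) =
          1 / ((1 - x) ^ 2 + x ^ 2) := by
        field_simp; ring
      rw [e, sub_nonneg, le_div_iff₀ hD]
      nlinarith [sq_nonneg (x * (1 - x))]
  have h2 := hmono (left_mem_Ico.mpr one_pos) ⟨h0, h1⟩ h0
  simp only [f] at h2
  norm_num at h2
  have h3 : ρ ^ 3 ≤ ρ ^ 2 := pow_le_pow_of_le_one h0 h1.le (by norm_num)
  linarith

/-- Along the line through `X` the argument lies below its linearisation at `X`, with a quadratic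
gain: this makes `X` a saddle point crossed in the direction of steepest descent. -/
theorem arg_line_le {X r : ℝ} (hX : 0 < X) (hr : -X ≤ r) :
    arg (X + r * (1 + I)) ≤ r / X - r ^ 2 / (3 * X * (X + |r|)) := by
  have hre := line_re X r
  have him := line_im X r
  have harg : -X < r → arg (X + r * (1 + I)) = Real.arctan (r / (X + r)) := fun h => by
    have h1 : (X + r * (1 + I) : ℂ) = ((X + r : ℝ) : ℂ) + (r : ℝ) * I := by push_cast; ring
    have h2 : arg (X + r * (1 + I)) ∈ Ioo (-(Real.pi / 2)) (Real.pi / 2) := by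
      have := abs_arg_lt_pi_div_two_iff.mpr (Or.inl (by rw [hre]; linarith) :
        0 < (X + r * (1 + I) : ℂ).re ∨ (X + r * (1 + I) : ℂ) = 0)
      exact abs_lt.mp this
    rw [← Real.arctan_tan h2.1 h2.2, tan_arg, hre, him]
  rcases le_total 0 r with h0 | h0
  · have hXr : 0 < X + r := by linarith
    rw [harg (by linarith), abs_of_nonneg h0]
    have h1 : Real.arctan (r / (X + r)) ≤ r / (X + r) := by
      have hq : 0 ≤ r / (X + r) := by positivity
      have := Real.le_tan (Real.arctan_nonneg.mpr hq) (Real.arctan_lt_pi_div_two _)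
      rwa [Real.tan_arctan] at this
    have h2 : r / (X + r) = r / X - r ^ 2 / (X * (X + r)) := by field_simp; ring
    have h3 : r ^ 2 / (3 * X * (X + r)) ≤ r ^ 2 / (X * (X + r)) := by
      apply div_le_div_of_nonneg_left (by positivity) (by positivity)
      nlinarith [mul_pos hX hXr]
    linarith
  · set ρ := -r / X with hρ
    have hr' : r = -(ρ * X) := by rw [hρ]; field_simp
    have hρ0 : 0 ≤ ρ := div_nonneg (by linarith) hX.le
    have h3 : r ^ 2 / (3 * X * (X + |r|)) ≤ ρ ^ 2 / 3 := by
      have : ρ ^ 2 / 3 = r ^ 2 / (3 * X * X) := by rw [hr']; field_simp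
      rw [this]
      apply div_le_div_of_nonneg_left (by positivity) (by positivity)
      gcongr
      linarith [abs_nonneg r]
    have h4 : r / X = -ρ := by rw [hρ]; ring
    have h5 : arg (X + r * (1 + I)) ≤ -(ρ + ρ ^ 2 / 3) := by
      rcases hr.eq_or_lt with h | h
      · have hz : (X + r * (1 + I) : ℂ) = X * (-I) := by rw [← h]; push_cast; ring
        rw [hz, arg_real_mul _ hX, arg_neg_I]
        have : ρ = 1 := by rw [hρ, ← h]; field_simp
        rw [this]; linarith [Real.pi_gt_three]
      · rw [harg h]
        have hρ1 : ρ < 1 := by rw [hρ, div_lt_one hX]; linarith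
        have h6 : r / (X + r) = -(ρ / (1 - ρ)) := by
          have : 1 - ρ ≠ 0 := by linarith
          rw [hr', show X + -(ρ * X) = X * (1 - ρ) by ring]
          field_simp
        rw [h6, Real.arctan_neg]
        linarith [add_sq_div_three_le_arctan hρ0 hρ1]
    linarith

/-- Majorant of the modulus on the line, of Gaussian type for `|r| ≤ X` and exponential beyond. -/
noncomputable def saddleBound (t X r : ℝ) : ℝ :=
  Real.exp (-(t / (6 * X ^ 2)) * r ^ 2) + Real.exp (-(t / (6 * X)) * |r|)

section saddle
variable {t X : ℝ}

theorem exp_le_saddleBound (ht : 0 < t) (hX : 0 < X) (r : ℝ) :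
    Real.exp (-(t * (r ^ 2 / (3 * X * (X + |r|))))) ≤ saddleBound t X r := by
  rcases le_total |r| X with h | h
  · refine le_add_of_le_of_nonneg (Real.exp_le_exp.mpr ?_) (Real.exp_pos _).le
    have h1 : r ^ 2 / (6 * X ^ 2) ≤ r ^ 2 / (3 * X * (X + |r|)) := by
      apply div_le_div_of_nonneg_left (by positivity) (by positivity)
      nlinarith
    have h2 := mul_le_mul_of_nonneg_left h1 ht.le
    have h3 : t / (6 * X ^ 2) * r ^ 2 = t * (r ^ 2 / (6 * X ^ 2)) := by ring
    linarith
  · refine le_add_of_nonneg_of_le (Real.exp_pos _).le (Real.exp_le_exp.mpr ?_)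
    have hr : 0 < |r| := hX.trans_le h
    have h1 : |r| / (6 * X) ≤ r ^ 2 / (3 * X * (X + |r|)) := by
      rw [div_le_div_iff₀ (by positivity) (by positivity), ← sq_abs]
      have : 0 ≤ X * |r| * (|r| - X) := mul_nonneg (by positivity) (by linarith)
      nlinarith
    have h2 := mul_le_mul_of_nonneg_left h1 ht.le
    have h3 : t / (6 * X) * |r| = t * (|r| / (6 * X)) := by ring
    linarith

theorem integrable_exp_neg_mul_abs {c : ℝ} (hc : 0 < c) :
    Integrable fun r : ℝ => Real.exp (-c * |r|) := by
  rw [← integrableOn_univ, ← Iic_union_Ioi (a := (0 : ℝ))]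
  refine IntegrableOn.union ?_ ?_
  · refine (integrableOn_exp_mul_Iic hc 0).congr_fun (fun r hr => ?_) measurableSet_Iic
    simp only [abs_of_nonpos (show r ≤ 0 from hr)]; ring_nf
  · refine (integrableOn_exp_mul_Ioi (neg_lt_zero.mpr hc) 0).congr_fun (fun r hr => ?_)
      measurableSet_Ioi
    simp only [abs_of_pos (show 0 < r from hr)]

theorem integrable_saddleBound (ht : 0 < t) (hX : 0 < X) : Integrable (saddleBound t X) :=
  (integrable_exp_neg_mul_sq (by positivity)).add (integrable_exp_neg_mul_abs (by positivity))

theorem saddleBound_nonneg (t X r : ℝ) : 0 ≤ saddleBound t X r :=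
  add_nonneg (Real.exp_pos _).le (Real.exp_pos _).le

theorem integral_saddleBound_le (ht : 1 ≤ t) (hX : 0 < X) :
    ∫ r, saddleBound t X r ≤ 20 * (X / √t) := by
  have ht0 : 0 < t := by linarith
  have h2 : ∫ r : ℝ, Real.exp (-(t / (6 * X)) * |r|) = 12 * (X / t) := by
    rw [integral_comp_abs (f := fun r => Real.exp (-(t / (6 * X)) * r)),
      integral_exp_mul_Ioi (by rw [neg_lt_zero]; positivity)]
    simp only [mul_zero, Real.exp_zero]
    field_simp; norm_num
  have h1 : √(Real.pi / (t / (6 * X ^ 2))) ≤ 5 * (X / √t) := by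
    have e : Real.pi / (t / (6 * X ^ 2)) = (6 * Real.pi) * (X / √t) ^ 2 := by
      rw [div_pow, Real.sq_sqrt ht0.le]; field_simp
    rw [e, Real.sqrt_mul (by positivity), Real.sqrt_sq (by positivity)]
    gcongr
    rw [Real.sqrt_le_left (by norm_num)]
    nlinarith [Real.pi_lt_d2]
  have h3 : X / t ≤ X / √t := by
    apply div_le_div_of_nonneg_left hX.le (Real.sqrt_pos.mpr ht0)
    rw [Real.sqrt_le_left ht0.le]; nlinarith
  have h4 : 0 ≤ X / √t := by positivity
  unfold saddleBound
  rw [integral_add (integrable_exp_neg_mul_sq (by positivity))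
    (integrable_exp_neg_mul_abs (by positivity)), integral_gaussian, h2]
  linarith

variable {s : ℂ} {α δ m : ℝ}

theorem half_rpow_neg_le (hs : 0 ≤ s.re) (hs1 : s.re ≤ 1) (hX : 0 < X) {z : ℂ}
    (hz : X / 2 ≤ ‖z‖) : ‖z‖ ^ (-s.re) ≤ 2 * X ^ (-s.re) := by
  have h1 : ‖z‖ ^ (-s.re) ≤ (X / 2) ^ (-s.re) :=
    Real.rpow_le_rpow_of_nonpos (by positivity) hz (by linarith)
  have h2 : (X / 2) ^ (-s.re) = 2 ^ s.re * X ^ (-s.re) := by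
    rw [Real.div_rpow hX.le (by norm_num), Real.rpow_neg (by norm_num : (0 : ℝ) ≤ 2)]
    field_simp
  have h3 : (2 : ℝ) ^ s.re ≤ 2 := by
    calc (2 : ℝ) ^ s.re ≤ 2 ^ (1 : ℝ) := Real.rpow_le_rpow_of_exponent_le (by norm_num) hs1
      _ = 2 := Real.rpow_one 2
  rw [h2] at h1
  refine h1.trans ?_
  gcongr

/-- The assumption `hm` says that the linear part of the phase is, on the side of `r`, dominated by the
exponential; both sides of `X` can be treated when `X` is the saddle point of frequency `m`. -/
theorem norm_osc_line_le_saddleBound (hs : 0 ≤ s.re) (hs1 : s.re ≤ 1) (ht : 0 < s.im)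
    (hX : 0 < X) {r : ℝ} (hr : -X ≤ r) (hm : s.im * (r / X) ≤ 2 * Real.pi * m * r) :
    ‖osc s α m (X + r * (1 + I))‖ ≤ 2 * X ^ (-s.re) * saddleBound s.im X r := by
  rw [norm_osc s α m (slitPlane_ne_zero (line_mem_slitPlane hX r)), line_im]
  refine mul_le_mul (half_rpow_neg_le hs hs1 hX (half_le_norm_line X r)) ?_ (Real.exp_pos _).le
    (by positivity)
  refine le_trans (Real.exp_le_exp.mpr ?_) (exp_le_saddleBound ht hX r)
  have := mul_le_mul_of_nonneg_left (arg_line_le hX hr) ht.le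
  linarith

theorem norm_osc_add_one_line (hX : 0 < X) (r : ℝ) :
    ‖osc s α (m + 1) (X + r * (1 + I))‖ =
      ‖osc s α m (X + r * (1 + I))‖ * Real.exp (-(2 * Real.pi * r)) := by
  have hz := slitPlane_ne_zero (line_mem_slitPlane hX r)
  rw [norm_osc s α _ hz, norm_osc s α _ hz, line_im,
    mul_assoc (‖(X + r * (1 + I) : ℂ)‖ ^ (-s.re)), ← Real.exp_add]
  congr 2; ring

theorem norm_integral_Ioi_osc_line_le (hs : 0 ≤ s.re) (hs1 : s.re ≤ 1) (ht : 1 ≤ s.im)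
    (hX : 0 < X) (hm : 2 * Real.pi * m * X = s.im) :
    ‖∫ r in Ioi (-X), osc s α m (X + r * (1 + I))‖ ≤ 40 * (X ^ (-s.re) * (X / √s.im)) := by
  have ht0 : 0 < s.im := by linarith
  have hint := (integrable_saddleBound ht0 hX).const_mul (2 * X ^ (-s.re))
  refine (norm_integral_le_of_norm_le hint.integrableOn (g := fun r =>
    2 * X ^ (-s.re) * saddleBound s.im X r) ?_).trans ?_
  · filter_upwards [ae_restrict_mem measurableSet_Ioi] with r hr
    refine norm_osc_line_le_saddleBound hs hs1 ht0 hX (le_of_lt hr) (le_of_eq ?_)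
    rw [← hm]; field_simp
  · have h1 : ∫ r in Ioi (-X), 2 * X ^ (-s.re) * saddleBound s.im X r ≤
        ∫ r, 2 * X ^ (-s.re) * saddleBound s.im X r :=
      setIntegral_le_integral hint (Eventually.of_forall fun r =>
        mul_nonneg (by positivity) (saddleBound_nonneg _ _ _))
    refine h1.trans ?_
    rw [integral_const_mul]
    have := mul_le_mul_of_nonneg_left (integral_saddleBound_le ht hX)
      (by positivity : 0 ≤ 2 * X ^ (-s.re))
    linarith

/-- The saddle-point estimate of the main remainder, for `m - 1 ≤ t / (2πX) ≤ m`. For `r ≥ 0` the factor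
`osc s α m` decays and the denominator is bounded below; for `r ≤ 0` the size of the denominator turns
the frequency `m` into `m - 1`, which decays on that side. -/
theorem norm_integral_Ioi_osc_div_den_le (hs : 0 ≤ s.re) (hs1 : s.re ≤ 1) (ht : 1 ≤ s.im)
    (hX : 0 < X) (hδ : 0 < δ) (hδ2 : δ ≤ 1 / 2) (h : ∀ n : ℤ, δ ≤ |X - α - n|)
    (hm : s.im ≤ 2 * Real.pi * m * X) (hm1 : 2 * Real.pi * (m - 1) * X ≤ s.im) :
    ‖∫ r in Ioi (-X), osc s α m (X + r * (1 + I)) / den α (X + r * (1 + I))‖ ≤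
      80 / δ * (X ^ (-s.re) * (X / √s.im)) := by
  have ht0 : 0 < s.im := by linarith
  have hint := (integrable_saddleBound ht0 hX).const_mul (2 / δ * (2 * X ^ (-s.re)))
  have hdiv : ∀ r : ℝ, s.im * (r / X) = s.im / X * r := fun r => by ring
  refine (norm_integral_le_of_norm_le hint.integrableOn (g := fun r =>
    2 / δ * (2 * X ^ (-s.re)) * saddleBound s.im X r) ?_).trans ?_
  · filter_upwards [ae_restrict_mem measurableSet_Ioi] with r hr
    rw [norm_div, div_le_iff₀ (norm_pos_iff.mpr (den_line_ne_zero hδ hδ2 h r))]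
    have hr : -X < r := hr
    rcases le_total 0 r with h0 | h0
    · have h1 := norm_osc_line_le_saddleBound (α := α) (m := m) hs hs1 ht0 hX hr.le (by
        rw [hdiv]
        refine mul_le_mul_of_nonneg_right ?_ h0
        rw [div_le_iff₀ hX]; exact hm)
      refine h1.trans ?_
      have h2 := le_norm_den_of_nonneg hδ hδ2 h h0
      have h3 := saddleBound_nonneg s.im X r
      calc _ = 2 / δ * (2 * X ^ (-s.re)) * saddleBound s.im X r * (δ / 2) := by field_simp
        _ ≤ _ := by gcongr
    · have h1 := norm_osc_line_le_saddleBound (α := α) (m := m - 1) hs hs1 ht0 hX hr.le (by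
        rw [hdiv]
        refine mul_le_mul_of_nonpos_right ?_ h0
        rw [le_div_iff₀ hX]; exact hm1)
      have h4 := norm_osc_add_one_line (s := s) (α := α) (m := m - 1) hX r
      rw [sub_add_cancel] at h4
      rw [h4]
      have h2 := le_norm_den_of_nonpos hδ hδ2 h h0
      have h3 := saddleBound_nonneg s.im X r
      calc _ ≤ 2 * X ^ (-s.re) * saddleBound s.im X r * Real.exp (-(2 * Real.pi * r)) := by gcongr
        _ = 2 / δ * (2 * X ^ (-s.re)) * saddleBound s.im X r *
          (δ / 2 * Real.exp (-(2 * Real.pi * r))) := by field_simp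
        _ ≤ _ := by gcongr
  · have h1 : ∫ r in Ioi (-X), 2 / δ * (2 * X ^ (-s.re)) * saddleBound s.im X r ≤
        ∫ r, 2 / δ * (2 * X ^ (-s.re)) * saddleBound s.im X r :=
      setIntegral_le_integral hint (Eventually.of_forall fun r =>
        mul_nonneg (by positivity) (saddleBound_nonneg _ _ _))
    refine h1.trans ?_
    rw [integral_const_mul]
    have := mul_le_mul_of_nonneg_left (integral_saddleBound_le ht hX)
      (by positivity : 0 ≤ 2 / δ * (2 * X ^ (-s.re)))
    refine this.trans (le_of_eq ?_)
    ring

/-- To the left of the negative imaginary axis the argument and the frequency are not positive, so that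
no exponential growth occurs in the numerator. -/
theorem norm_integral_Iic_osc_div_den_le (hs : 0 ≤ s.re) (hs1 : s.re ≤ 1) (ht : 0 < s.im)
    (hX : 1 / 2 ≤ X) (hm : m ≤ 0) :
    ‖∫ r in Iic (-X), osc s α m (X + r * (1 + I)) / den α (X + r * (1 + I))‖ ≤
      4 * X ^ (-s.re) := by
  have hX0 : 0 < X := by linarith
  have hpi := Real.pi_gt_three
  have h2π : (0 : ℝ) < 2 * Real.pi := by positivity
  have hint := (integrableOn_exp_mul_Iic h2π (-X)).const_mul (4 * X ^ (-s.re))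
  refine (norm_integral_le_of_norm_le hint ?_).trans ?_
  · filter_upwards [ae_restrict_mem measurableSet_Iic] with r hr
    have hr : r ≤ -X := hr
    have hz := line_im X r
    have hden : Real.exp (-(2 * Real.pi * r)) / 2 ≤ ‖den α (X + r * (1 + I))‖ := by
      have h3 := norm_sub_norm_le (cexp (2 * Real.pi * I * ((X + r * (1 + I) : ℂ) - α))) (1 : ℂ)
      rw [norm_exp_two_pi_I, hz, norm_one, norm_sub_rev] at h3
      have h4 := Real.add_one_le_exp (-(2 * Real.pi * r))
      have h5 : 3 ≤ -(2 * Real.pi * r) := by nlinarith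
      rw [den]; linarith
    have hpos : 0 < ‖den α (X + r * (1 + I))‖ := lt_of_lt_of_le (by positivity) hden
    rw [norm_div, div_le_iff₀ hpos,
      norm_osc s α m (slitPlane_ne_zero (line_mem_slitPlane hX0 r)), hz]
    have harg : arg (X + r * (1 + I)) ≤ 0 := (arg_neg_iff.mpr (by rw [hz]; linarith)).le
    have h6 : Real.exp (s.im * arg (X + r * (1 + I)) - 2 * Real.pi * m * r) ≤ 1 := by
      apply Real.exp_le_one_iff.mpr
      have a1 := mul_nonpos_of_nonneg_of_nonpos ht.le harg
      have a2 : 0 ≤ 2 * Real.pi * (m * r) :=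
        mul_nonneg h2π.le (mul_nonneg_of_nonpos_of_nonpos hm (by linarith))
      linarith
    have h7 := half_rpow_neg_le hs hs1 hX0 (half_le_norm_line X r)
    calc _ ≤ 2 * X ^ (-s.re) * 1 := mul_le_mul h7 h6 (Real.exp_pos _).le (by positivity)
      _ = 4 * X ^ (-s.re) * Real.exp (2 * Real.pi * r) * (Real.exp (-(2 * Real.pi * r)) / 2) := by
        have : Real.exp (2 * Real.pi * r) * Real.exp (-(2 * Real.pi * r)) = 1 := by
          rw [← Real.exp_add]; simp
        linear_combination (-2 * X ^ (-s.re)) * this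
      _ ≤ _ := by gcongr
  · rw [integral_const_mul, integral_exp_mul_Iic h2π]
    have h1 : Real.exp (2 * Real.pi * -X) / (2 * Real.pi) ≤ 1 := by
      rw [div_le_one h2π]
      have : Real.exp (2 * Real.pi * -X) ≤ 1 := Real.exp_le_one_iff.mpr (by nlinarith)
      linarith
    exact mul_le_of_le_one_right (by positivity) h1

end saddle

/-! ### Bounds for the segments -/

section segments
variable {s : ℂ} {α m X : ℝ}

/-- An integration by parts keeps this bound uniform as `Re s → 1`. -/
theorem norm_integral_cpow_mul_exp_le (hs1 : s.re < 1) (hX : 0 ≤ X) {a E : ℝ}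
    (hE : 1 ≤ E) (haE : Real.exp (a * X) ≤ E) :
    ‖1 - s‖ * ‖∫ v in (0 : ℝ)..X, (v : ℂ) ^ (-s) * cexp (a * v)‖ ≤ 2 * X ^ (1 - s.re) * E := by
  have hs' : 0 < (1 - s).re := by simp; linarith
  have hs0 : 1 - s ≠ 0 := fun h => by rw [h] at hs'; simp at hs'
  have hcexp : Continuous fun v : ℝ => cexp (a * v) := by fun_prop
  have hi1 : IntervalIntegrable (fun v : ℝ => (v : ℂ) ^ (-s) * cexp (a * v)) volume 0 X :=
    (intervalIntegral.intervalIntegrable_cpow' (by simp; linarith)).mul_continuousOn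
      hcexp.continuousOn
  have hcp : ContinuousOn (fun v : ℝ => (v : ℂ) ^ (1 - s)) (uIcc 0 X) := fun v hv =>
    (continuousAt_ofReal_cpow_const v (1 - s) (Or.inl hs')).continuousWithinAt
  have hi2 : IntervalIntegrable (fun v : ℝ => (v : ℂ) ^ (1 - s) * (a * cexp (a * v))) volume 0 X :=
    (hcp.mul (by fun_prop)).intervalIntegrable
  have key := intervalIntegral.integral_eq_sub_of_hasDerivAt_of_le hX
    (f := fun v : ℝ => (v : ℂ) ^ (1 - s) * cexp (a * v))
    (f' := fun v : ℝ => (1 - s) * ((v : ℂ) ^ (-s) * cexp (a * v)) +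
      (v : ℂ) ^ (1 - s) * (a * cexp (a * v)))
    (by rw [uIcc_of_le hX] at hcp; exact hcp.mul hcexp.continuousOn)
    (fun v hv => by
      have h1 := hasDerivAt_ofReal_cpow_const (x := v) (r := 1 - s) hv.1.ne' hs0
      have h2 : HasDerivAt (fun v : ℝ => cexp (a * v)) (a * cexp (a * v)) v := by
        have h3 : HasDerivAt (fun v : ℝ => (a * v : ℂ)) a v := by
          simpa using (hasDerivAt_id v).ofReal_comp.const_mul (a : ℂ)
        have := h3.cexp
        rwa [mul_comm] at this
      convert! h1.mul h2 using 1
      rw [show (1 - s - 1 : ℂ) = -s by ring]; ring)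
    ((hi1.const_mul _).add hi2)
  rw [intervalIntegral.integral_add (hi1.const_mul _) hi2,
    intervalIntegral.integral_const_mul] at key
  have hXs : ‖(X : ℂ) ^ (1 - s)‖ ≤ X ^ (1 - s.re) := by
    rw [norm_cpow_eq_rpow_re_of_nonneg hX hs'.ne']; simp
  have hnorm1 : ‖(X : ℂ) ^ (1 - s) * cexp (a * X)‖ ≤ X ^ (1 - s.re) * Real.exp (a * X) := by
    rw [norm_mul, norm_exp]
    refine mul_le_mul hXs (le_of_eq ?_) (Real.exp_pos _).le (by positivity)
    simp
  have hnorm2 : ‖∫ v in (0 : ℝ)..X, (v : ℂ) ^ (1 - s) * (a * cexp (a * v))‖ ≤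
      X ^ (1 - s.re) * |Real.exp (a * X) - 1| := by
    have hFTC : ∫ v in (0 : ℝ)..X, a * Real.exp (a * v) = Real.exp (a * X) - 1 := by
      simp [intervalIntegral.mul_integral_comp_mul_left (f := Real.exp)]
    have hFTC' : ∫ v in (0 : ℝ)..X, X ^ (1 - s.re) * (|a| * Real.exp (a * v)) =
        X ^ (1 - s.re) * |Real.exp (a * X) - 1| := by
      rw [intervalIntegral.integral_const_mul]
      congr 1
      rcases le_total 0 a with h | h
      · rw [abs_of_nonneg h, hFTC, abs_of_nonneg]
        have := Real.one_le_exp (mul_nonneg h hX); linarith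
      · simp only [abs_of_nonpos h, neg_mul, intervalIntegral.integral_neg, hFTC]
        rw [abs_of_nonpos]
        have := Real.exp_le_one_iff.mpr (mul_nonpos_of_nonpos_of_nonneg h hX); linarith
    rw [← hFTC']
    refine intervalIntegral.norm_integral_le_of_norm_le hX ?_
      (by apply Continuous.intervalIntegrable; fun_prop)
    refine Eventually.of_forall fun v hv => ?_
    rw [norm_mul, norm_mul, norm_exp, norm_real, Real.norm_eq_abs,
      norm_cpow_eq_rpow_re_of_pos hv.1]
    have : v ^ (1 - s).re ≤ X ^ (1 - s.re) := by
      have h5 : (1 - s).re = 1 - s.re := by simp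
      rw [h5]
      exact Real.rpow_le_rpow hv.1.le hv.2 (by linarith)
    refine mul_le_mul this (le_of_eq ?_) (by positivity) (by positivity)
    simp
  have h0 : (((0 : ℝ) : ℂ)) ^ (1 - s) = 0 := by rw [ofReal_zero, zero_cpow hs0]
  rw [h0, zero_mul, sub_zero] at key
  have e : (1 - s) * ∫ v in (0 : ℝ)..X, (v : ℂ) ^ (-s) * cexp (a * v) =
      (X : ℂ) ^ (1 - s) * cexp (a * X) -
        ∫ v in (0 : ℝ)..X, (v : ℂ) ^ (1 - s) * (a * cexp (a * v)) := by
    linear_combination key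
  rw [← norm_mul, e]
  refine (norm_sub_le _ _).trans ((add_le_add hnorm1 hnorm2).trans ?_)
  rw [← mul_add]
  have : Real.exp (a * X) + |Real.exp (a * X) - 1| ≤ 2 * E := by
    have hp := Real.exp_pos (a * X)
    rcases abs_cases (Real.exp (a * X) - 1) with ⟨h, _⟩ | ⟨h, _⟩ <;> rw [h] <;> linarith
  calc _ ≤ X ^ (1 - s.re) * (2 * E) := by gcongr
    _ = _ := by ring

/-- On the segment `arg z = -π/2`, so that `|z ^ (-s)|` carries the factor `exp (-πt/2)`, while the
exponential is at most `exp t`. -/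
theorem norm_seg_le (hs1 : s.re < 1) (ht : 0 < s.im) (hX : 0 < X)
    (hm : 2 * Real.pi * m * X ≤ s.im) : ‖seg s α m X‖ ≤ 2 * X ^ (-s.re) * (X / s.im) := by
  have hcongr : ∫ v in (0 : ℝ)..X, osc s α m (-(I * v)) =
      (-I) ^ (-s) * cexp (-(2 * Real.pi * I * m * α)) *
        ∫ v in (0 : ℝ)..X, (v : ℂ) ^ (-s) * cexp ((2 * Real.pi * m : ℝ) * v) := by
    rw [← intervalIntegral.integral_const_mul]
    refine intervalIntegral.integral_congr_ae (Eventually.of_forall fun v hv => ?_)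
    rw [uIoc_of_le hX.le] at hv
    have hv0 : 0 < v := hv.1
    have hp : (-(I * v) : ℂ) ^ (-s) = (-I) ^ (-s) * (v : ℂ) ^ (-s) := by
      rw [show (-(I * v) : ℂ) = v * (-I) by ring,
        cpow_def_of_ne_zero (by simpa using hv0.ne'), log_ofReal_mul hv0 (by simp),
        cpow_def_of_ne_zero (by simp : (-I : ℂ) ≠ 0),
        cpow_def_of_ne_zero (ofReal_ne_zero.mpr hv0.ne'), ← ofReal_log hv0.le,
        ← Complex.exp_add]
      ring_nf
    rw [osc, hp, show (2 * Real.pi * I * m * (-(I * v) - α) : ℂ) =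
      -(2 * Real.pi * I * m * α) + (2 * Real.pi * m : ℝ) * v by
        push_cast; linear_combination (-2 * Real.pi * m * v : ℂ) * I_sq, Complex.exp_add]
    ring
  have hI : ‖(-I : ℂ) ^ (-s)‖ = Real.exp (-(Real.pi / 2 * s.im)) := by
    rw [norm_cpow_of_ne_zero (by simp), arg_neg_I]
    simp [← Real.exp_neg]
  have he : ‖cexp (-(2 * Real.pi * I * m * α))‖ = 1 := by
    rw [norm_exp]; simp
  have hns : s.im ≤ ‖1 - s‖ := by
    have := abs_im_le_norm (1 - s)
    simp only [sub_im, one_im, zero_sub, abs_neg] at this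
    exact (le_abs_self _).trans this
  have key := norm_integral_cpow_mul_exp_le hs1 hX.le (a := 2 * Real.pi * m)
    (E := Real.exp s.im) (Real.one_le_exp ht.le) (Real.exp_le_exp.mpr hm)
  have hX1 : X ^ (1 - s.re) = X ^ (-s.re) * X := by
    rw [sub_eq_neg_add, Real.rpow_add_one hX.ne']
  rw [seg, norm_mul, norm_I, one_mul, hcongr, norm_mul, norm_mul, hI, he, mul_one]
  set J := ‖∫ v in (0 : ℝ)..X, (v : ℂ) ^ (-s) * cexp ((2 * Real.pi * m : ℝ) * v)‖
  have hJ : s.im * J ≤ 2 * (X ^ (-s.re) * X) * Real.exp s.im := by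
    rw [← hX1]
    exact (mul_le_mul_of_nonneg_right hns (norm_nonneg _)).trans key
  have h1 : Real.exp (-(Real.pi / 2 * s.im)) * Real.exp s.im ≤ 1 := by
    rw [← Real.exp_add]
    apply Real.exp_le_one_iff.mpr
    nlinarith [Real.pi_gt_three]
  have h2 : Real.exp (-(Real.pi / 2 * s.im)) * (s.im * J) ≤ 2 * (X ^ (-s.re) * X) := by
    calc _ ≤ Real.exp (-(Real.pi / 2 * s.im)) * (2 * (X ^ (-s.re) * X) * Real.exp s.im) := by gcongr
      _ = 2 * (X ^ (-s.re) * X) * (Real.exp (-(Real.pi / 2 * s.im)) * Real.exp s.im) := by ring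
      _ ≤ 2 * (X ^ (-s.re) * X) * 1 := by gcongr
      _ = _ := mul_one _
  rw [show 2 * X ^ (-s.re) * (X / s.im) = 2 * (X ^ (-s.re) * X) / s.im by ring, le_div_iff₀ ht]
  linarith

end segments

/-! ### Bounds for the dual terms -/

section dualbounds
variable {s : ℂ} {α m : ℝ}

/-- Stirling's upper bound for the Gamma factor, obtained from the ray integral through its saddle
point `t / (2πm)`. -/
theorem norm_dual_one_le (hs : 0 ≤ s.re) (hs1 : s.re < 1) (ht : 1 ≤ s.im) (hm : 0 < m) :
    ‖dual s α 1 m‖ ≤ 82 * ((s.im / m) ^ (1 - s.re) / √s.im) := by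
  have ht0 : 0 < s.im := by linarith
  set X := s.im / (2 * Real.pi * m) with hXdef
  have hX : 0 < X := by positivity
  have hmX : 2 * Real.pi * m * X = s.im := by rw [hXdef]; field_simp
  have h1 := integral_Ioi_osc_line (α := α) hs hs1 hX hm
  have h2 := norm_integral_Ioi_osc_line_le (α := α) hs hs1.le ht hX hmX
  have h3 := norm_seg_le (α := α) hs1 ht0 hX hmX.le
  have hX1 : X ^ (1 - s.re) = X ^ (-s.re) * X := by
    rw [sub_eq_neg_add, Real.rpow_add_one hX.ne']
  have hXle : X ^ (1 - s.re) ≤ (s.im / m) ^ (1 - s.re) := by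
    refine Real.rpow_le_rpow hX.le ?_ (by linarith)
    rw [hXdef]
    apply div_le_div_of_nonneg_left ht0.le hm
    nlinarith [Real.pi_gt_three]
  have hsq : X / s.im ≤ X / √s.im := by
    apply div_le_div_of_nonneg_left hX.le (Real.sqrt_pos.mpr ht0)
    rw [Real.sqrt_le_left ht0.le]; nlinarith
  have e : dual s α 1 m = (1 + I) * (∫ r in Ioi (-X), osc s α m (X + r * (1 + I))) -
      seg s α m X := by rw [h1, seg]; ring
  rw [e]
  calc _ ≤ 2 * (40 * (X ^ (-s.re) * (X / √s.im))) + 2 * X ^ (-s.re) * (X / s.im) := by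
        refine (norm_sub_le _ _).trans (add_le_add ?_ h3)
        rw [norm_mul]
        exact mul_le_mul norm_one_add_I_le h2 (norm_nonneg _) two_pos.le
    _ ≤ 2 * (40 * (X ^ (-s.re) * (X / √s.im))) + 2 * X ^ (-s.re) * (X / √s.im) := by gcongr
    _ = 82 * (X ^ (1 - s.re) / √s.im) := by rw [hX1]; ring
    _ ≤ _ := by gcongr

theorem norm_dual_neg_one :
    ‖dual s α (-1) (-m)‖ = Real.exp (-(Real.pi * s.im)) * ‖dual s α 1 m‖ := by
  have h1 : ∀ m : ℝ, ‖cexp (-(2 * Real.pi * I * m * α))‖ = 1 := fun m => by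
    rw [norm_exp]; simp
  have h2 : ∀ ε : ℝ, ‖cexp (ε * (Real.pi * I / 2) * (1 - s))‖ =
      Real.exp (ε * (Real.pi / 2) * s.im) := fun ε => by
    rw [norm_exp]; congr 1
    simp
  rw [dual, dual]
  simp only [norm_mul, h1, h2]
  have h3 : Real.exp (-1 * (Real.pi / 2) * s.im) =
      Real.exp (-(Real.pi * s.im)) * Real.exp (1 * (Real.pi / 2) * s.im) := by
    rw [← Real.exp_add]; congr 1; ring
  rw [show (-1 : ℝ) * -m = 1 * m by ring, h3]
  ring

/-- The dual terms on the side where the Gamma factor is exponentially small. -/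
theorem norm_dual_neg_one_le (hs : 0 ≤ s.re) (hs1 : s.re < 1) (ht : 1 ≤ s.im) (hm : 1 ≤ m) :
    ‖dual s α (-1) (-m)‖ ≤ 82 / s.im ^ 2 := by
  have ht0 : 0 < s.im := by linarith
  rw [norm_dual_neg_one]
  have h1 := norm_dual_one_le (α := α) hs hs1 ht (by linarith : 0 < m)
  have h2 : (s.im / m) ^ (1 - s.re) / √s.im ≤ s.im := by
    have a1 : (s.im / m) ^ (1 - s.re) ≤ s.im := by
      calc (s.im / m) ^ (1 - s.re) ≤ s.im ^ (1 - s.re) := by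
            refine Real.rpow_le_rpow (by positivity) ?_ (by linarith)
            exact div_le_self ht0.le hm
        _ ≤ s.im ^ (1 : ℝ) := Real.rpow_le_rpow_of_exponent_le ht (by linarith)
        _ = s.im := Real.rpow_one _
    exact (div_le_self (by positivity) (Real.one_le_sqrt.mpr ht)).trans a1
  have h3 : Real.exp (-(Real.pi * s.im)) ≤ 1 / s.im ^ 3 := by
    rw [Real.exp_neg, ← one_div]
    apply one_div_le_one_div_of_le (by positivity)
    calc s.im ^ 3 ≤ Real.exp s.im ^ 3 := by
          gcongr; linarith [Real.add_one_le_exp s.im]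
      _ = Real.exp (3 * s.im) := by rw [← Real.exp_nat_mul]; norm_num
      _ ≤ _ := by
          apply Real.exp_le_exp.mpr; nlinarith [Real.pi_gt_three]
  calc _ ≤ 1 / s.im ^ 3 * (82 * s.im) :=
        mul_le_mul h3 (h1.trans (by gcongr)) (norm_nonneg _) (by positivity)
    _ = _ := by field_simp

end dualbounds

/-! ### The approximate functional equation for the continued tails -/

/-- Points close to `x` and away from the translates of `α` by integers. -/
theorem exists_dist_int_ge (x α : ℝ) {Δ : ℝ} (hΔ : 0 < Δ) (hΔ2 : Δ ≤ 1 / 2) :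
    ∃ X, x - Δ / 2 ≤ X ∧ X ≤ x ∧ ∀ n : ℤ, Δ / 4 ≤ |X - α - n| := by
  by_cases h : ∀ n : ℤ, Δ / 4 ≤ |x - α - n|
  · exact ⟨x, by linarith, le_rfl, h⟩
  · push Not at h
    obtain ⟨n₀, hn₀⟩ := h
    rw [abs_lt] at hn₀
    refine ⟨x - Δ / 2, le_rfl, by linarith, fun n => ?_⟩
    rcases lt_trichotomy n n₀ with h | h | h
    · have : (n : ℝ) + 1 ≤ n₀ := by exact_mod_cast h
      rw [le_abs]; left; linarith
    · rw [h, le_abs]; right; linarith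
    · have : (n₀ : ℝ) + 1 ≤ n := by exact_mod_cast h
      rw [le_abs]; right; linarith

theorem norm_sum_range_sub_sum_range_le {f : ℕ → ℂ} {B : ℝ} {K L : ℕ}
    (h : ∀ k, min K L ≤ k → ‖f k‖ ≤ B) :
    ‖∑ k ∈ Finset.range K, f k - ∑ k ∈ Finset.range L, f k‖ ≤ |(K : ℝ) - L| * B := by
  wlog hKL : L ≤ K generalizing K L
  · rw [norm_sub_rev, abs_sub_comm]
    exact this (by rwa [min_comm]) (by omega)
  rw [← Finset.sum_range_add_sum_Ico _ hKL, add_sub_cancel_left]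
  refine (norm_sum_le_of_le _ fun k hk => h k ?_).trans ?_
  · rw [min_eq_right hKL]; exact (Finset.mem_Ico.mp hk).1
  · have : (L : ℝ) ≤ K := by exact_mod_cast hKL
    rw [Finset.sum_const, Nat.card_Ico, nsmul_eq_mul, Nat.cast_sub hKL, abs_of_nonneg (by linarith)]

section core
variable {s : ℂ} {α δ lam x y X : ℝ}

theorem rpow_neg_le_two_mul {σ : ℝ} (hs : 0 ≤ σ) (hs1 : σ ≤ 1) (hx : 0 < x) (hX : x / 2 ≤ X) :
    X ^ (-σ) ≤ 2 * x ^ (-σ) := by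
  have h := half_rpow_neg_le (s := (σ : ℂ)) (by simpa using hs) (by simpa using hs1) hx
    (z := (X : ℂ)) (by rw [norm_real, Real.norm_of_nonneg (by linarith)]; exact hX)
  rwa [norm_real, Real.norm_of_nonneg (by linarith), ofReal_re] at h

theorem mul_sqrt_div_le {t : ℝ} (hx : 0 < x) (hy : 0 < y) (h : x * y ≤ t) :
    x * √(y / x) ≤ √t := by
  have ht : 0 < t := lt_of_lt_of_le (by positivity) h
  apply Real.le_sqrt_of_sq_le
  rw [mul_pow, Real.sq_sqrt (by positivity)]
  calc x ^ 2 * (y / x) = x * y := by field_simp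
    _ ≤ t := h

theorem inv_min_sqrt_le (hx : 0 < x) (hy : 0 < y) :
    1 / min (1 / 2) √(x / y) ≤ 2 + √(y / x) := by
  have h0 : √(y / x) = 1 / √(x / y) := by
    rw [one_div, ← Real.sqrt_inv, inv_div]
  have h1 : 0 < √(x / y) := by positivity
  rcases min_choice (1 / 2 : ℝ) √(x / y) with h | h
  · rw [h]; have := Real.sqrt_nonneg (y / x); linarith
  · rw [h, h0]; linarith

/-- The integrals and segments left over after the dual terms have been taken out of the tail:
the cut point `X` is within `min (1 / 2) √(x / y)` of `x` and at a comparable distance from the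
poles. -/
theorem norm_remainder_le (hs : 0 < s.re) (hs1 : s.re < 1) (hx : 1 ≤ x) (hy : 1 ≤ y)
    (hxy : 2 * Real.pi * x * y = s.im) (hX : x / 2 ≤ X) (hXx : X ≤ x)
    (h : ∀ n : ℤ, min (1 / 2) √(x / y) / 4 ≤ |X - α - n|) (hl : 0 ≤ lam) (hl1 : lam < 1) {K : ℕ}
    (hK : K ≤ s.im / (2 * Real.pi * X) - lam) (hK1 : s.im / (2 * Real.pi * X) - lam < K + 1) :
    ‖(1 + I) * (∫ r in Ioi (-X),
        osc s α (lam + K + 1) (X + r * (1 + I)) / den α (X + r * (1 + I))) +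
      (1 + I) * (∫ r in Iic (-X),
        osc s α (lam - 1) (X + r * (1 + I)) / den α (X + r * (1 + I))) +
      (∑ k ∈ Finset.range K, seg s α (lam + (k + 1)) X + seg s α lam X +
        seg s α (lam - 1) X)‖ ≤ 2580 * (x ^ (-s.re) + x ^ (1 - s.re) / √s.im) := by
  have hx0 : 0 < x := by linarith
  have hy0 : 0 < y := by linarith
  have hX0 : 0 < X := by linarith
  have hpi := Real.pi_gt_three
  have hxyt : x * y ≤ s.im := by
    rw [← hxy, mul_assoc]
    exact le_mul_of_one_le_left (by positivity) (by linarith)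
  have ht1 : 1 ≤ s.im := (one_le_mul_of_one_le_of_one_le hx hy).trans hxyt
  have ht : 0 < s.im := by linarith
  have hxt : 6 * x ≤ s.im := by
    rw [← hxy]
    have : x * 1 ≤ x * y := by gcongr
    nlinarith
  have hst : 0 < √s.im := Real.sqrt_pos.mpr ht
  have hXs : X ^ (-s.re) ≤ 2 * x ^ (-s.re) := rpow_neg_le_two_mul hs.le hs1.le hx0 hX
  have hp : 0 < x ^ (-s.re) := by positivity
  have hx1 : x ^ (1 - s.re) = x ^ (-s.re) * x := by
    rw [sub_eq_neg_add, Real.rpow_add_one hx0.ne']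
  set D := min (1 / 2) √(x / y) with hD
  have hD0 : 0 < D := lt_min (by norm_num) (by positivity)
  have hD2 : D ≤ 1 / 2 := min_le_left _ _
  have hδ : 0 < D / 4 := by positivity
  have hδ2 : D / 4 ≤ 1 / 2 := by linarith
  have hc : 0 < 2 * Real.pi * X := by positivity
  rw [le_sub_iff_add_le, le_div_iff₀ hc] at hK
  rw [sub_lt_iff_lt_add, div_lt_iff₀ hc] at hK1
  have b1 : ‖(1 + I) * (∫ r in Ioi (-X),
      osc s α (lam + K + 1) (X + r * (1 + I)) / den α (X + r * (1 + I)))‖ ≤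
      2560 * (x ^ (-s.re) + x ^ (1 - s.re) / √s.im) := by
    have h1 := norm_integral_Ioi_osc_div_den_le (α := α) hs.le hs1.le ht1 hX0 hδ hδ2 h
      (m := lam + K + 1) (by nlinarith) (by nlinarith)
    have h2 : x / (D * √s.im) ≤ 2 * (x / √s.im) + 1 := by
      have e1 := inv_min_sqrt_le hx0 hy0
      have e2 := mul_sqrt_div_le hx0 hy0 hxyt
      calc x / (D * √s.im) = x * (1 / D) / √s.im := by field_simp
        _ ≤ x * (2 + √(y / x)) / √s.im := by gcongr
        _ = 2 * (x / √s.im) + x * √(y / x) / √s.im := by ring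
        _ ≤ _ := by gcongr; rwa [div_le_one hst]
    rw [norm_mul]
    calc _ ≤ 2 * (80 / (D / 4) * (X ^ (-s.re) * (X / √s.im))) :=
          mul_le_mul norm_one_add_I_le h1 (norm_nonneg _) two_pos.le
      _ ≤ 2 * (80 / (D / 4) * (2 * x ^ (-s.re) * (x / √s.im))) := by gcongr
      _ = 1280 * x ^ (-s.re) * (x / (D * √s.im)) := by field_simp; ring
      _ ≤ 1280 * x ^ (-s.re) * (2 * (x / √s.im) + 1) := by gcongr
      _ = 2560 * (x ^ (-s.re) * x / √s.im) + 1280 * x ^ (-s.re) := by ring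
      _ ≤ _ := by rw [hx1]; linarith
  have b2 : ‖(1 + I) * (∫ r in Iic (-X),
      osc s α (lam - 1) (X + r * (1 + I)) / den α (X + r * (1 + I)))‖ ≤ 16 * x ^ (-s.re) := by
    have h1 := norm_integral_Iic_osc_div_den_le (α := α) hs.le hs1.le ht (by linarith : 1 / 2 ≤ X)
      (by linarith : lam - 1 ≤ 0)
    rw [norm_mul]
    have := mul_le_mul norm_one_add_I_le h1 (norm_nonneg _) two_pos.le
    linarith
  have b3 : ‖∑ k ∈ Finset.range K, seg s α (lam + (k + 1)) X + seg s α lam X +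
      seg s α (lam - 1) X‖ ≤ 4 * x ^ (-s.re) := by
    have hm : ∀ m : ℝ, m ≤ lam + K → ‖seg s α m X‖ ≤ 2 * X ^ (-s.re) * (X / s.im) := fun m hm =>
      norm_seg_le hs1 ht hX0 (by nlinarith)
    have h1 : ‖∑ k ∈ Finset.range K, seg s α (lam + (k + 1)) X‖ ≤
        K * (2 * X ^ (-s.re) * (X / s.im)) := by
      refine (norm_sum_le_of_le _ fun k hk => hm _ ?_).trans (by simp)
      have : ((k + 1 : ℕ) : ℝ) ≤ K := by exact_mod_cast Finset.mem_range.mp hk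
      push_cast at this
      linarith
    have h2 := hm lam (by simp)
    have h3 := hm (lam - 1) (by have : (0 : ℝ) ≤ K := by positivity
                                linarith)
    have h4 : (K + 2) * (X / s.im) ≤ 1 := by
      rw [← mul_div_assoc, div_le_one ht]
      have : (0 : ℝ) ≤ K * X := by positivity
      nlinarith
    calc _ ≤ K * (2 * X ^ (-s.re) * (X / s.im)) + 2 * X ^ (-s.re) * (X / s.im) +
          2 * X ^ (-s.re) * (X / s.im) :=
          (norm_add₃_le).trans (add_le_add (add_le_add h1 h2) h3)
      _ = 2 * X ^ (-s.re) * ((K + 2) * (X / s.im)) := by ring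
      _ ≤ 2 * (2 * x ^ (-s.re)) * 1 := by gcongr
      _ = _ := by ring
  refine (norm_add₃_le).trans ((add_le_add (add_le_add b1 b2) b3).trans ?_)
  have : 0 ≤ x ^ (1 - s.re) / √s.im := by positivity
  linarith

theorem norm_osc_natCast_add (hα : 0 < α) (k : ℕ) :
    ‖osc s α lam (k + α)‖ = ((k : ℝ) + α) ^ (-s.re) := by
  have hk : 0 < (k : ℝ) + α := by positivity
  have e : ((k : ℂ) + α) = ((k + α : ℝ) : ℂ) := by push_cast; rfl
  rw [osc, e, norm_mul, norm_cpow_eq_rpow_re_of_pos hk, norm_exp]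
  simp

/-- The approximate functional equation before the two series are identified: if the tails of the
series with sum `Z` are given by `rest`, then `Z` is the sum of the series up to `x` and of the
dual series up to `y`. -/
theorem norm_sub_sum_sub_sum_dual_le (hα : 0 < α) (hα1 : α ≤ 1) (hs : 0 < s.re) (hs1 : s.re < 1) (hx : 1 ≤ x)
    (hy : 1 ≤ y) (hxy : 2 * Real.pi * x * y = s.im) (hl : 0 ≤ lam) (hl1 : lam < 1) {Z : ℂ}
    (hZ : ∀ (X δ : ℝ) (N : ℕ), 0 < δ → δ ≤ 1 / 2 → 0 < X → (∀ n : ℤ, δ ≤ |X - α - n|) →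
      X < N + α → N + α < X + 1 →
      Z - ∑ n ∈ Finset.range N, osc s α lam (n + α) = rest s α lam X) :
    ‖Z - ∑ n ∈ Finset.range (⌊x⌋₊ + 1), osc s α lam (n + α) -
      ∑ k ∈ Finset.range ⌊y⌋₊, dual s α 1 (lam + (k + 1)) - dual s α (-1) (lam - 1)‖ ≤
      4000 * (x ^ (-s.re) + x ^ (1 - s.re) / √s.im) := by
  have hx0 : 0 < x := by linarith
  have hy0 : 0 < y := by linarith
  have hpi := Real.pi_gt_three
  have hxyt : x * y ≤ s.im := by
    rw [← hxy, mul_assoc]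
    exact le_mul_of_one_le_left (by positivity) (by linarith)
  have ht1 : 1 ≤ s.im := (one_le_mul_of_one_le_of_one_le hx hy).trans hxyt
  have ht : 0 < s.im := by linarith
  have hst : 0 < √s.im := Real.sqrt_pos.mpr ht
  set D := min (1 / 2) √(x / y) with hD
  have hD0 : 0 < D := lt_min (by norm_num) (by positivity)
  have hD2 : D ≤ 1 / 2 := min_le_left _ _
  obtain ⟨X, hX1, hX2, hX3⟩ := exists_dist_int_ge x α hD0 hD2
  have hX : x / 2 ≤ X := by linarith
  have hX0 : 0 < X := by linarith
  have hXs : X ^ (-s.re) ≤ 2 * x ^ (-s.re) := rpow_neg_le_two_mul hs.le hs1.le hx0 hX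
  -- the number of terms of the series to the left of the cut
  obtain ⟨N, hN1, hN2⟩ : ∃ N : ℕ, X < N + α ∧ N + α < X + 1 := by
    refine ⟨⌈X - α⌉₊, ?_, ?_⟩
    · have h1 := Nat.le_ceil (X - α)
      have h2 := hX3 ⌈X - α⌉₊
      refine lt_of_le_of_ne (by linarith) fun h3 => ?_
      rw [Int.cast_natCast, show X - α - (⌈X - α⌉₊ : ℝ) = 0 by linarith, abs_zero] at h2
      linarith
    · rcases le_or_gt 0 (X - α) with h1 | h1
      · linarith [Nat.ceil_lt_add_one h1]
      · rw [Nat.ceil_eq_zero.mpr h1.le, Nat.cast_zero]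
        linarith
  set y' := s.im / (2 * Real.pi * X) with hy'
  have hyy' : y ≤ y' := by
    rw [hy', le_div_iff₀ (by positivity), ← hxy]
    have : X * y ≤ x * y := by gcongr
    nlinarith
  have hy'y : y' - y ≤ √(y / x) := by
    have e : y' - y = y * (x - X) / X := by
      rw [hy', ← hxy]; field_simp
    have e1 : √(y / x) * √(x / y) = 1 := by
      rw [← Real.sqrt_mul (by positivity)]
      rw [show y / x * (x / y) = 1 by field_simp, Real.sqrt_one]
    have e2 : y / x = √(y / x) * √(y / x) := (Real.mul_self_sqrt (by positivity)).symm
    have e3 : D ≤ √(x / y) := min_le_right _ _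
    calc y' - y = y * (x - X) / X := e
      _ ≤ y * (D / 2) / (x / 2) := by gcongr; linarith
      _ = y / x * D := by field_simp
      _ ≤ y / x * √(x / y) := by gcongr
      _ = √(y / x) * (√(y / x) * √(x / y)) := by rw [← mul_assoc, ← e2]
      _ = _ := by rw [e1, mul_one]
  have hK0 : 0 ≤ y' - lam := by linarith
  set K := ⌊y' - lam⌋₊ with hKdef
  have hK : (K : ℝ) ≤ y' - lam := Nat.floor_le hK0
  have hK1 : y' - lam < K + 1 := Nat.lt_floor_add_one _
  have hL1 := Nat.floor_le hy0.le
  have hL2 := Nat.lt_floor_add_one y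
  have hM1 := Nat.floor_le hx0.le
  have hM2 := Nat.lt_floor_add_one x
  have hrem := norm_remainder_le (α := α) hs hs1 hx hy hxy hX hX2 hX3 hl hl1 hK hK1
  have hrest := (hZ X (D / 4) N (by positivity) (by linarith) hX0 hX3 hN1 hN2).trans
    (rest_eq_sum_dual hs.le hs1 hX0 (by positivity) (by linarith) hX3 hl hl1 K)
  -- every term in exactly one of the two sums has `n + α ≥ X`
  have hprimal := norm_sum_range_sub_sum_range_le (f := fun n : ℕ => osc s α lam (n + α))
    (K := N) (L := ⌊x⌋₊ + 1) (B := X ^ (-s.re)) fun k hk => by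
      rw [norm_osc_natCast_add hα]
      refine Real.rpow_le_rpow_of_nonpos hX0 ?_ (by linarith)
      rcases min_le_iff.mp hk with h | h
      · have : (N : ℝ) ≤ k := by exact_mod_cast h
        linarith
      · have : ((⌊x⌋₊ + 1 : ℕ) : ℝ) ≤ k := by exact_mod_cast h
        push_cast at this
        linarith
  -- every frequency in exactly one of the two sums is at least `y`
  have hdual := norm_sum_range_sub_sum_range_le (f := fun k : ℕ => dual s α 1 (lam + (k + 1)))
    (K := K) (L := ⌊y⌋₊) (B := 574 * (x ^ (1 - s.re) / √s.im)) fun k hk => by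
      have hm : y ≤ lam + (k + 1) := by
        rcases min_le_iff.mp hk with h | h
        · have : (K : ℝ) ≤ k := by exact_mod_cast h
          linarith
        · have : (⌊y⌋₊ : ℝ) ≤ k := by exact_mod_cast h
          linarith
      refine (norm_dual_one_le hs.le hs1 ht1 (by linarith)).trans ?_
      have h1 : (s.im / (lam + (k + 1))) ^ (1 - s.re) ≤ 7 * x ^ (1 - s.re) := by
        calc _ ≤ (7 * x) ^ (1 - s.re) := by
              refine Real.rpow_le_rpow (div_nonneg ht.le (by linarith)) ?_ (by linarith)
              rw [div_le_iff₀ (by linarith), ← hxy]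
              have : 2 * Real.pi ≤ 7 := by linarith [Real.pi_lt_d2]
              calc 2 * Real.pi * x * y ≤ 7 * x * y := by gcongr
                _ ≤ _ := by gcongr
          _ = 7 ^ (1 - s.re) * x ^ (1 - s.re) := Real.mul_rpow (by norm_num) hx0.le
          _ ≤ 7 ^ (1 : ℝ) * x ^ (1 - s.re) := by
              gcongr
              · norm_num
              · linarith
          _ = _ := by rw [Real.rpow_one]
      calc _ ≤ 82 * (7 * x ^ (1 - s.re) / √s.im) := by gcongr
        _ = _ := by ring
  have hx1 : x ^ (1 - s.re) = x ^ (-s.re) * x := by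
    rw [sub_eq_neg_add, Real.rpow_add_one hx0.ne']
  have c1 : |(N : ℝ) - (⌊x⌋₊ + 1 : ℕ)| ≤ 3 := by
    push_cast
    rw [abs_le]; constructor <;> linarith
  have c2 : |(K : ℝ) - ⌊y⌋₊| ≤ 2 + √(y / x) := by
    have := Real.sqrt_nonneg (y / x)
    rw [abs_le]; constructor <;> linarith
  have c3 : √(y / x) * (x ^ (1 - s.re) / √s.im) ≤ x ^ (-s.re) := by
    have := mul_sqrt_div_le hx0 hy0 hxyt
    rw [hx1]
    calc _ = x ^ (-s.re) * (x * √(y / x) / √s.im) := by ring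
      _ ≤ x ^ (-s.re) * 1 := by gcongr; rwa [div_le_one hst]
      _ = _ := mul_one _
  have hp : 0 < x ^ (-s.re) := by positivity
  have hq : 0 ≤ x ^ (1 - s.re) / √s.im := by positivity
  have d1 : |(N : ℝ) - (⌊x⌋₊ + 1 : ℕ)| * X ^ (-s.re) ≤ 3 * (2 * x ^ (-s.re)) := by gcongr
  have d2 : |(K : ℝ) - ⌊y⌋₊| * (574 * (x ^ (1 - s.re) / √s.im)) ≤
      (2 + √(y / x)) * (574 * (x ^ (1 - s.re) / √s.im)) := by gcongr
  have hfinal := norm_add₃_le.trans (add_le_add (add_le_add hprimal hdual) hrem)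
  refine le_trans (le_of_eq (congrArg norm ?_)) (hfinal.trans ?_)
  · linear_combination hrest
  · nlinarith
end core

section upper
variable {s : ℂ} {α lam x y : ℝ}

/-- The terms `k ≥ 1` of the second dual sum are exponentially small in the upper half-plane, so that
any number of them, up to about `y`, may be included. -/
theorem norm_sub_sum_sub_sum_dual_sub_sum_dual_le (hα : 0 < α) (hα1 : α ≤ 1) (hs : 0 < s.re)
    (hs1 : s.re < 1) (hx : 1 ≤ x)
    (hy : 1 ≤ y) (hxy : 2 * Real.pi * x * y = s.im) (hl : 0 ≤ lam) (hl1 : lam < 1) {Z : ℂ}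
    (hZ : ∀ (X δ : ℝ) (N : ℕ), 0 < δ → δ ≤ 1 / 2 → 0 < X → (∀ n : ℤ, δ ≤ |X - α - n|) →
      X < N + α → N + α < X + 1 →
      Z - ∑ n ∈ Finset.range N, osc s α lam (n + α) = rest s α lam X)
    {M : ℕ} (hM1 : 1 ≤ M) (hM : |(M : ℝ) - 1| ≤ y) :
    ‖Z - ∑ n ∈ Finset.range (⌊x⌋₊ + 1), osc s α lam (n + α) -
      ∑ k ∈ Finset.range ⌊y⌋₊, dual s α 1 (lam + (k + 1)) -
      ∑ k ∈ Finset.range M, dual s α (-1) (lam - 1 - k)‖ ≤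
      4100 * (x ^ (-s.re) + x ^ (1 - s.re) / √s.im) := by
  have hx0 : 0 < x := by linarith
  have hy0 : 0 < y := by linarith
  have hpi := Real.pi_gt_three
  have hxyt : x * y ≤ s.im := by
    rw [← hxy, mul_assoc]
    exact le_mul_of_one_le_left (by positivity) (by linarith)
  have ht1 : 1 ≤ s.im := (one_le_mul_of_one_le_of_one_le hx hy).trans hxyt
  have ht : 0 < s.im := by linarith
  have h1 := norm_sub_sum_sub_sum_dual_le hα hα1 hs hs1 hx hy hxy hl hl1 hZ
  have h2 := norm_sum_range_sub_sum_range_le (f := fun k : ℕ => dual s α (-1) (lam - 1 - k))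
    (K := M) (L := 1) (B := 82 / s.im ^ 2) fun k hk => by
      rw [min_eq_right hM1] at hk
      have : (1 : ℝ) ≤ k := by exact_mod_cast hk
      rw [show lam - 1 - k = -(k + (1 - lam)) by ring]
      exact norm_dual_neg_one_le hs.le hs1 ht1 (by linarith)
  have h3 : |(M : ℝ) - (1 : ℕ)| * (82 / s.im ^ 2) ≤ 82 * x ^ (-s.re) := by
    have e1 : x⁻¹ ≤ x ^ (-s.re) := by
      rw [← Real.rpow_neg_one]
      exact Real.rpow_le_rpow_of_exponent_le hx (by linarith)
    have e2 : y / s.im ^ 2 ≤ x⁻¹ := by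
      rw [← one_div, div_le_div_iff₀ (by positivity) hx0, mul_comm y, one_mul]
      exact hxyt.trans (le_self_pow₀ ht1 two_ne_zero)
    rw [Nat.cast_one]
    calc _ ≤ y * (82 / s.im ^ 2) := by gcongr
      _ = 82 * (y / s.im ^ 2) := by ring
      _ ≤ _ := by gcongr; exact e2.trans e1
  simp only [Finset.sum_range_one, Nat.cast_zero, sub_zero] at h2
  have hq : 0 ≤ x ^ (1 - s.re) / √s.im := by positivity
  have hp : 0 < x ^ (-s.re) := by positivity
  have h4 := (norm_sub_le _ _).trans (add_le_add h1 (h2.trans h3))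
  refine le_trans (le_of_eq (congrArg norm ?_)) (h4.trans ?_)
  · ring
  · linarith

end upper

/-! ### The dual terms and complex conjugation -/

section conjugation
variable {s : ℂ} {α m ε : ℝ}

/-- The dual term with the powers of `2π` and of the frequency separated. -/
theorem dual_eq_mul_div (s : ℂ) (α : ℝ) (h : 0 ≤ ε * m) :
    dual s α ε m = Gamma (1 - s) / (2 * Real.pi : ℂ) ^ (1 - s) *
      (cexp (-(2 * Real.pi * I * m * α) + ε * (Real.pi * I / 2) * (1 - s)) /
        ((ε * m : ℝ) : ℂ) ^ (1 - s)) := by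
  have h2 : (0 : ℝ) ≤ 2 * Real.pi := by positivity
  rw [dual, Complex.exp_add, ofReal_mul (2 * Real.pi), mul_cpow_ofReal_nonneg h2 h,
    show s - 1 = -(1 - s) by ring, cpow_neg, cpow_neg]
  push_cast
  ring

theorem conj_ofReal_cpow {r : ℝ} (hr : 0 ≤ r) (s : ℂ) :
    (starRingEnd ℂ) ((r : ℂ) ^ s) = (r : ℂ) ^ (starRingEnd ℂ) s := by
  rw [cpow_conj _ _ (by rw [arg_ofReal_of_nonneg hr]; exact Real.pi_pos.ne), conj_ofReal]

/-- Conjugation exchanges the two kinds of dual terms. -/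
theorem conj_dual (s : ℂ) (α : ℝ) (h : 0 ≤ ε * m) :
    (starRingEnd ℂ) (dual s α ε m) = dual ((starRingEnd ℂ) s) α (-ε) (-m) := by
  have h2 : (0 : ℝ) ≤ 2 * Real.pi * (ε * m) := by positivity
  rw [dual, dual, map_mul, map_mul, map_mul, ← Gamma_conj, ← exp_conj, ← exp_conj, conj_ofReal_cpow h2,
    neg_mul_neg]
  simp only [map_neg, map_sub, map_mul, map_div₀, map_ofNat, map_one, conj_ofReal, conj_I, ofReal_neg]
  ring_nf

theorem conj_natCast_add_cpow (hα : 0 < α) (n : ℕ) (s : ℂ) :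
    (starRingEnd ℂ) (((n : ℂ) + α) ^ s) = ((n : ℂ) + α) ^ (starRingEnd ℂ) s := by
  have e : ((n : ℂ) + α) = ((n + α : ℝ) : ℂ) := by push_cast; rfl
  rw [e, conj_ofReal_cpow (by positivity)]

/-- Conjugation replaces `lam` by `-lam`, and hence by `1 - lam`. -/
theorem conj_exp_two_pi_I (n : ℕ) (lam : ℝ) :
    (starRingEnd ℂ) (cexp (2 * Real.pi * I * n * lam)) =
      cexp (2 * Real.pi * I * n * (1 - lam : ℝ)) := by
  rw [← exp_conj, exp_eq_exp_iff_exists_int]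
  refine ⟨-n, ?_⟩
  simp only [map_mul, map_ofNat, conj_ofReal, conj_I, map_natCast]
  push_cast
  ring

theorem conj_osc (hα : 0 < α) (n : ℕ) (s : ℂ) (lam : ℝ) :
    (starRingEnd ℂ) (osc s α lam (n + α)) = osc ((starRingEnd ℂ) s) α (1 - lam) (n + α) := by
  rw [osc_natCast_add, osc_natCast_add, map_div₀, conj_natCast_add_cpow hα, conj_exp_two_pi_I]

theorem conj_osc_zero (hα : 0 < α) (n : ℕ) (s : ℂ) :
    (starRingEnd ℂ) (osc s α 0 (n + α)) = osc ((starRingEnd ℂ) s) α 0 (n + α) := by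
  rw [osc_natCast_add, osc_natCast_add, map_div₀, conj_natCast_add_cpow hα]
  simp

theorem conj_lerchZeta {lam : ℝ} (hα : 0 < α) (h0 : 0 < lam) (h1 : lam < 1) (s : ℂ) :
    (starRingEnd ℂ) (lerchZeta α lam s) = lerchZeta α (1 - lam) ((starRingEnd ℂ) s) := by
  have h := lerchZeta_spec hα h0 h1
  have h' := lerchZeta_spec hα (by linarith : 0 < 1 - lam) (by linarith)
  have hc : IsLerchContinuation α (1 - lam)
      (fun s => (starRingEnd ℂ) (lerchZeta α lam ((starRingEnd ℂ) s))) := by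
    refine ⟨fun s => ?_, fun s hs => ?_⟩
    · exact differentiableAt_conj_conj_iff.mpr (h.1 _)
    · have := (h.2 ((starRingEnd ℂ) s) (by simpa using hs)).map (starRingEnd ℂ) continuous_conj
      refine this.congr_fun fun n => ?_
      simp only [Function.comp, map_div₀, conj_natCast_add_cpow hα, conj_exp_two_pi_I, conj_conj]
  have := congrFun (hc.unique h') ((starRingEnd ℂ) s)
  simpa using this

theorem conj_hurwitzZeta (hα : 0 < α) (hα1 : α ≤ 1) {s : ℂ} (hs : s ≠ 1) :
    (starRingEnd ℂ) (HurwitzZeta.hurwitzZeta (α : UnitAddCircle) s) =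
      HurwitzZeta.hurwitzZeta (α : UnitAddCircle) ((starRingEnd ℂ) s) := by
  have hU : IsOpen ({1}ᶜ : Set ℂ) := isOpen_compl_singleton
  have hne : ∀ z : ℂ, z ≠ 1 → (starRingEnd ℂ) z ≠ 1 := fun z hz h => hz (by
    rw [← conj_conj z, h, map_one])
  have hf : AnalyticOnNhd ℂ (HurwitzZeta.hurwitzZeta (α : UnitAddCircle)) {1}ᶜ :=
    DifferentiableOn.analyticOnNhd (fun z hz =>
      (HurwitzZeta.differentiableAt_hurwitzZeta _ hz).differentiableWithinAt) hU
  have hg : AnalyticOnNhd ℂ (fun z => (starRingEnd ℂ)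
      (HurwitzZeta.hurwitzZeta (α : UnitAddCircle) ((starRingEnd ℂ) z))) {1}ᶜ :=
    DifferentiableOn.analyticOnNhd (fun z hz =>
      (differentiableAt_conj_conj_iff.mpr
        (HurwitzZeta.differentiableAt_hurwitzZeta _ (hne z hz))).differentiableWithinAt) hU
  have hconn : IsPreconnected ({1}ᶜ : Set ℂ) :=
    (isConnected_compl_singleton_of_one_lt_rank (by simp) 1).isPreconnected
  have hev : (fun z => (starRingEnd ℂ)
      (HurwitzZeta.hurwitzZeta (α : UnitAddCircle) ((starRingEnd ℂ) z))) =ᶠ[𝓝 2]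
      HurwitzZeta.hurwitzZeta (α : UnitAddCircle) := by
    have hev : ∀ᶠ z : ℂ in 𝓝 2, 1 < z.re :=
      continuous_re.continuousAt.eventually (lt_mem_nhds (by simp))
    filter_upwards [hev] with z hz
    have a1 := (HurwitzZeta.hasSum_hurwitzZeta_of_one_lt_re ⟨hα.le, hα1⟩
      (s := (starRingEnd ℂ) z) (by simpa using hz)).map (starRingEnd ℂ) continuous_conj
    have a2 := HurwitzZeta.hasSum_hurwitzZeta_of_one_lt_re ⟨hα.le, hα1⟩ hz
    refine (a1.congr_fun fun n => ?_).unique a2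
    simp only [Function.comp, map_div₀, conj_natCast_add_cpow hα, conj_conj, map_one]
  have := hg.eqOn_of_preconnected_of_eventuallyEq hf hconn (by simp : (2 : ℂ) ∈ ({1}ᶜ : Set ℂ)) hev
    (hne s hs)
  simpa using this

end conjugation

/-! ### The closed strip and both half-planes -/

/-- The error of the approximate functional equation of the Lerch zeta-function. -/
noncomputable def lerchError (α lam x y : ℝ) (s : ℂ) : ℂ :=
  lerchZeta α lam s - ∑ n ∈ Finset.range (⌊x⌋₊ + 1), osc s α lam (n + α) -
    ∑ n ∈ Finset.range (⌊y⌋₊ + 1), dual s α 1 (lam + n) -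
    ∑ n ∈ Finset.range (⌊y⌋₊ + 1), dual s α (-1) (lam - 1 - n)

/-- The error of the approximate functional equation of the Hurwitz zeta-function. -/
noncomputable def hurwitzError (α x y : ℝ) (s : ℂ) : ℂ :=
  HurwitzZeta.hurwitzZeta (α : UnitAddCircle) s -
    ∑ n ∈ Finset.range (⌊x⌋₊ + 1), osc s α 0 (n + α) -
    ∑ n ∈ Finset.range ⌊y⌋₊, dual s α 1 (n + 1) -
    ∑ n ∈ Finset.range ⌊y⌋₊, dual s α (-1) (-(n + 1))

section error
variable {s : ℂ} {α lam x y : ℝ}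

theorem norm_lerchError_le_of_mem_Ioo (hα : 0 < α) (hα1 : α ≤ 1) (h0 : 0 < lam) (h1 : lam < 1)
    (hs : 0 < s.re) (hs1 : s.re < 1) (hx : 1 ≤ x) (hy : 1 ≤ y)
    (hxy : 2 * Real.pi * x * y = s.im) :
    ‖lerchError α lam x y s‖ ≤ 4100 * (x ^ (-s.re) + x ^ (1 - s.re) / √s.im) := by
  have ht : 0 < s.im := by rw [← hxy]; positivity
  have hfl := Nat.floor_le (by linarith : 0 ≤ y)
  have := norm_sub_sum_sub_sum_dual_sub_sum_dual_le (Z := lerchZeta α lam s - dual s α 1 lam)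
    (M := ⌊y⌋₊ + 1) hα hα1 hs hs1 hx hy hxy h0.le h1 (fun X δ N hδ hδ2 hX h hN hN1 => by
      have := lerchZeta_sub_sum_eq_rest hα hδ hδ2 h0 h1 hX h hN hN1 hs hs1 ht
      linear_combination this) (by omega) (by push_cast; rwa [add_sub_cancel_right, Nat.abs_cast])
  refine le_trans (le_of_eq (congrArg norm ?_)) this
  rw [lerchError, Finset.sum_range_succ' (fun n : ℕ => dual s α 1 (lam + n))]
  push_cast
  rw [add_zero]
  ring

theorem norm_hurwitzError_le_of_mem_Ioo (hα : 0 < α) (hα1 : α ≤ 1)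
    (hs : 0 < s.re) (hs1 : s.re < 1) (hx : 1 ≤ x) (hy : 1 ≤ y)
    (hxy : 2 * Real.pi * x * y = s.im) :
    ‖hurwitzError α x y s‖ ≤ 4100 * (x ^ (-s.re) + x ^ (1 - s.re) / √s.im) := by
  have ht : 0 < s.im := by rw [← hxy]; positivity
  have hfl := Nat.floor_le (by linarith : 0 ≤ y)
  have hfl1 : 1 ≤ ⌊y⌋₊ := Nat.le_floor (by simpa using hy)
  have hfl2 : (1 : ℝ) ≤ ⌊y⌋₊ := by exact_mod_cast hfl1
  have := norm_sub_sum_sub_sum_dual_sub_sum_dual_le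
    (Z := HurwitzZeta.hurwitzZeta (α : UnitAddCircle) s)
    (M := ⌊y⌋₊) hα hα1 hs hs1 hx hy hxy le_rfl one_pos (fun X δ N hδ hδ2 hX h hN hN1 =>
      hurwitzZeta_sub_sum_eq_rest hα hα1 hδ hδ2 hX h hN hN1 hs hs1 ht) hfl1
      (by rw [abs_of_nonneg (by linarith)]; linarith)
  refine le_trans (le_of_eq (congrArg norm ?_)) this
  rw [hurwitzError]
  simp only [zero_add, neg_add', sub_eq_add_neg, add_comm]

theorem differentiableAt_dual (α : ℝ) {ε m : ℝ} (hm : 0 < ε * m) (ht : s.im ≠ 0) :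
    DifferentiableAt ℂ (fun s => dual s α ε m) s := by
  unfold dual
  have h1 : ((2 * Real.pi * (ε * m) : ℝ) : ℂ) ≠ 0 := ofReal_ne_zero.mpr (by positivity)
  have h2 : DifferentiableAt ℂ Gamma (1 - s) := differentiableAt_Gamma _ fun n h => ht (by
    have := congrArg im h
    simpa using this)
  have h3 : DifferentiableAt ℂ (fun s : ℂ => Gamma (1 - s)) s := h2.comp s (by fun_prop)
  have h4 : DifferentiableAt ℂ (fun s : ℂ => ((2 * Real.pi * (ε * m) : ℝ) : ℂ) ^ (s - 1)) s :=
    (differentiableAt_id.sub_const 1).const_cpow (Or.inl h1)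
  exact ((DifferentiableAt.mul (by fun_prop) h4)).mul h3

theorem differentiable_sum_osc (hα : 0 < α) (lam : ℝ) (N : ℕ) :
    Differentiable ℂ fun s => ∑ n ∈ Finset.range N, osc s α lam (n + α) :=
  Differentiable.fun_sum fun n _ => differentiable_osc_param α lam (by
    have h3 : ((n + α : ℝ) : ℂ) ≠ 0 := ofReal_ne_zero.mpr (by positivity)
    simpa using h3)

theorem differentiableAt_lerchError (hα : 0 < α) (h0 : 0 < lam) (h1 : lam < 1) (x y : ℝ)
    (ht : s.im ≠ 0) : DifferentiableAt ℂ (lerchError α lam x y) s := by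
  unfold lerchError
  refine (((lerchZeta_spec hα h0 h1).1 s |>.sub (differentiable_sum_osc hα lam _ s)).sub ?_).sub ?_
  · exact DifferentiableAt.fun_sum fun n _ => differentiableAt_dual α (by positivity) ht
  · refine DifferentiableAt.fun_sum fun n _ => differentiableAt_dual α ?_ ht
    have : (0 : ℝ) ≤ n := by positivity
    linarith

theorem differentiableAt_hurwitzError (hα : 0 < α) (x y : ℝ)
    (ht : s.im ≠ 0) : DifferentiableAt ℂ (hurwitzError α x y) s := by
  have hs : s ≠ 1 := fun h => ht (by rw [h]; simp)
  unfold hurwitzError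
  refine (((HurwitzZeta.differentiableAt_hurwitzZeta _ hs).sub
    (differentiable_sum_osc hα 0 _ s)).sub ?_).sub ?_
  · exact DifferentiableAt.fun_sum fun n _ => differentiableAt_dual α (by positivity) ht
  · refine DifferentiableAt.fun_sum fun n _ => differentiableAt_dual α ?_ ht
    rw [neg_mul_neg]; positivity

/-- On a horizontal line, a bound in the open strip extends to its edges by continuity. -/
theorem norm_le_of_forall_mem_Ioo {f : ℂ → ℂ} {C t : ℝ} (hx : 0 < x)
    (hf : ∀ s : ℂ, s.im = t → DifferentiableAt ℂ f s)
    (h : ∀ s : ℂ, s.im = t → 0 < s.re → s.re < 1 →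
      ‖f s‖ ≤ C * (x ^ (-s.re) + x ^ (1 - s.re) / √t))
    (ht : s.im = t) (hs : 0 ≤ s.re) (hs1 : s.re ≤ 1) :
    ‖f s‖ ≤ C * (x ^ (-s.re) + x ^ (1 - s.re) / √t) := by
  have him : ∀ σ : ℝ, (σ + t * I : ℂ).im = t := fun σ => by simp
  have hre : ∀ σ : ℝ, (σ + t * I : ℂ).re = σ := fun σ => by simp
  have hc : Continuous fun σ : ℝ => ‖f (σ + t * I)‖ :=
    continuous_iff_continuousAt.mpr fun σ => ContinuousAt.norm
      (ContinuousAt.comp (f := fun σ : ℝ => (σ + t * I : ℂ)) (hf _ (him σ)).continuousAt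
        (by fun_prop))
  have hc2 : Continuous fun σ : ℝ => C * (x ^ (-σ) + x ^ (1 - σ) / √t) := by
    have h1 : Continuous fun σ : ℝ => x ^ (-σ) := Real.continuous_const_rpow hx.ne' |>.comp continuous_neg
    have h2 : Continuous fun σ : ℝ => x ^ (1 - σ) :=
      (Real.continuous_const_rpow hx.ne').comp (continuous_const.sub continuous_id)
    fun_prop
  have key := le_on_closure (s := Ioo (0 : ℝ) 1) (fun σ hσ => by
      have := h (σ + t * I) (him σ) (by rw [hre]; exact hσ.1) (by rw [hre]; exact hσ.2)
      rwa [hre] at this) hc.continuousOn hc2.continuousOn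
    (by rw [closure_Ioo zero_ne_one]; exact ⟨hs, hs1⟩ : s.re ∈ closure (Ioo (0 : ℝ) 1))
  have e : (s.re + t * I : ℂ) = s := by rw [← ht]; exact re_add_im s
  simpa only [e] using key

theorem conj_lerchError (hα : 0 < α) (h0 : 0 < lam) (h1 : lam < 1) (x y : ℝ) (s : ℂ) :
    (starRingEnd ℂ) (lerchError α lam x y s) =
      lerchError α (1 - lam) x y ((starRingEnd ℂ) s) := by
  have e1 : ∀ n : ℕ, (starRingEnd ℂ) (dual s α 1 (lam + n)) =
      dual ((starRingEnd ℂ) s) α (-1) (1 - lam - 1 - n) := fun n => by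
    rw [conj_dual s α (by positivity)]; congr 1; ring
  have e2 : ∀ n : ℕ, (starRingEnd ℂ) (dual s α (-1) (lam - 1 - n)) =
      dual ((starRingEnd ℂ) s) α 1 (1 - lam + n) := fun n => by
    have : (0 : ℝ) ≤ n := by positivity
    rw [conj_dual s α (by linarith), neg_neg]; congr 1; ring
  simp only [lerchError, map_sub, map_sum, conj_lerchZeta hα h0 h1, conj_osc hα, e1, e2]
  ring

theorem conj_hurwitzError (hα : 0 < α) (hα1 : α ≤ 1) (x y : ℝ) (hs : s ≠ 1) :
    (starRingEnd ℂ) (hurwitzError α x y s) = hurwitzError α x y ((starRingEnd ℂ) s) := by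
  have e1 : ∀ n : ℕ, (starRingEnd ℂ) (dual s α 1 (n + 1)) =
      dual ((starRingEnd ℂ) s) α (-1) (-(n + 1)) := fun n => by
    rw [conj_dual s α (by positivity)]
  have e2 : ∀ n : ℕ, (starRingEnd ℂ) (dual s α (-1) (-(n + 1))) =
      dual ((starRingEnd ℂ) s) α 1 (n + 1) := fun n => by
    rw [conj_dual s α (by rw [neg_mul_neg]; positivity), neg_neg, neg_neg]
  simp only [hurwitzError, map_sub, map_sum, conj_hurwitzZeta hα hα1 hs, conj_osc_zero hα, e1, e2]
  ring

theorem norm_lerchError_le (hα : 0 < α) (hα1 : α ≤ 1) (h0 : 0 < lam) (h1 : lam < 1)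
    (hs : 0 ≤ s.re) (hs1 : s.re ≤ 1) (hx : 1 ≤ x) (hy : 1 ≤ y)
    (hxy : 2 * Real.pi * x * y = |s.im|) :
    ‖lerchError α lam x y s‖ ≤ 4100 * (x ^ (-s.re) + x ^ (1 - s.re) / √|s.im|) := by
  have ht : 0 < |s.im| := by rw [← hxy]; positivity
  have upper : ∀ lam : ℝ, 0 < lam → lam < 1 → ∀ w : ℂ, w.im = |s.im| → 0 ≤ w.re → w.re ≤ 1 →
      ‖lerchError α lam x y w‖ ≤ 4100 * (x ^ (-w.re) + x ^ (1 - w.re) / √|s.im|) :=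
    fun lam h0 h1 w hw => norm_le_of_forall_mem_Ioo (by linarith)
      (fun z hz => differentiableAt_lerchError hα h0 h1 x y (by rw [hz]; exact ht.ne'))
      (fun z hz hz0 hz1 => by
        have := norm_lerchError_le_of_mem_Ioo hα hα1 h0 h1 hz0 hz1 hx hy (hxy.trans hz.symm)
        rwa [hz] at this) hw
  rcases abs_choice s.im with h | h
  · exact upper lam h0 h1 s h.symm hs hs1
  · have := upper (1 - lam) (by linarith) (by linarith) ((starRingEnd ℂ) s) (by simp [h]) (by simpa)
      (by simpa)
    rwa [← conj_lerchError hα h0 h1, norm_conj, conj_re] at this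

theorem norm_hurwitzError_le (hα : 0 < α) (hα1 : α ≤ 1)
    (hs : 0 ≤ s.re) (hs1 : s.re ≤ 1) (hx : 1 ≤ x) (hy : 1 ≤ y)
    (hxy : 2 * Real.pi * x * y = |s.im|) :
    ‖hurwitzError α x y s‖ ≤ 4100 * (x ^ (-s.re) + x ^ (1 - s.re) / √|s.im|) := by
  have ht : 0 < |s.im| := by rw [← hxy]; positivity
  have upper : ∀ w : ℂ, w.im = |s.im| → 0 ≤ w.re → w.re ≤ 1 →
      ‖hurwitzError α x y w‖ ≤ 4100 * (x ^ (-w.re) + x ^ (1 - w.re) / √|s.im|) :=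
    fun w hw => norm_le_of_forall_mem_Ioo (by linarith)
      (fun z hz => differentiableAt_hurwitzError hα x y (by rw [hz]; exact ht.ne'))
      (fun z hz hz0 hz1 => by
        have := norm_hurwitzError_le_of_mem_Ioo hα hα1 hz0 hz1 hx hy (hxy.trans hz.symm)
        rwa [hz] at this) hw
  have hne : s ≠ 1 := fun h => by rw [h] at ht; simp at ht
  rcases abs_choice s.im with h | h
  · exact upper s h.symm hs hs1
  · have := upper ((starRingEnd ℂ) s) (by simp [h]) (by simpa) (by simpa)
    rwa [← conj_hurwitzError hα hα1 x y hne, norm_conj, conj_re] at this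

/-- The dual terms with `ε = 1` as summands of the first dual sum of the Lerch zeta-function. -/
theorem dual_one_add (s : ℂ) (α : ℝ) (hl : 0 ≤ lam) (n : ℕ) :
    dual s α 1 (lam + n) = Gamma (1 - s) / (2 * Real.pi : ℂ) ^ (1 - s) *
      (cexp (((1 - s) / 2 - 2 * α * lam) * Real.pi * I) *
        (cexp (2 * Real.pi * I * n * (1 - α)) / ((n : ℂ) + lam) ^ (1 - s))) := by
  rw [dual_eq_mul_div s α (by positivity), ← mul_div_assoc (cexp _), ← Complex.exp_add]
  congr 2
  · rw [exp_eq_exp_iff_exists_int]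
    exact ⟨-n, by push_cast; ring⟩
  · congr 1; push_cast; ring

/-- The dual terms with `ε = -1` as summands of the second dual sum of the Lerch zeta-function. -/
theorem dual_neg_one_sub (s : ℂ) (α : ℝ) (hl : lam ≤ 1) (n : ℕ) :
    dual s α (-1) (lam - 1 - n) = Gamma (1 - s) / (2 * Real.pi : ℂ) ^ (1 - s) *
      (cexp ((-(1 - s) / 2 + 2 * α * (1 - lam)) * Real.pi * I) *
        (cexp (2 * Real.pi * I * n * α) / ((n : ℂ) + 1 - lam) ^ (1 - s))) := by
  have h : (0 : ℝ) ≤ -1 * (lam - 1 - n) := by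
    have : (0 : ℝ) ≤ n := by positivity
    linarith
  rw [dual_eq_mul_div s α h, ← mul_div_assoc (cexp _), ← Complex.exp_add]
  congr 2
  · congr 1
    push_cast; ring
  · congr 1; push_cast; ring

theorem dual_one_natCast_add_one (s : ℂ) (α : ℝ) (n : ℕ) :
    dual s α 1 (n + 1) = Gamma (1 - s) / (2 * Real.pi : ℂ) ^ (1 - s) *
      (cexp (Real.pi * I / 2 * (1 - s)) *
        (cexp (2 * Real.pi * I * (n + 1 : ℕ) * (1 - α)) / ((n + 1 : ℕ) : ℂ) ^ (1 - s))) := by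
  have h := dual_one_add s α le_rfl (n + 1)
  rw [zero_add, ofReal_zero, add_zero,
    show ((1 - s) / 2 - 2 * α * 0) * Real.pi * I = Real.pi * I / 2 * (1 - s) by ring] at h
  rw [← h]; push_cast; rfl

theorem dual_neg_one_natCast_add_one (s : ℂ) (α : ℝ) (n : ℕ) :
    dual s α (-1) (-(n + 1)) = Gamma (1 - s) / (2 * Real.pi : ℂ) ^ (1 - s) *
      (cexp (-(Real.pi * I / 2) * (1 - s)) *
        (cexp (2 * Real.pi * I * (n + 1 : ℕ) * α) / ((n + 1 : ℕ) : ℂ) ^ (1 - s))) := by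
  have h := dual_neg_one_sub s α le_rfl (n + 1)
  rw [sub_self, zero_sub, ofReal_one, add_sub_cancel_right, show
    (-(1 - s) / 2 + 2 * α * (1 - 1)) * Real.pi * I = -(Real.pi * I / 2) * (1 - s) by ring] at h
  rw [← h]; push_cast; rfl

/-- The right side equals `(2πx) ^ (1 - σ) / √t`. -/
theorem rpow_div_sqrt_le (hx : 1 ≤ x) (hy : 1 ≤ y) {t σ : ℝ} (hσ : σ ≤ 1)
    (hxy : 2 * Real.pi * x * y = t) :
    x ^ (1 - σ) / √t ≤ t ^ (1 / 2 - σ) * y ^ (σ - 1) := by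
  have ht : 0 < t := by rw [← hxy]; positivity
  have hy0 : 0 < y := by linarith
  have e : t ^ (1 / 2 - σ) * y ^ (σ - 1) = (t / y) ^ (1 - σ) / √t := by
    rw [Real.sqrt_eq_rpow, Real.div_rpow ht.le hy0.le, show 1 / 2 - σ = (1 - σ) - 1 / 2 by ring,
      Real.rpow_sub ht, show σ - 1 = -(1 - σ) by ring, Real.rpow_neg hy0.le]
    ring
  rw [e]
  have hσ' : 0 ≤ 1 - σ := by linarith
  gcongr
  · rw [le_div_iff₀ hy0, ← hxy]
    have := Real.pi_gt_three
    have : 1 * (x * y) ≤ 2 * Real.pi * (x * y) := by gcongr; linarith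
    linarith

end error
end LerchAFE

theorem theorem2 :
    (∃ C : ℝ, ∀ (α lam : ℝ) (s : ℂ) (x y : ℝ),
      0 < α → α ≤ 1 → 0 < lam → lam < 1 → 0 ≤ s.re → s.re ≤ 1 → 1 ≤ x → 1 ≤ y →
      2 * Real.pi * x * y = |s.im| →
      ‖lerchZeta α lam s -
          ((∑ n ∈ Finset.Icc 0 ⌊x⌋₊, Complex.exp (2 * Real.pi * Complex.I * n * lam) / ((n : ℂ) + α) ^ s) +
            Complex.Gamma (1 - s) / (2 * Real.pi : ℂ) ^ (1 - s) *
              (Complex.exp (((1 - s) / 2 - 2 * α * lam) * Real.pi * Complex.I) *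
                  (∑ n ∈ Finset.Icc 0 ⌊y⌋₊,
                    Complex.exp (2 * Real.pi * Complex.I * n * (1 - α)) / ((n : ℂ) + lam) ^ (1 - s)) +
                Complex.exp ((-(1 - s) / 2 + 2 * α * (1 - lam)) * Real.pi * Complex.I) *
                  (∑ n ∈ Finset.Icc 0 ⌊y⌋₊,
                    Complex.exp (2 * Real.pi * Complex.I * n * α) / ((n : ℂ) + 1 - lam) ^ (1 - s))))‖
        ≤ C * (x ^ (-s.re) + |s.im| ^ (1 / 2 - s.re) * y ^ (s.re - 1))) ∧
    (∃ C : ℝ, ∀ (α : ℝ) (s : ℂ) (x y : ℝ),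
      0 < α → α ≤ 1 → 0 ≤ s.re → s.re ≤ 1 → 1 ≤ x → 1 ≤ y →
      2 * Real.pi * x * y = |s.im| →
      ‖HurwitzZeta.hurwitzZeta (α : UnitAddCircle) s -
          ((∑ n ∈ Finset.Icc 0 ⌊x⌋₊, 1 / ((n : ℂ) + α) ^ s) +
            Complex.Gamma (1 - s) / (2 * Real.pi : ℂ) ^ (1 - s) *
              (Complex.exp (Real.pi * Complex.I / 2 * (1 - s)) *
                  (∑ n ∈ Finset.Icc 1 ⌊y⌋₊,
                    Complex.exp (2 * Real.pi * Complex.I * n * (1 - α)) / (n : ℂ) ^ (1 - s)) +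
                Complex.exp (-(Real.pi * Complex.I / 2) * (1 - s)) *
                  (∑ n ∈ Finset.Icc 1 ⌊y⌋₊,
                    Complex.exp (2 * Real.pi * Complex.I * n * α) / (n : ℂ) ^ (1 - s))))‖
        ≤ C * (x ^ (-s.re) + |s.im| ^ (1 - s.re) * y ^ (s.re - 1))) := by
  have hIcc : ∀ N : ℕ, Finset.Icc 0 N = Finset.range (N + 1) := fun N => by
    ext; simp
  refine ⟨⟨4100, fun α lam s x y hα hα1 h0 h1 hs hs1 hx hy hxy => ?_⟩,
    ⟨4100, fun α s x y hα hα1 hs hs1 hx hy hxy => ?_⟩⟩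
  · have key := LerchAFE.norm_lerchError_le hα hα1 h0 h1 hs hs1 hx hy hxy
    have hR := LerchAFE.rpow_div_sqrt_le hx hy hs1 hxy
    refine le_trans (le_of_eq (congrArg norm ?_)) (key.trans (by gcongr))
    simp only [LerchAFE.lerchError, LerchAFE.osc_natCast_add, LerchAFE.dual_one_add s α h0.le,
      LerchAFE.dual_neg_one_sub s α h1.le, hIcc, ← Finset.mul_sum]
    ring
  · have key := LerchAFE.norm_hurwitzError_le hα hα1 hs hs1 hx hy hxy
    have hR := LerchAFE.rpow_div_sqrt_le hx hy hs1 hxy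
    have ht1 : 1 ≤ |s.im| := by
      rw [← hxy, mul_assoc]
      have := Real.pi_gt_three
      exact one_le_mul_of_one_le_of_one_le (by linarith) (one_le_mul_of_one_le_of_one_le hx hy)
    have hR2 : |s.im| ^ (1 / 2 - s.re) ≤ |s.im| ^ (1 - s.re) :=
      Real.rpow_le_rpow_of_exponent_le ht1 (by linarith)
    have hR3 : |s.im| ^ (1 / 2 - s.re) * y ^ (s.re - 1) ≤ |s.im| ^ (1 - s.re) * y ^ (s.re - 1) := by
      gcongr
    refine le_trans (le_of_eq (congrArg norm ?_)) (key.trans (by gcongr; exact hR.trans hR3))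
    have hIcc1 : ∀ (N : ℕ) (f : ℕ → ℂ), ∑ n ∈ Finset.Icc 1 N, f n =
        ∑ n ∈ Finset.range N, f (n + 1) := fun N f => by
      rw [Finset.range_eq_Ico, Finset.sum_Ico_add' f 0 N 1]
      rfl
    simp only [LerchAFE.hurwitzError, LerchAFE.osc_natCast_add, LerchAFE.dual_one_natCast_add_one,
      LerchAFE.dual_neg_one_natCast_add_one, hIcc, hIcc1,
      ← Finset.mul_sum, Complex.ofReal_zero, mul_zero, Complex.exp_zero]
    ring
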